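/- Let $R$ be a commutative unital ring, let $(V,\partial_V)$ and $(W,\partial_W)$ be ($\mathbb Z$-graded) chain complexes of $R$-modules, let $f:V\to W$ and $g:W\to V$ be chain maps, and let $h:V\to V$ be a degree $1$ map with $\partial_V h+h\partial_V=gf-\mathrm{id}_V$. **Conventions.** Tensor products of maps are evaluated by the Koszul sign rule: $(F_1\otimes\cdots\otimes F_k)$ evaluated at elements acquires the sign $-1$ each time an odd $F_j$ passes an odd argument. For an $n$-multilinear map $F$ of degree $d$ put $\delta F=\partial F-(-1)^d\sum_{i=1}^nF(\mathrm{id}^{\otimes i-1}\otimes\partial\otimes\mathrm{id}^{\otimes n-i})$, and put $\vartheta(u_1,\dots,u_s)=\sum_{1\le\alpha<\beta\le s}u_\alpha(u_\beta+1)$. For integers $n$ consider the index sets $$A_n=\{(k,l,i): k+l=n+1,\ k,l\ge2,\ 1\le i\le k\},\qquad A'_n=\{(k,l,i): k+l=n+1,\ k\ge1,\ l\ge2,\ 1\le i\le k\},$$ $$B_n=\{(k,r_1,\dots,r_k): 2\le k\le n,\ r_j\ge1,\ r_1+\cdots+r_k=n\},$$ $$C_n=\{(k,i,r_1,\dots,r_i):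 2\le k\le n,\ 1\le i\le k,\ r_j\ge1,\ r_1+\cdots+r_i+k-i=n\}.$$ * An $A_\infty$-structure on $V$ is a family $\mu=(\mu_n)_{n\ge2}$ of multilinear maps $\mu_n:V^{\otimes n}\to V$ of degree $n-2$ such that for all $n\ge2$ $$\delta(\mu_n)=\sum_{A_n}(-1)^{i(l+1)+n}\mu_k(\mathrm{id}^{\otimes i-1}\otimes\mu_l\otimes\mathrm{id}^{\otimes k-i});$$ similarly for $W$. * An $A_\infty$-map $\varphi:(V,\mu)\to(W,\nu)$ is a family of multilinear maps $\varphi_n:V^{\otimes n}\to W$ ($n\ge1$) of degree $n-1$ such that for all $n\ge1$ $$\delta(\varphi_n)=-\sum_{B_n}(-1)^{\vartheta(r_1,\dots,r_k)}\nu_k(\varphi_{r_1}\otimes\cdots\otimes\varphi_{r_k})-\sum_{A'_n}(-1)^{i(l+1)+n}\varphi_k(\mathrm{id}^{\otimes i-1}\otimes\mu_l\otimes\mathrm{id}^{\otimes k-i}).$$ It extends a chain map $f$ if $\varphi_1=f$. The composite of $A_\infty$-maps is $(\psi\varphi)_n=\sum(-1)^{\vartheta(r_1,\dots,r_k)}\psi_k(\varphi_{r_1}\otimes\cdots\otimes\varphi_{r_k})$,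 summed over all $k\ge1$ and $r_j\ge1$ with $r_1+\cdots+r_k=n$. The identity $A_\infty$-map has $(\mathrm{id}_V)_1=\mathrm{id}_V$ and $(\mathrm{id}_V)_n=0$ for $n\ge2$. * An $A_\infty$-homotopy between an $A_\infty$-map $\chi:(V,\mu)\to(V,\mu)$ and $\mathrm{id}_V$ is a family of multilinear maps $H_n:V^{\otimes n}\to V$ ($n\ge1$) of degree $n$ such that for all $n\ge1$ $$\delta(H_n)=-\sum_{C_n}(-1)^{n+r_i+\vartheta(r_1,\dots,r_i)}\mu_k(\chi_{r_1}\otimes\cdots\otimes\chi_{r_{i-1}}\otimes H_{r_i}\otimes\mathrm{id}^{\otimes k-i})+\sum_{A'_n}(-1)^{n+i(l+1)}H_k(\mathrm{id}^{\otimes i-1}\otimes\mu_l\otimes\mathrm{id}^{\otimes k-i})+\chi_n-(\mathrm{id}_V)_n.$$ It extends $h$ if $H_1=h$. **Kernels.** Let $\mu$ be an $A_\infty$-structure on $V$. With the formal convention $h p_1=\mathrm{id}_V$, define inductively, for $n\ge2$ (so that $p_2=\mu_2$), $$p_n=\sum_{B_n}(-1)^{\vartheta(r_1,\dots,r_k)}\mu_k(hp_{r_1}\otimes\cdots\otimes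 hp_{r_k}),$$ for $n\ge2$ and $1\le i\le n$ $$p_n^i=\sum(-1)^{\vartheta(r_1,\dots,r_m)}\mu_{m+n-i+1}(hp_{r_1}\otimes\cdots\otimes hp_{r_m}\otimes\mathrm{id}^{\otimes n-i+1}),$$ summed over all $m\ge0$ and $r_1,\dots,r_m\ge1$ with $r_1+\cdots+r_m=i-1$ and $m+n-i+1\ge2$, and then $q_1=\mathrm{id}_V$ and, for $n\ge2$, $$q_n=\sum_{C_n}(-1)^{n+r_i+\vartheta(r_1,\dots,r_i)}p_k^i(gfq_{r_1}\otimes\cdots\otimes gfq_{r_{i-1}}\otimes hq_{r_i}\otimes\mathrm{id}^{\otimes k-i}).$$ **Theorem.** Put $\nu_n=f\circ p_n\circ g^{\otimes n}$ for $n\ge2$, $\varphi_n=f\circ q_n$ for $n\ge1$, $\psi_1=g$ and $\psi_n=h\circ p_n\circ g^{\otimes n}$ for $n\ge2$, and $H_n=h\circ q_n$ for $n\ge1$. Then $\nu$ is an $A_\infty$-structure on $W$, $\varphi:(V,\mu)\to(W,\nu)$ is an $A_\infty$-map extending $f$, $\psi:(W,\nu)\to(V,\mu)$ is an $A_\infty$-map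 extending $g$, and $H$ is an $A_\infty$-homotopy between $\psi\varphi$ and $\mathrm{id}_V$ extending $h$. -/

import Mathlib

namespace AInfinity

open CategoryTheory

universe u v

noncomputable section

variable {R : Type u} [CommRing R]

/-! ### The total graded module of a chain complex -/

/-- The total graded module `⨁ i, V_i` of a chain complex `V` (graded by all integers,
with differential of degree `-1`). -/
abbrev Tot (V : ChainComplex (ModuleCat.{v} R) ℤ) : Type v :=
  DirectSum ℤ (fun i => V.X i)

/-- The inclusion of the degree `i` component. -/
abbrev incl (V : ChainComplex (ModuleCat.{v} R) ℤ) (i : ℤ) : V.X i →ₗ[R] Tot V :=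
  DirectSum.lof R ℤ (fun i => V.X i) i

/-- The differential as an endomorphism of the total module. -/
def diff (V : ChainComplex (ModuleCat.{v} R) ℤ) : Tot V →ₗ[R] Tot V :=
  DirectSum.toModule R ℤ (Tot V) (fun i => incl V (i - 1) ∘ₗ (V.d i (i - 1)).hom)

/-- The degree `0` map of total modules induced by a chain map. -/
def chainTot {V W : ChainComplex (ModuleCat.{v} R) ℤ} (f : V ⟶ W) : Tot V →ₗ[R] Tot W :=
  DirectSum.toModule R ℤ (Tot W) (fun i => incl W i ∘ₗ (f.f i).hom)

/-- The degree `1` map of total modules given by a chain homotopy. -/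
def htpyTot {V W : ChainComplex (ModuleCat.{v} R) ℤ} {a b : V ⟶ W} (h : Homotopy a b) :
    Tot V →ₗ[R] Tot W :=
  DirectSum.toModule R ℤ (Tot W) (fun i => incl W (i + 1) ∘ₗ (h.hom i (i + 1)).hom)

/-- The Koszul sign operator: `x ↦ (-1) ^ (d * |x|) x` on homogeneous `x`. -/
def koszul (V : ChainComplex (ModuleCat.{v} R) ℤ) (d : ℤ) : Tot V →ₗ[R] Tot V :=
  DirectSum.toModule R ℤ (Tot V) (fun i => ((Int.negOnePow (d * i) : ℤˣ) : ℤ) • incl V i)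

/-! ### Multilinear operations -/

/-- `n`-multilinear operations `V^{⊗ n} → W`. -/
abbrev Op (V W : ChainComplex (ModuleCat.{v} R) ℤ) (n : ℕ) : Type _ :=
  MultilinearMap R (fun _ : Fin n => Tot V) (Tot W)

variable {V W U : ChainComplex (ModuleCat.{v} R) ℤ}

/-- The operation `F` is homogeneous of degree `d`. -/
def HasDegree {n : ℕ} (d : ℤ) (F : Op V W n) : Prop :=
  ∀ (a : Fin n → ℤ) (x : ∀ i, V.X (a i)),
    F (fun i => incl V (a i) (x i)) ∈ LinearMap.range (incl W ((∑ i, a i) + d))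

/-- The induced differential of a degree `d` operation,
`δ F = ∂ F - (-1)^d ∑ i, F (1 ⊗ ⋯ ⊗ 1 ⊗ ∂ ⊗ 1 ⊗ ⋯ ⊗ 1)`, the Koszul sign of moving `∂` past the
first arguments being produced by the operator `koszul V 1`. -/
def delta {n : ℕ} (d : ℤ) (F : Op V W n) : Op V W n :=
  (diff W).compMultilinearMap F -
    ((Int.negOnePow d : ℤˣ) : ℤ) • ∑ i : Fin n, F.compLinearMap (fun j =>
      if j < i then koszul V 1 else if j = i then diff V else LinearMap.id)

/-- The family of operations with linear part `f` and no other component. -/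
def lin (f : Tot V →ₗ[R] Tot W) : ∀ n : ℕ, Op V W n
  | 1 => MultilinearMap.ofSubsingleton R (Tot V) (Tot W) (0 : Fin 1) f
  | _ => 0

/-- The family `((id_V)_1, (id_V)_2, …) = (id, 0, 0, …)`. -/
def idOp (V : ChainComplex (ModuleCat.{v} R) ℤ) : ∀ n : ℕ, Op V V n :=
  lin LinearMap.id

/-- The composite `F ∘ (G_1 ⊗ ⋯ ⊗ G_k)`, where `G_j` has arity the `j`-th block of `c` and
degree `e j`. By the Koszul sign convention its value at homogeneous `v_1, …, v_n` is
`F (G_1 (…), …, G_k (…))` times `(-1)` to the sum over `i < j` of `e j` times the total degree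
of the arguments of `G_i`. -/
def tcomp {n : ℕ} (c : Composition n) (F : Op W U c.length)
    (e : Fin c.length → ℤ) (G : ∀ j : Fin c.length, Op V W (c.blocksFun j)) : Op V U n :=
  (F.compMultilinearMap (fun i => (G i).compLinearMap
    (fun _ => koszul V (∑ j ∈ Finset.univ.filter (fun j => i < j), e j)))).domDomCongr
      c.blocksFinEquiv

/-- `ϑ(u_1, …, u_s) = ∑_{α < β} u_α (u_β + 1)`. -/
def theta : List ℕ → ℕ
  | [] => 0
  | r :: u => r * (u.map (fun t => t + 1)).sum + theta u

/-- The sum of `(-1)^{i(l+1)+n} F_k (1^{⊗ i-1} ⊗ G_l ⊗ 1^{⊗ k-i})` over `k + l = n + 1`,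
`k ≥ kmin`, `l ≥ 2`, `1 ≤ i ≤ k`, for a family `G` with `G_l` of degree `l - 2`. A triple
`(k, l, i)` is encoded by the composition `c = (1, …, 1, l, 1, …, 1)` of `n` into `k` parts
together with the (zero-based) position of `l`. -/
def insertSum (kmin : ℕ) (F : ∀ n, Op V W n) (G : ∀ n, Op V V n) (n : ℕ) : Op V W n :=
  ∑ c : Composition n, ∑ i : Fin c.length,
    if kmin ≤ c.length ∧ 2 ≤ c.blocksFun i ∧ ∀ j, j ≠ i → c.blocksFun j = 1 then
      ((-1 : ℤ) ^ (((i : ℕ) + 1) * (c.blocksFun i + 1) + n)) •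
        tcomp c (F c.length)
          (fun j => if j = i then (c.blocksFun j : ℤ) - 2 else 0)
          (fun j => if j = i then G (c.blocksFun j) else idOp V (c.blocksFun j))
    else 0

/-- The sum of `(-1)^{ϑ(r_1, …, r_k)} F_k (G_{r_1} ⊗ ⋯ ⊗ G_{r_k})` over `kmin ≤ k ≤ n` and
`r_1 + ⋯ + r_k = n`, `r_j ≥ 1`, for a family `G` with `G_r` of degree `r - 1`. -/
def blockSum (kmin : ℕ) (F : ∀ n, Op W U n) (G : ∀ n, Op V W n) (n : ℕ) : Op V U n :=
  ∑ c : Composition n,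
    if kmin ≤ c.length then
      ((-1 : ℤ) ^ theta c.blocks) •
        tcomp c (F c.length) (fun j => (c.blocksFun j : ℤ) - 1) (fun j => G (c.blocksFun j))
    else 0

/-! ### `A_∞`-structures, `A_∞`-maps and `A_∞`-homotopies

Only the components of index at least `2` of an `A_∞`-structure and of index at least `1` of
an `A_∞`-map or of an `A_∞`-homotopy are meaningful. -/

/-- `μ = (μ_2, μ_3, …)` is an `A_∞`-structure on the chain complex `V`. -/
def IsStructure (V : ChainComplex (ModuleCat.{v} R) ℤ) (μ : ∀ n, Op V V n) : Prop :=
  ∀ n : ℕ, 2 ≤ n → HasDegree ((n : ℤ) - 2) (μ n) ∧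
    delta ((n : ℤ) - 2) (μ n) = insertSum 2 μ μ n

/-- `φ = (φ_1, φ_2, …)` is an `A_∞`-map `(V, μ) → (W, ν)`. -/
def IsMap (μ : ∀ n, Op V V n) (ν : ∀ n, Op W W n) (φ : ∀ n, Op V W n) : Prop :=
  ∀ n : ℕ, 1 ≤ n → HasDegree ((n : ℤ) - 1) (φ n) ∧
    delta ((n : ℤ) - 1) (φ n) = - blockSum 2 ν φ n - insertSum 1 φ μ n

/-- The composition of `A_∞`-maps,
`(ψφ)_n = ∑ (-1)^{ϑ(r_1, …, r_k)} ψ_k (φ_{r_1} ⊗ ⋯ ⊗ φ_{r_k})` over all `k ≥ 1`. -/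
def compMap (ψ : ∀ n, Op W U n) (φ : ∀ n, Op V W n) : ∀ n, Op V U n :=
  blockSum 1 ψ φ

/-- `H = (H_1, H_2, …)` is an `A_∞`-homotopy between the `A_∞`-endomorphism `χ` of `(V, μ)` and
the identity. The first sum runs over `2 ≤ k ≤ n`, `1 ≤ i ≤ k`, `r_1, …, r_i ≥ 1` with
`r_1 + ⋯ + r_i + k - i = n`; these data are encoded by the composition
`c = (r_1, …, r_i, 1, …, 1)` of `n` into `k` parts and the (zero-based) position of `r_i`. -/
def IsHomotopyToId (μ : ∀ n, Op V V n) (χ : ∀ n, Op V V n) (H : ∀ n, Op V V n) : Prop :=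
  ∀ n : ℕ, 1 ≤ n → HasDegree (n : ℤ) (H n) ∧
    delta (n : ℤ) (H n) =
      - (∑ c : Composition n, ∑ i : Fin c.length,
          if 2 ≤ c.length ∧ ∀ j, i < j → c.blocksFun j = 1 then
            ((-1 : ℤ) ^ (n + c.blocksFun i + theta (c.blocks.take ((i : ℕ) + 1)))) •
              tcomp c (μ c.length)
                (fun j => if j < i then (c.blocksFun j : ℤ) - 1
                  else if j = i then (c.blocksFun j : ℤ) else 0)
                (fun j => if j < i then χ (c.blocksFun j)
                  else if j = i then H (c.blocksFun j) else idOp V (c.blocksFun j))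
          else 0)
      + insertSum 1 H μ n + χ n - idOp V n

/-! ### The kernels -/

/-- In a composition with at least two parts every part is smaller than the whole. -/
theorem blocksFun_lt {n : ℕ} (c : Composition n) (hc : 2 ≤ c.length) (j : Fin c.length) :
    c.blocksFun j < n := by
  have hn : 0 < n := lt_of_lt_of_le (by omega) (hc.trans c.length_le)
  have hne : c ≠ Composition.single n hn := by
    intro h
    have := (Composition.eq_single_iff_length hn).1 h
    omega
  exact (Composition.ne_single_iff hn).1 hne j

/-- The p-kernels
`p_n = ∑ (-1)^{ϑ(r_1, …, r_k)} μ_k (h p_{r_1} ⊗ ⋯ ⊗ h p_{r_k})`, over `2 ≤ k ≤ n` and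
`r_1 + ⋯ + r_k = n`, `r_j ≥ 1`, with the convention `h p_1 = id`. In particular `p_2 = μ_2`. -/
def pKer (μ : ∀ n, Op V V n) (h : Tot V →ₗ[R] Tot V) (n : ℕ) : Op V V n :=
  ∑ c : Composition n,
    if hc : 2 ≤ c.length then
      ((-1 : ℤ) ^ theta c.blocks) •
        tcomp c (μ c.length) (fun j => (c.blocksFun j : ℤ) - 1)
          (fun j => if c.blocksFun j = 1 then idOp V (c.blocksFun j)
            else h.compMultilinearMap (pKer μ h (c.blocksFun j)))
    else 0
termination_by n
decreasing_by exact blocksFun_lt c hc j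

/-- The family `h p_n`, with the convention `h p_1 = id`. -/
def hpKer (μ : ∀ n, Op V V n) (h : Tot V →ₗ[R] Tot V) (n : ℕ) : Op V V n :=
  if n = 1 then idOp V n else h.compMultilinearMap (pKer μ h n)

/-- The operations
`p_n^i = ∑ (-1)^{ϑ(r_1, …, r_m)} μ_k (h p_{r_1} ⊗ ⋯ ⊗ h p_{r_m} ⊗ 1^{⊗ n-i+1})`, over all
`m ≥ 0`, `r_1, …, r_m ≥ 1` with `r_1 + ⋯ + r_m = i - 1` and `k = m + n - i + 1 ≥ 2`
(`1 ≤ i ≤ n`). The data are encoded by the composition `c = (r_1, …, r_m, 1, …, 1)` of `n` into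
`k` parts and the number `m < k`. -/
def piKer (μ : ∀ n, Op V V n) (h : Tot V →ₗ[R] Tot V) (n i : ℕ) : Op V V n :=
  ∑ c : Composition n, ∑ m : Fin c.length,
    if 2 ≤ c.length ∧ c.sizeUpTo m + 1 = i ∧ ∀ j, m ≤ j → c.blocksFun j = 1 then
      ((-1 : ℤ) ^ theta (c.blocks.take m)) •
        tcomp c (μ c.length)
          (fun j => if j < m then (c.blocksFun j : ℤ) - 1 else 0)
          (fun j => if j < m then hpKer μ h (c.blocksFun j) else idOp V (c.blocksFun j))
    else 0

/-- The q-kernels: `q_1 = id` and, for `n ≥ 2`,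
`q_n = ∑ (-1)^{n + r_i + ϑ(r_1, …, r_i)}
  p_k^i (gf q_{r_1} ⊗ ⋯ ⊗ gf q_{r_{i-1}} ⊗ h q_{r_i} ⊗ 1^{⊗ k-i})`
over `2 ≤ k ≤ n`, `1 ≤ i ≤ k`, `r_1, …, r_i ≥ 1` with `r_1 + ⋯ + r_i + k - i = n`, encoded as
in `IsHomotopyToId`. The argument `gf` is the composite `g ∘ f` on total modules. -/
def qKer (μ : ∀ n, Op V V n) (h gf : Tot V →ₗ[R] Tot V) (n : ℕ) : Op V V n :=
  if n = 1 then idOp V n else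
  ∑ c : Composition n, ∑ i : Fin c.length,
    if hc : 2 ≤ c.length ∧ ∀ j, i < j → c.blocksFun j = 1 then
      ((-1 : ℤ) ^ (n + c.blocksFun i + theta (c.blocks.take ((i : ℕ) + 1)))) •
        tcomp c (piKer μ h c.length ((i : ℕ) + 1))
          (fun j => if j < i then (c.blocksFun j : ℤ) - 1
            else if j = i then (c.blocksFun j : ℤ) else 0)
          (fun j => if j < i then gf.compMultilinearMap (qKer μ h gf (c.blocksFun j))
            else if j = i then h.compMultilinearMap (qKer μ h gf (c.blocksFun j))
            else idOp V (c.blocksFun j))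
    else 0
termination_by n
decreasing_by
  · exact blocksFun_lt c hc.1 j
  · exact blocksFun_lt c hc.1 j

/-! ### The transferred data -/

variable (f : V ⟶ W) (g : W ⟶ V) (h : Homotopy (f ≫ g) (𝟙 V)) (μ : ∀ n, Op V V n)

/-- `ν_n = f ∘ p_n ∘ g^{⊗ n}`. -/
def nu (n : ℕ) : Op W W n :=
  (chainTot f).compMultilinearMap ((pKer μ (htpyTot h) n).compLinearMap (fun _ => chainTot g))

/-- `φ_n = f ∘ q_n`. -/
def phi (n : ℕ) : Op V W n :=
  (chainTot f).compMultilinearMap (qKer μ (htpyTot h) (chainTot g ∘ₗ chainTot f) n)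

/-- `ψ_n = h ∘ p_n ∘ g^{⊗ n}`, with the convention `h p_1 = id`. -/
def psi (n : ℕ) : Op W V n :=
  (hpKer μ (htpyTot h) n).compLinearMap (fun _ => chainTot g)

/-- `H_n = h ∘ q_n`. -/
def bigH (n : ℕ) : Op V V n :=
  (htpyTot h).compMultilinearMap (qKer μ (htpyTot h) (chainTot g ∘ₗ chainTot f) n)

end

end AInfinity

/-! The proof moves everything to tensor coalgebras. After a suspension, which twists each operation
by signs, a family of multilinear maps is one linear map on the tensor coalgebra, and sums over
compositions become convolution products. The sign `(-1)^ϑ` is exactly what the suspension produces,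
so it disappears (`susp_tcomp_even`, `susp_tcomp_odd`). An even corestriction `C` without constant
term extends to a coalgebra map `hat C`, written `Ĉ` here. An odd one `b` extends to a coderivation
`b̂ = coder τ b`, where `τ` is the parity operator that carries the remaining Koszul signs. An
A∞-structure is a `b = D + β`, with `β` free of linear terms, such that `b ∘ b̂ = 0`. An A∞-map is a
`C` with `b' ∘ Ĉ = C ∘ b̂`. A homotopy from `χ` to the identity is an `H` with `b ∘ K + H ∘ b̂ = χ -
proj`, where `K = τχ̂ ⋆ ιH ⋆ id`.

The kernels solve fixed point equations: `P = proj + h p` and `p = β P̂` (`fam_hpKer`, `fam_pKer`),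
and `q = proj + β K` with `H = h q` and `χ = ψ φ̂` (`fam_qKer`). The last one holds because `p_k^i`
applies `P̂` to its first `i - 1` inputs, and `P̂ ĝ φ̂ = χ̂`.

For the `p`-kernels put `d = D + gf p` (with `D` read as `D ∘ proj`) and let `E = b P̂ - P d̂`. The
equations `b b̂ = 0` and `D h + h D = gf - 1` give `E = h β (P̂τ ⋆ ιE ⋆ P̂)`. Since `β` has no
linear part, the right side on a word evaluates `E` only on shorter words, hence `E = 0`. It also
follows that `D p + p d̂ = 0`; transporting along `f` and `g` yields `ν` and `ψ`
(`pKernel_identity`, `transfer_structure`).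

For the `q`-kernels a single defect `C = D q + β χ̂ - q b̂` governs everything: `φ` fails to be an
A∞-map by `f C`, the homotopy equation fails by `-h C`, and the failure of `χ` is linear in `C`. The
equation `b b̂ K = 0` expresses `C` through these failures on shorter words, so `C = 0`
(`transfer_map_homotopy`). -/

namespace AInfinity

/-! ### Sums over the ways of cutting a word into nonempty blocks -/

section Compositions

/-- A sum over compositions of `n + 1` is a sum over the first block and the remaining blocks. -/
theorem sum_composition_succ {A : Type*} [AddCommMonoid A] (n : ℕ) (f : List ℕ → A) :
    ∑ c : Composition (n + 1), f c.blocks =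
      ∑ r ∈ Finset.range (n + 1), ∑ c : Composition (n - r), f ((r + 1) :: c.blocks) := by
  rw [Finset.sum_sigma']
  symm
  refine Finset.sum_bij (fun x hx => ⟨(x.1 + 1) :: x.2.blocks, ?_, ?_⟩) ?_ ?_ ?_ ?_
  · intro i hi
    rcases List.mem_cons.1 hi with rfl | hi
    · omega
    · exact x.2.blocks_pos hi
  · have := x.2.blocks_sum
    simp at hx
    simp only [List.sum_cons, this]
    omega
  · simp
  · rintro ⟨a, c⟩ ha ⟨b, d⟩ hb h
    simp only [Composition.mk.injEq, List.cons.injEq, Nat.add_right_cancel_iff] at h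
    obtain ⟨rfl, h⟩ := h
    congr 1
    ext1
    exact h
  · rintro ⟨bl, pos, hs⟩ -
    rcases bl with _ | ⟨b, bl⟩
    · simp at hs
    · have hb : 0 < b := pos (by simp)
      rw [List.sum_cons] at hs
      refine ⟨⟨b - 1, ⟨bl, fun h => pos (by simp [h]), by omega⟩⟩, by simp; omega, ?_⟩
      simp only [Composition.mk.injEq, List.cons.injEq, and_true]
      omega
  · intros; rfl

/-- The sum of `f` over all ways of cutting the list `l` into `n` letters along a composition. -/
def splitSum {α A : Type*} [AddCommMonoid A] (n : ℕ) (l : List α) (f : List (List α) → A) : A :=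
  ∑ c : Composition n, f (l.splitWrtComposition c)

theorem splitSum_zero {α A : Type*} [AddCommMonoid A] (l : List α) (f : List (List α) → A) :
    splitSum 0 l f = f [] := by
  have h (c : Composition 0) : f (l.splitWrtComposition c) = f [] := by
    rw [List.splitWrtComposition, c.blocks_eq_nil.2 rfl]
    rfl
  rw [splitSum, Finset.sum_congr rfl fun c _ => h c, Finset.sum_const, Finset.card_univ,
    composition_card, pow_zero, one_smul]

theorem splitSum_succ {α A : Type*} [AddCommMonoid A] (n : ℕ) (l : List α)
    (f : List (List α) → A) :
    splitSum (n + 1) l f = ∑ r ∈ Finset.range (n + 1),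
      splitSum (n - r) (l.drop (r + 1)) (fun ps => f (l.take (r + 1) :: ps)) := by
  unfold splitSum List.splitWrtComposition
  rw [sum_composition_succ n (fun b => f (l.splitWrtCompositionAux b))]
  simp only [List.splitWrtCompositionAux_cons]

theorem splitSum_length {α A : Type*} [AddCommMonoid A] {l : List α} (hl : l ≠ [])
    (f : List (List α) → A) :
    splitSum l.length l f = ∑ r ∈ Finset.range l.length,
      splitSum (l.drop (r + 1)).length (l.drop (r + 1)) (fun ps => f (l.take (r + 1) :: ps)) := by
  obtain ⟨n, hn⟩ : ∃ n, l.length = n + 1 := ⟨l.length - 1, by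
    have := List.length_pos_iff.2 hl; omega⟩
  rw [hn, splitSum_succ]
  refine Finset.sum_congr rfl fun r _ => ?_
  rw [List.length_drop, hn, Nat.add_sub_add_right]

theorem splitSum_mul {α A : Type*} [Ring A] (n : ℕ) (l : List α) (a : A)
    (f : List (List α) → A) : splitSum n l (fun ps => a * f ps) = a * splitSum n l f := by
  simp [splitSum, Finset.mul_sum]

theorem splitSum_add {α A : Type*} [AddCommMonoid A] (n : ℕ) (l : List α)
    (f f' : List (List α) → A) :
    splitSum n l (fun ps => f ps + f' ps) = splitSum n l f + splitSum n l f' := by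
  simp [splitSum, Finset.sum_add_distrib]

/-- Induction over lists by cutting off a nonempty prefix. -/
theorem drop_induction {α : Type*} {p : List α → Prop} (h0 : p [])
    (h1 : ∀ l : List α, l ≠ [] → (∀ r, p (l.drop (r + 1))) → p l) (l : List α) : p l := by
  induction hn : l.length using Nat.strong_induction_on generalizing l with
  | _ n ih =>
    by_cases hl : l = []
    · exact hl ▸ h0
    · refine h1 l hl fun r => ih _ ?_ _ rfl
      have := List.length_pos_iff.2 hl
      rw [List.length_drop]
      omega

/-- A solution of the recursion for a geometric series is a sum over compositions. -/
theorem geom_eq_splitSum {α A : Type*} [Ring A] {x X : List α → A} (h0 : X [] = 1)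
    (h1 : ∀ l ≠ [], X l = ∑ r ∈ Finset.range l.length, x (l.take (r + 1)) * X (l.drop (r + 1)))
    (l : List α) : X l = splitSum l.length l (fun ps => (ps.map x).prod) := by
  induction l using drop_induction with
  | h0 => simp [h0, splitSum_zero]
  | h1 l hl ih =>
    rw [h1 l hl, splitSum_length hl]
    refine Finset.sum_congr rfl fun r _ => ?_
    simp only [List.map_cons, List.prod_cons]
    rw [splitSum_mul, ih]

theorem splitSum_geom {α A : Type*} [Ring A] (x : List α → A) {l : List α} (hl : l ≠ []) :
    splitSum l.length l (fun ps => (ps.map x).prod) =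
      ∑ r ∈ Finset.range l.length, x (l.take (r + 1)) *
        splitSum (l.drop (r + 1)).length (l.drop (r + 1)) (fun ps => (ps.map x).prod) := by
  rw [splitSum_length hl]
  simp only [List.map_cons, List.prod_cons, splitSum_mul]

/-- The sum over all `i` of the products `x ⋯ x y z ⋯ z` with `y` in position `i`. -/
def midProd {β A : Type*} [Ring A] (x y z : β → A) : List β → A
  | [] => 0
  | p :: ps => y p * (ps.map z).prod + x p * midProd x y z ps

theorem midProd_ofFn {β A : Type*} [Ring A] (x y z : β → A) {k : ℕ} (q : Fin k → β) :
    midProd x y z (List.ofFn q) = ∑ i : Fin k,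
      (List.ofFn fun j => if j < i then x (q j) else if j = i then y (q j) else z (q j)).prod := by
  induction k with
  | zero => simp [midProd]
  | succ k ih =>
    rw [List.ofFn_succ, midProd, Fin.sum_univ_succ, ih, Finset.mul_sum]
    congr 1
    · rw [List.ofFn_succ, List.prod_cons, List.map_ofFn]
      simp [Function.comp_def, Fin.succ_ne_zero]
    · refine Finset.sum_congr rfl fun i _ => ?_
      rw [List.ofFn_succ, List.prod_cons]
      simp [Fin.succ_pos]

/-- The recursion for `K` looks at the first block: either it is the distinguished one, and `Z`
takes the rest, or it lies before it, and the recursion continues. -/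
theorem mid_eq_splitSum {α A : Type*} [Ring A] {x y z Z K : List α → A} (hZ0 : Z [] = 1)
    (hZ : ∀ l ≠ [], Z l = ∑ r ∈ Finset.range l.length, z (l.take (r + 1)) * Z (l.drop (r + 1)))
    (hK0 : K [] = 0)
    (hK : ∀ l ≠ [], K l = ∑ r ∈ Finset.range l.length,
      (y (l.take (r + 1)) * Z (l.drop (r + 1)) + x (l.take (r + 1)) * K (l.drop (r + 1))))
    (l : List α) : K l = splitSum l.length l (midProd x y z) := by
  induction l using drop_induction with
  | h0 => simp [hK0, splitSum_zero, midProd]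
  | h1 l hl ih =>
    rw [hK l hl, splitSum_length hl]
    refine Finset.sum_congr rfl fun r _ => ?_
    simp only [midProd]
    rw [splitSum_add, splitSum_mul, splitSum_mul, ← ih, ← geom_eq_splitSum hZ0 hZ]

/-- The product `x ⋯ x z ⋯ z`, where the factors `x` take up exactly the first `i` letters and
there is at least one factor `z`. -/
def prefixProd {α A : Type*} [Ring A] (x z : List α → A) : ℕ → List (List α) → A
  | _, [] => 0
  | i, p :: ps => (if i = 0 then ((p :: ps).map z).prod else 0) +
      if p.length ≤ i then x p * prefixProd x z (i - p.length) ps else 0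

theorem prefixProd_ofFn {α A : Type*} [Ring A] (x z : List α → A) {k : ℕ} (i : ℕ)
    (q : Fin k → List α) :
    prefixProd x z i (List.ofFn q) = ∑ m : Fin k,
      if (((List.ofFn q).map List.length).take m).sum = i then
        (List.ofFn fun j => if j < m then x (q j) else z (q j)).prod else 0 := by
  induction k generalizing i with
  | zero => simp [prefixProd]
  | succ k ih =>
    rw [List.ofFn_succ, prefixProd, Fin.sum_univ_succ, ih]
    congr 1
    · rw [List.ofFn_succ, List.prod_cons, List.map_cons, List.map_ofFn]
      simp [Function.comp_def, eq_comm]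
    · rw [Finset.mul_sum]
      split_ifs with h
      · refine Finset.sum_congr rfl fun m _ => ?_
        simp only [List.map_cons, Fin.val_succ, List.take_succ_cons, List.sum_cons]
        rw [mul_ite, mul_zero, List.ofFn_succ, List.prod_cons]
        simp only [Fin.succ_pos, if_true, Fin.succ_lt_succ_iff]
        congr 1
        apply propext
        omega
      · symm
        refine Finset.sum_eq_zero fun m _ => if_neg ?_
        simp only [List.map_cons, Fin.val_succ, List.take_succ_cons, List.sum_cons]
        omega

/-- Expanding both factors cuts the first `i` letters and the remaining letters independently, which
is the same as cutting the whole word with a block boundary after letter `i`. The bound on `i`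
guarantees a block after that boundary. -/
theorem prefix_eq_splitSum {α A : Type*} [Ring A] {x z X Z : List α → A} (hX0 : X [] = 1)
    (hX : ∀ l ≠ [], X l = ∑ r ∈ Finset.range l.length, x (l.take (r + 1)) * X (l.drop (r + 1)))
    (hZ0 : Z [] = 1)
    (hZ : ∀ l ≠ [], Z l = ∑ r ∈ Finset.range l.length, z (l.take (r + 1)) * Z (l.drop (r + 1)))
    (l : List α) {i : ℕ} (hi : i < l.length) :
    X (l.take i) * Z (l.drop i) = splitSum l.length l (prefixProd x z i) := by
  induction l using drop_induction generalizing i with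
  | h0 => simp at hi
  | h1 l hl ih =>
    rw [splitSum_length hl]
    simp only [prefixProd, splitSum_add]
    rcases Nat.eq_zero_or_pos i with rfl | hi0
    · simp only [if_true, List.map_cons, List.prod_cons]
      rw [List.take_zero, hX0, one_mul, List.drop_zero, hZ l hl]
      refine Finset.sum_congr rfl fun r hr => ?_
      rw [splitSum_mul, ← geom_eq_splitSum hZ0 hZ]
      simp [splitSum, hl]
    · have hne : l.take i ≠ [] := by
        rw [← List.length_pos_iff, List.length_take]; omega
      rw [hX _ hne, Finset.sum_mul]
      have hlen : (l.take i).length = i := by rw [List.length_take]; omega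
      rw [hlen]
      -- A first block longer than `i` would straddle the boundary; such blocks contribute zero, so
      -- only the first `i` values of `r` matter.
      rw [← Finset.sum_subset (Finset.range_subset_range.2 hi.le)]
      · refine Finset.sum_congr rfl fun r hr => ?_
        simp only [Finset.mem_range] at hr
        have hl1 : (l.take (r + 1)).length = r + 1 := by rw [List.length_take]; omega
        simp only [if_neg hi0.ne', hl1, if_pos (show r + 1 ≤ i by omega)]
        rw [splitSum_mul,
          ← ih r (by rw [List.length_drop]; omega)]
        have : splitSum (l.drop (r + 1)).length (l.drop (r + 1))
          (fun _ : List (List α) => (0 : A)) = 0 := by simp [splitSum]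
        rw [this, zero_add, List.take_take, List.drop_take, List.drop_drop, mul_assoc]
        congr 4 <;> omega
      · intro r hr hr'
        simp only [Finset.mem_range] at hr hr'
        have hl1 : (l.take (r + 1)).length = r + 1 := by rw [List.length_take]; omega
        simp only [if_neg hi0.ne', hl1, if_neg (show ¬ r + 1 ≤ i by omega)]
        simp [splitSum]

/-- The recursions above live on lists, the operations on functions on `Fin n`; this identifies the
two descriptions of a block. -/
theorem splitWrtComposition_ofFn {α : Type*} {n : ℕ} (v : Fin n → α) (c : Composition n) :
    (List.ofFn v).splitWrtComposition c =
      List.ofFn fun i => List.ofFn fun j => v (c.embedding i j) := by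
  refine List.ext_getElem (by simp) fun i h1 h2 => ?_
  rw [List.getElem_splitWrtComposition, List.getElem_ofFn]
  have hi : i < c.length := by simpa using h2
  have hs := c.sizeUpTo_succ hi
  have hle := c.sizeUpTo_le (i + 1)
  refine List.ext_getElem ?_ fun j h3 h4 => ?_
  · simp only [List.length_drop, List.length_take, List.length_ofFn, Composition.blocksFun]
    simp only [List.get_eq_getElem]
    omega
  · simp only [List.getElem_drop, List.getElem_take, List.getElem_ofFn]
    rfl

theorem splitSum_ofFn {α A : Type*} [AddCommMonoid A] {n : ℕ} (v : Fin n → α)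
    (f : List (List α) → A) :
    splitSum n (List.ofFn v) f = ∑ c : Composition n,
      f (List.ofFn fun i => List.ofFn fun j => v (c.embedding i j)) := by
  simp only [splitSum, splitWrtComposition_ofFn]

end Compositions

/-! ### Words, deconcatenation, convolution and geometric series -/

section TensorCoalgebra

open TensorProduct

variable {R : Type*} [CommRing R] {L M N A B : Type*} [AddCommGroup L] [Module R L]
  [AddCommGroup M] [Module R M] [AddCommGroup N] [Module R N] [Ring A] [Algebra R A]
  [Ring B] [Algebra R B]

/-- The word with the given letters in the tensor algebra. -/
def word (R : Type*) [CommRing R] {M : Type*} [AddCommGroup M] [Module R M] (l : List M) :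
    TensorAlgebra R M :=
  (l.map (TensorAlgebra.ι R)).prod

@[simp] theorem word_nil : word R ([] : List M) = 1 := rfl

@[simp] theorem word_cons (v : M) (l : List M) :
    word R (v :: l) = TensorAlgebra.ι R v * word R l := by simp [word]

theorem word_singleton (v : M) : word R [v] = TensorAlgebra.ι R v := by simp

theorem word_ofFn {n : ℕ} (v : Fin n → M) : word R (List.ofFn v) = TensorAlgebra.tprod R M n v := by
  rw [word, List.map_ofFn, TensorAlgebra.tprod_apply]
  rfl

/-- Induction on elements of the tensor algebra by multiplication by letters on the left. -/
theorem letter_induction {p : TensorAlgebra R M → Prop} (one : p 1)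
    (letter : ∀ v x, p x → p (TensorAlgebra.ι R v * x)) (add : ∀ x y, p x → p y → p (x + y))
    (smul : ∀ (r : R) x, p x → p (r • x)) (x : TensorAlgebra R M) : p x := by
  suffices h : ∀ y, p y → p (x * y) by simpa using h 1 one
  induction x using TensorAlgebra.induction with
  | algebraMap r => intro y hy; rw [← Algebra.smul_def]; exact smul r y hy
  | ι v => exact letter v
  | mul a b ha hb => intro y hy; rw [mul_assoc]; exact ha _ (hb _ hy)
  | add a b ha hb => intro y hy; rw [add_mul]; exact add _ _ (ha _ hy) (hb _ hy)

theorem linearMap_ext_letter {F G : TensorAlgebra R M →ₗ[R] N} (one : F 1 = G 1)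
    (letter : ∀ v x, F x = G x → F (TensorAlgebra.ι R v * x) = G (TensorAlgebra.ι R v * x)) :
    F = G := by
  ext x
  induction x using letter_induction with
  | one => exact one
  | letter v x hx => exact letter v x hx
  | add x y hx hy => rw [map_add, map_add, hx, hy]
  | smul r x hx => rw [map_smul, map_smul, hx]

theorem linearMap_ext_word {F G : TensorAlgebra R M →ₗ[R] N}
    (h : ∀ l, F (word R l) = G (word R l)) : F = G := by
  let S : Submodule R (TensorAlgebra R M) := Submodule.span R (Set.range (word R))
  have hS (x : TensorAlgebra R M) : x ∈ S := by
    induction x using letter_induction with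
    | one => exact Submodule.subset_span ⟨[], rfl⟩
    | letter v x hx =>
      induction hx using Submodule.span_induction with
      | mem x hx =>
        obtain ⟨l, rfl⟩ := hx
        exact Submodule.subset_span ⟨v :: l, word_cons v l⟩
      | zero => rw [mul_zero]; exact S.zero_mem
      | add x y _ _ hx hy => rw [mul_add]; exact S.add_mem hx hy
      | smul r x _ hx => rw [mul_smul_comm]; exact S.smul_mem _ hx
    | add x y hx hy => exact S.add_mem hx hy
    | smul r x hx => exact S.smul_mem _ hx
  ext x
  induction hS x using Submodule.span_induction with
  | mem x hx => obtain ⟨l, rfl⟩ := hx; exact h l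
  | zero => simp
  | add x y _ _ hx hy => rw [map_add, map_add, hx, hy]
  | smul r x _ hx => rw [map_smul, map_smul, hx]

/-- The linear map on the tensor algebra with prescribed multilinear components. -/
noncomputable def ofFamily (F : ∀ n : ℕ, MultilinearMap R (fun _ : Fin n => M) N) :
    TensorAlgebra R M →ₗ[R] N :=
  DirectSum.toModule R ℕ N (fun n => PiTensorProduct.lift (F n)) ∘ₗ
    TensorAlgebra.toDirectSum.toLinearMap

@[simp] theorem ofFamily_word_ofFn (F : ∀ n : ℕ, MultilinearMap R (fun _ : Fin n => M) N) {n : ℕ}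
    (v : Fin n → M) : ofFamily F (word R (List.ofFn v)) = F n v := by
  rw [word_ofFn, ofFamily, LinearMap.comp_apply, AlgHom.toLinearMap_apply,
    TensorAlgebra.toDirectSum_tensorPower_tprod, ← DirectSum.lof_eq_of R,
    DirectSum.toModule_lof, PiTensorProduct.lift.tprod]

theorem linearMap_ext_ofFn {F G : TensorAlgebra R M →ₗ[R] N}
    (h : ∀ (n : ℕ) (v : Fin n → M), F (word R (List.ofFn v)) = G (word R (List.ofFn v))) :
    F = G := by
  refine linearMap_ext_word fun l => ?_
  simpa using h l.length l.get

/-! ### Deconcatenation -/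

/-- The map `(x, t) ↦ (v x, (v ⊗ 1) t + 1 ⊗ v x)`. -/
noncomputable def deconcStep : M →ₗ[R] Module.End R
    (TensorAlgebra R M × (TensorAlgebra R M ⊗[R] TensorAlgebra R M)) where
  toFun v :=
    ((LinearMap.mulLeft R (TensorAlgebra.ι R v)) ∘ₗ LinearMap.fst R _ _).prod
      (LinearMap.mulLeft R (TensorAlgebra.ι R v ⊗ₜ[R] 1) ∘ₗ LinearMap.snd R _ _ +
        Algebra.TensorProduct.includeRight.toLinearMap ∘ₗ
          (LinearMap.mulLeft R (TensorAlgebra.ι R v)) ∘ₗ LinearMap.fst R _ _)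
  map_add' v w := by
    refine LinearMap.ext fun x => Prod.ext ?_ ?_
    · simp [add_mul]
    · simp [add_mul, TensorProduct.add_tmul, TensorProduct.tmul_add]
      abel
  map_smul' r v := by
    refine LinearMap.ext fun x => Prod.ext ?_ ?_
    · simp
    · simp [← TensorProduct.smul_tmul']

theorem deconcStep_apply (v : M)
    (t : TensorAlgebra R M × (TensorAlgebra R M ⊗[R] TensorAlgebra R M)) :
    deconcStep v t = (TensorAlgebra.ι R v * t.1,
      (TensorAlgebra.ι R v ⊗ₜ[R] 1) * t.2 + 1 ⊗ₜ[R] (TensorAlgebra.ι R v * t.1)) := rfl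

/-- The deconcatenation coproduct on the tensor algebra. -/
noncomputable def deconc :
    TensorAlgebra R M →ₗ[R] TensorAlgebra R M ⊗[R] TensorAlgebra R M :=
  LinearMap.snd R _ _ ∘ₗ LinearMap.applyₗ ((1 : TensorAlgebra R M), (1 : _ ⊗[R] _)) ∘ₗ
    (TensorAlgebra.lift R (deconcStep (R := R) (M := M))).toLinearMap

@[simp] theorem deconc_one : deconc (1 : TensorAlgebra R M) = 1 := by
  simp [deconc]

@[simp] theorem deconc_letter_mul (v : M) (x : TensorAlgebra R M) :
    deconc (TensorAlgebra.ι R v * x) =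
      (TensorAlgebra.ι R v ⊗ₜ[R] 1) * deconc x + 1 ⊗ₜ[R] (TensorAlgebra.ι R v * x) := by
  -- The recursion for the coproduct refers to the word itself, so the iteration carries a first
  -- coordinate, which merely rebuilds `x`.
  have h (x : TensorAlgebra R M) :
      (TensorAlgebra.lift R (deconcStep (R := R) (M := M)) x ((1, 1) : _ × (_ ⊗[R] _))).1 = x := by
    induction x using letter_induction with
    | one => simp
    | letter v x hx => simp [deconcStep_apply, hx]
    | add x y hx hy => simp [hx, hy]
    | smul r x hx => simp [hx]
  simp only [deconc, LinearMap.comp_apply, AlgHom.toLinearMap_apply, map_mul,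
    TensorAlgebra.lift_ι_apply]
  simp [deconcStep_apply, h]

/-- The convolution product of linear maps from the tensor coalgebra to an algebra. -/
noncomputable def conv (F G : TensorAlgebra R M →ₗ[R] A) : TensorAlgebra R M →ₗ[R] A :=
  LinearMap.mul' R A ∘ₗ TensorProduct.map F G ∘ₗ deconc

scoped infixr:70 " ⋆ " => conv

/-- The unit of the convolution product. -/
noncomputable def convOne : TensorAlgebra R M →ₗ[R] A :=
  Algebra.linearMap R A ∘ₗ (TensorAlgebra.algebraMapInv (R := R) (M := M)).toLinearMap

@[simp] theorem convOne_one : (convOne : TensorAlgebra R M →ₗ[R] A) 1 = 1 := by simp [convOne]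

@[simp] theorem convOne_letter_mul (v : M) (x : TensorAlgebra R M) :
    (convOne : TensorAlgebra R M →ₗ[R] A) (TensorAlgebra.ι R v * x) = 0 := by
  simp [convOne, TensorAlgebra.algebraMapInv]

@[simp] theorem conv_one (F G : TensorAlgebra R M →ₗ[R] A) : (F ⋆ G) 1 = F 1 * G 1 := by
  simp [conv, Algebra.TensorProduct.one_def]

theorem conv_letter_mul (F G : TensorAlgebra R M →ₗ[R] A) (v : M) (x : TensorAlgebra R M) :
    (F ⋆ G) (TensorAlgebra.ι R v * x) =
      ((F ∘ₗ LinearMap.mulLeft R (TensorAlgebra.ι R v)) ⋆ G) x +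
        F 1 * G (TensorAlgebra.ι R v * x) := by
  simp only [conv, LinearMap.comp_apply, deconc_letter_mul, map_add, TensorProduct.map_tmul,
    LinearMap.mul'_apply]
  congr 2
  induction deconc x using TensorProduct.induction_on with
  | zero => simp
  | tmul a b => simp
  | add a b ha hb => rw [mul_add, map_add, ha, hb, map_add]

/-- On words, convolution is a sum over cuts into a prefix and a suffix, both possibly empty.
Identities that need no associativity can be read off from this form. -/
theorem conv_word (F G : TensorAlgebra R M →ₗ[R] A) (l : List M) :
    (F ⋆ G) (word R l) = ∑ r ∈ Finset.range (l.length + 1),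
      F (word R (l.take r)) * G (word R (l.drop r)) := by
  induction l generalizing F with
  | nil => simp
  | cons v l ih =>
    rw [word_cons, conv_letter_mul, ih, List.length_cons, Finset.sum_range_succ' _ (l.length + 1)]
    simp

theorem add_conv (F F' G : TensorAlgebra R M →ₗ[R] A) : (F + F') ⋆ G = F ⋆ G + F' ⋆ G := by
  simp [conv, TensorProduct.map_add_left, LinearMap.add_comp, LinearMap.comp_add]

theorem conv_add (F G G' : TensorAlgebra R M →ₗ[R] A) : F ⋆ (G + G') = F ⋆ G + F ⋆ G' := by
  simp [conv, TensorProduct.map_add_right, LinearMap.add_comp, LinearMap.comp_add]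

@[simp] theorem zero_conv (G : TensorAlgebra R M →ₗ[R] A) : 0 ⋆ G = 0 := by
  simpa using add_conv 0 0 G

@[simp] theorem conv_zero (G : TensorAlgebra R M →ₗ[R] A) : G ⋆ 0 = 0 := by
  simpa using conv_add G 0 0

theorem neg_conv (F G : TensorAlgebra R M →ₗ[R] A) : (-F) ⋆ G = -(F ⋆ G) :=
  eq_neg_of_add_eq_zero_left (by rw [← add_conv]; simp)

theorem conv_neg (F G : TensorAlgebra R M →ₗ[R] A) : F ⋆ (-G) = -(F ⋆ G) :=
  eq_neg_of_add_eq_zero_left (by rw [← conv_add]; simp)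

theorem sub_conv (F F' G : TensorAlgebra R M →ₗ[R] A) : (F - F') ⋆ G = F ⋆ G - F' ⋆ G := by
  rw [sub_eq_add_neg, add_conv, neg_conv, sub_eq_add_neg]

theorem conv_sub (F G G' : TensorAlgebra R M →ₗ[R] A) : F ⋆ (G - G') = F ⋆ G - F ⋆ G' := by
  rw [sub_eq_add_neg, conv_add, conv_neg, sub_eq_add_neg]

theorem mulLeft_comp_conv (a : A) (F G : TensorAlgebra R M →ₗ[R] A) :
    (LinearMap.mulLeft R a ∘ₗ F) ⋆ G = LinearMap.mulLeft R a ∘ₗ (F ⋆ G) := by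
  refine linearMap_ext_word fun l => ?_
  simp [conv_word, mul_assoc]

/-- Peeling off a letter replaces `F` by its composite with multiplication by that letter, so the
induction has to run over all `F` at once. -/
theorem conv_assoc (F G H : TensorAlgebra R M →ₗ[R] A) : (F ⋆ G) ⋆ H = F ⋆ G ⋆ H := by
  ext x
  induction x using letter_induction generalizing F with
  | one => simp [mul_assoc]
  | letter v x hx =>
    have : (F ⋆ G) ∘ₗ LinearMap.mulLeft R (TensorAlgebra.ι R v) =
        (F ∘ₗ LinearMap.mulLeft R (TensorAlgebra.ι R v)) ⋆ G +
          LinearMap.mulLeft R (F 1) ∘ₗ G ∘ₗ LinearMap.mulLeft R (TensorAlgebra.ι R v) := by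
      refine LinearMap.ext fun y => ?_
      simp [conv_letter_mul]
    rw [conv_letter_mul, conv_letter_mul, conv_letter_mul, this, add_conv, LinearMap.add_apply, hx,
      mulLeft_comp_conv, conv_one]
    simp [mul_add, mul_assoc, add_assoc]
  | add x y hx hy => simp [hx, hy]
  | smul r x hx => simp [hx]

@[simp] theorem convOne_conv (F : TensorAlgebra R M →ₗ[R] A) : convOne ⋆ F = F := by
  refine linearMap_ext_letter (by simp) fun v x _ => ?_
  have : (convOne : TensorAlgebra R M →ₗ[R] A) ∘ₗ
      LinearMap.mulLeft R (TensorAlgebra.ι R v) = 0 := by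
    ext; simp
  rw [conv_letter_mul, this]
  simp

@[simp] theorem conv_convOne (F : TensorAlgebra R M →ₗ[R] A) : F ⋆ convOne = F := by
  ext x
  induction x using letter_induction generalizing F with
  | one => simp
  | letter v x hx => rw [conv_letter_mul, hx]; simp
  | add x y hx hy => simp [hx, hy]
  | smul r x hx => simp [hx]

theorem algHom_comp_conv (α : A →ₐ[R] B) (F G : TensorAlgebra R M →ₗ[R] A) :
    α.toLinearMap ∘ₗ (F ⋆ G) = (α.toLinearMap ∘ₗ F) ⋆ (α.toLinearMap ∘ₗ G) := by
  refine linearMap_ext_word fun l => ?_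
  simp [conv_word]

theorem algHom_comp_convOne (α : A →ₐ[R] B) :
    α.toLinearMap ∘ₗ (convOne : TensorAlgebra R M →ₗ[R] A) = convOne := by
  refine linearMap_ext_letter (by simp) fun v x _ => by simp

/-! ### Geometric series -/

/-- The geometric series `∑ k, x ^ k` with respect to convolution, for `x` without constant term,
written as a sum over compositions. -/
noncomputable def geom (x : TensorAlgebra R M →ₗ[R] A) : TensorAlgebra R M →ₗ[R] A :=
  ofFamily fun n => ∑ c : Composition n,
    ((MultilinearMap.mkPiAlgebraFin R c.length A).compMultilinearMap
      (fun i => x.compMultilinearMap (TensorAlgebra.tprod R M (c.blocksFun i)))).domDomCongr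
        c.blocksFinEquiv

theorem geom_word_ofFn (x : TensorAlgebra R M →ₗ[R] A) {n : ℕ} (v : Fin n → M) :
    geom x (word R (List.ofFn v)) = ∑ c : Composition n,
      (List.ofFn fun i => x (word R (List.ofFn fun j => v (c.embedding i j)))).prod := by
  rw [geom, ofFamily_word_ofFn, sum_apply]
  refine Finset.sum_congr rfl fun c _ => ?_
  simp only [MultilinearMap.domDomCongr_apply, MultilinearMap.compMultilinearMap_apply,
    MultilinearMap.mkPiAlgebraFin_apply, LinearMap.compMultilinearMap_apply, ← word_ofFn]
  rfl

theorem geom_word (x : TensorAlgebra R M →ₗ[R] A) (l : List M) :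
    geom x (word R l) = splitSum l.length l (fun ps => (ps.map fun p => x (word R p)).prod) := by
  have h := geom_word_ofFn x l.get
  rw [List.ofFn_get] at h
  have h' := splitSum_ofFn l.get (fun ps => (ps.map fun p => x (word R p)).prod)
  rw [List.ofFn_get] at h'
  rw [h, h']
  simp [List.map_ofFn, Function.comp_def]

theorem geom_rec (x : TensorAlgebra R M →ₗ[R] A) {l : List M} (hl : l ≠ []) :
    geom x (word R l) = ∑ r ∈ Finset.range l.length,
      x (word R (l.take (r + 1))) * geom x (word R (l.drop (r + 1))) := by
  simp only [geom_word]
  exact splitSum_geom (fun p => x (word R p)) hl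

@[simp] theorem geom_one (x : TensorAlgebra R M →ₗ[R] A) : geom x 1 = 1 := by
  simpa [splitSum_zero] using geom_word x []

theorem geom_eq {x : TensorAlgebra R M →ₗ[R] A} (hx : x 1 = 0) :
    geom x = convOne + x ⋆ geom x := by
  refine linearMap_ext_word fun l => ?_
  rcases l with _ | ⟨v, l⟩
  · simp [hx]
  · rw [geom_rec x (by simp), LinearMap.add_apply, conv_word, Finset.sum_range_succ']
    simp [hx]

theorem sub_conv_geom {x : TensorAlgebra R M →ₗ[R] A} (hx : x 1 = 0) :
    (convOne - x) ⋆ geom x = convOne := by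
  rw [sub_conv, convOne_conv]
  nth_rewrite 1 [geom_eq hx]
  abel

/-- The series `G` is a right inverse of `1 - x`. Its constant term is `1`, so `1 - G` is again free
of constant term and `G = 1 - (1 - G)` has a right inverse of its own. An element with an inverse on
either side has equal inverses, so `G` is two-sided. -/
theorem geom_conv_sub {x : TensorAlgebra R M →ₗ[R] A} (hx : x 1 = 0) :
    geom x ⋆ (convOne - x) = convOne := by
  have hy : ((convOne : TensorAlgebra R M →ₗ[R] A) - geom x) 1 = 0 := by simp
  have h1 := sub_conv_geom hx
  have h2 := sub_conv_geom hy
  rw [sub_sub_cancel] at h2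
  have : convOne - x = geom (convOne - geom x) := by
    have h3 := congrArg (· ⋆ geom (convOne - geom x)) h1
    simpa [conv_assoc, h2] using h3
  rw [this, h2]

theorem geom_eq' {x : TensorAlgebra R M →ₗ[R] A} (hx : x 1 = 0) :
    geom x = convOne + geom x ⋆ x := by
  have := geom_conv_sub hx
  rw [conv_sub, conv_convOne, sub_eq_iff_eq_add] at this
  exact this

/-- Uniqueness of the inverse. Identities between coalgebra maps are proved below by checking this
linear equation instead of comparing sums over compositions. -/
theorem eq_geom_of_sub_conv {x X : TensorAlgebra R M →ₗ[R] A} (hx : x 1 = 0)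
    (h : (convOne - x) ⋆ X = convOne) : X = geom x := by
  rw [← convOne_conv X, ← geom_conv_sub hx, conv_assoc, h, conv_convOne]

theorem algHom_comp_geom (α : A →ₐ[R] B) {x : TensorAlgebra R M →ₗ[R] A} (hx : x 1 = 0) :
    α.toLinearMap ∘ₗ geom x = geom (α.toLinearMap ∘ₗ x) := by
  refine eq_geom_of_sub_conv (by simp [hx]) ?_
  rw [← algHom_comp_convOne α, ← LinearMap.comp_sub, ← algHom_comp_conv, sub_conv_geom hx]

/-- The sum over compositions with a distinguished block as a convolution product. -/
theorem geom_conv_conv_geom {x y z : TensorAlgebra R M →ₗ[R] A} (hx : x 1 = 0) (hy : y 1 = 0)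
    {n : ℕ} (v : Fin n → M) :
    (geom x ⋆ y ⋆ geom z) (word R (List.ofFn v)) = ∑ c : Composition n, ∑ i : Fin c.length,
      (List.ofFn fun j =>
        if j < i then x (word R (List.ofFn fun a => v (c.embedding j a)))
        else if j = i then y (word R (List.ofFn fun a => v (c.embedding j a)))
        else z (word R (List.ofFn fun a => v (c.embedding j a)))).prod := by
  have h1 : geom x ⋆ y ⋆ geom z = y ⋆ geom z + x ⋆ geom x ⋆ y ⋆ geom z := by
    nth_rewrite 1 [geom_eq hx]
    rw [add_conv, convOne_conv, conv_assoc]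
  have h := mid_eq_splitSum (α := M) (x := fun l => x (word R l)) (y := fun l => y (word R l))
    (z := fun l => z (word R l)) (Z := fun l => geom z (word R l))
    (K := fun l => (geom x ⋆ y ⋆ geom z) (word R l)) (by simp) (fun l hl => geom_rec z hl)
    (by simp [hy]) (fun l hl => by
      nth_rewrite 1 [h1]
      rw [LinearMap.add_apply, conv_word, conv_word, Finset.sum_range_succ',
        Finset.sum_range_succ']
      simp [hx, hy, Finset.sum_add_distrib]) (List.ofFn v)
  rw [h, List.length_ofFn, splitSum_ofFn]
  simp only [midProd_ofFn]

end TensorCoalgebra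

/-! ### Coalgebra maps, coderivations and the filtration by arity -/

section CoalgebraMaps

open TensorProduct

variable {R : Type*} [CommRing R] {L M N A B : Type*} [AddCommGroup L] [Module R L]
  [AddCommGroup M] [Module R M] [AddCommGroup N] [Module R N] [Ring A] [Algebra R A]
  [Ring B] [Algebra R B]

/-- The first factor inclusion `x ↦ x ⊗ 1`. -/
noncomputable abbrev inL : TensorAlgebra R N →ₐ[R] TensorAlgebra R N ⊗[R] TensorAlgebra R N :=
  Algebra.TensorProduct.includeLeft

/-- The second factor inclusion `x ↦ 1 ⊗ x`. -/
noncomputable abbrev inR : TensorAlgebra R N →ₐ[R] TensorAlgebra R N ⊗[R] TensorAlgebra R N :=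
  Algebra.TensorProduct.includeRight

/-- The counit of the tensor coalgebra. -/
noncomputable abbrev counit : TensorAlgebra R M →ₐ[R] R := TensorAlgebra.algebraMapInv

/-- The algebra map of tensor algebras induced by a linear map. -/
noncomputable def tmap (f : M →ₗ[R] N) : TensorAlgebra R M →ₐ[R] TensorAlgebra R N :=
  TensorAlgebra.lift R (TensorAlgebra.ι R ∘ₗ f)

@[simp] theorem tmap_letter (f : M →ₗ[R] N) (v : M) :
    tmap f (TensorAlgebra.ι R v) = TensorAlgebra.ι R (f v) := by simp [tmap]

theorem tmap_word (f : M →ₗ[R] N) (l : List M) : tmap f (word R l) = word R (l.map f) := by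
  simp [word, map_list_prod, Function.comp_def]

theorem deconc_letter (v : M) :
    deconc (TensorAlgebra.ι R v) = inL (TensorAlgebra.ι R v) + inR (TensorAlgebra.ι R v) := by
  simpa using deconc_letter_mul (R := R) v 1

/-- A cut of a product of two words falls into the second or into the first; the cut at the junction
is counted twice, which the last term corrects. -/
theorem deconc_mul (x y : TensorAlgebra R M) :
    deconc (x * y) = inL x * deconc y + deconc x * inR y - x ⊗ₜ[R] y := by
  induction x using letter_induction with
  | one => simp [← Algebra.TensorProduct.one_def]
  | letter v x hx =>
    rw [mul_assoc, deconc_letter_mul, hx, deconc_letter_mul]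
    simp [mul_add, add_mul, mul_sub, ← mul_assoc]
    abel
  | add x x' hx hx' => rw [add_mul, map_add, hx, hx']; simp [add_mul, add_tmul]; abel
  | smul r x hx => rw [smul_mul_assoc, map_smul, hx]; simp [smul_add, smul_sub, ← smul_tmul']

theorem deconc_comp_conv (X Y : TensorAlgebra R M →ₗ[R] TensorAlgebra R N) :
    deconc ∘ₗ (X ⋆ Y) = (inL.toLinearMap ∘ₗ X) ⋆ (deconc ∘ₗ Y) +
      (deconc ∘ₗ X) ⋆ (inR.toLinearMap ∘ₗ Y) -
        (inL.toLinearMap ∘ₗ X) ⋆ (inR.toLinearMap ∘ₗ Y) := by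
  refine linearMap_ext_word fun l => ?_
  simp [conv_word, deconc_mul, Finset.sum_add_distrib, Finset.sum_sub_distrib]

theorem mul_map_comp_conv (F G : TensorAlgebra R N →ₗ[R] A)
    (X Y : TensorAlgebra R M →ₗ[R] TensorAlgebra R N) :
    LinearMap.mul' R A ∘ₗ TensorProduct.map F G ∘ₗ
      ((inL.toLinearMap ∘ₗ X) ⋆ (inR.toLinearMap ∘ₗ Y)) = (F ∘ₗ X) ⋆ (G ∘ₗ Y) := by
  refine linearMap_ext_word fun l => ?_
  simp [conv_word]

/-- `X` is a map of coalgebras. -/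
structure IsCoalg (X : TensorAlgebra R M →ₗ[R] TensorAlgebra R N) : Prop where
  deconc_comp : deconc ∘ₗ X = (inL.toLinearMap ∘ₗ X) ⋆ (inR.toLinearMap ∘ₗ X)
  counit_comp : counit.toLinearMap ∘ₗ X = counit.toLinearMap

/-- `K` is a coderivation along the coalgebra maps `X` and `Y`. -/
structure IsCoder (X K Y : TensorAlgebra R M →ₗ[R] TensorAlgebra R N) : Prop where
  deconc_comp : deconc ∘ₗ K = (inL.toLinearMap ∘ₗ X) ⋆ (inR.toLinearMap ∘ₗ K) +
    (inL.toLinearMap ∘ₗ K) ⋆ (inR.toLinearMap ∘ₗ Y)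
  counit_comp : counit.toLinearMap ∘ₗ K = 0

variable {X K Y : TensorAlgebra R M →ₗ[R] TensorAlgebra R N}

/-- Precomposition with a coalgebra map is multiplicative for convolution. -/
theorem IsCoalg.conv_comp (h : IsCoalg X) (F G : TensorAlgebra R N →ₗ[R] A) :
    (F ⋆ G) ∘ₗ X = (F ∘ₗ X) ⋆ (G ∘ₗ X) := by
  rw [conv, LinearMap.comp_assoc, LinearMap.comp_assoc, h.deconc_comp, mul_map_comp_conv]

theorem IsCoalg.convOne_comp (h : IsCoalg X) :
    (convOne : TensorAlgebra R N →ₗ[R] A) ∘ₗ X = convOne := by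
  rw [convOne, LinearMap.comp_assoc, h.counit_comp]
  rfl

/-- The Leibniz rule. No sign is visible because the Koszul signs are part of the map `X` to the
left of the coderivation. -/
theorem IsCoder.conv_comp (h : IsCoder X K Y) (F G : TensorAlgebra R N →ₗ[R] A) :
    (F ⋆ G) ∘ₗ K = (F ∘ₗ X) ⋆ (G ∘ₗ K) + (F ∘ₗ K) ⋆ (G ∘ₗ Y) := by
  rw [conv, LinearMap.comp_assoc, LinearMap.comp_assoc, h.deconc_comp, LinearMap.comp_add,
    LinearMap.comp_add, mul_map_comp_conv, mul_map_comp_conv]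

theorem IsCoder.convOne_comp (h : IsCoder X K Y) :
    (convOne : TensorAlgebra R N →ₗ[R] A) ∘ₗ K = 0 := by
  rw [convOne, LinearMap.comp_assoc, h.counit_comp, LinearMap.comp_zero]

/-- The coalgebra map with the given corestriction. -/
noncomputable def hat (C : TensorAlgebra R M →ₗ[R] N) :
    TensorAlgebra R M →ₗ[R] TensorAlgebra R N :=
  geom (TensorAlgebra.ι R ∘ₗ C)

@[simp] theorem hat_one (C : TensorAlgebra R M →ₗ[R] N) : hat C 1 = 1 := geom_one _

theorem convOne_eq_counit : (convOne : TensorAlgebra R M →ₗ[R] R) = counit.toLinearMap := rfl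

theorem counit_comp_letter (C : TensorAlgebra R M →ₗ[R] N) :
    counit.toLinearMap ∘ₗ TensorAlgebra.ι R ∘ₗ C = 0 := by
  ext x; simp [TensorAlgebra.algebraMapInv]

theorem geom_zero : geom (0 : TensorAlgebra R M →ₗ[R] A) = convOne := by
  rw [geom_eq (by simp)]; simp

/-- Applying the coproduct to the geometric recursion and using `deconc_mul` gives an affine
equation for `deconc ∘ hat C`, whose coefficient `1 - inL ι C` is invertible for convolution. -/
theorem isCoalg_hat {C : TensorAlgebra R M →ₗ[R] N} (hC : C 1 = 0) : IsCoalg (hat C) where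
  deconc_comp := by
    have hC' : (TensorAlgebra.ι R ∘ₗ C) 1 = 0 := by simp [hC]
    have hL : (inL.toLinearMap ∘ₗ TensorAlgebra.ι R ∘ₗ C) 1 = 0 := by simp [hC]
    have hd : deconc ∘ₗ TensorAlgebra.ι R ∘ₗ C = inL.toLinearMap ∘ₗ TensorAlgebra.ι R ∘ₗ C +
        inR.toLinearMap ∘ₗ TensorAlgebra.ι R ∘ₗ C := by
      ext x; simp [deconc_letter]
    have h1 : deconc ∘ₗ hat C = inR.toLinearMap ∘ₗ hat C +
        (inL.toLinearMap ∘ₗ TensorAlgebra.ι R ∘ₗ C) ⋆ (deconc ∘ₗ hat C) := by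
      have h2 : deconc ∘ₗ (convOne : TensorAlgebra R M →ₗ[R] TensorAlgebra R N) =
          inR.toLinearMap ∘ₗ convOne :=
        linearMap_ext_letter (by simp [Algebra.TensorProduct.one_def]) fun v x _ => by simp
      nth_rewrite 1 2 [hat]
      rw [geom_eq hC', LinearMap.comp_add, LinearMap.comp_add, h2, deconc_comp_conv, hd,
        add_conv, algHom_comp_conv]
      simp only [hat]
      abel
    have h3 : (convOne - inL.toLinearMap ∘ₗ TensorAlgebra.ι R ∘ₗ C) ⋆ (deconc ∘ₗ hat C) =
        inR.toLinearMap ∘ₗ hat C := by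
      rw [sub_conv, convOne_conv]
      nth_rewrite 1 [h1]
      abel
    rw [← h3]
    nth_rewrite 2 [hat]
    rw [algHom_comp_geom _ hC', ← conv_assoc, geom_conv_sub hL, convOne_conv]
  counit_comp := by
    rw [hat, algHom_comp_geom _ (by simp [hC]), counit_comp_letter, geom_zero, convOne_eq_counit]

theorem hat_comp {X : TensorAlgebra R L →ₗ[R] TensorAlgebra R M} (hX : IsCoalg X) (hX1 : X 1 = 1)
    {C : TensorAlgebra R M →ₗ[R] N} (hC : C 1 = 0) : hat C ∘ₗ X = hat (C ∘ₗ X) := by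
  refine eq_geom_of_sub_conv (by simp [hX1, hC]) ?_
  rw [← hX.convOne_comp, ← LinearMap.comp_assoc, ← LinearMap.sub_comp, hat, ← hX.conv_comp,
    sub_conv_geom (by simp [hC])]

theorem map_comp_hat (f : N →ₗ[R] L) {C : TensorAlgebra R M →ₗ[R] N} (hC : C 1 = 0) :
    (tmap f).toLinearMap ∘ₗ hat C = hat (f ∘ₗ C) := by
  rw [hat, algHom_comp_geom _ (by simp [hC]), hat]
  congr 1
  ext x
  simp

/-- The components of the projection of the tensor coalgebra to its cogenerators. -/
noncomputable def projFamily : ∀ n : ℕ, MultilinearMap R (fun _ : Fin n => M) M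
  | 1 => MultilinearMap.ofSubsingleton R M M (0 : Fin 1) LinearMap.id
  | _ => 0

/-- The projection of the tensor coalgebra to its cogenerators. -/
noncomputable def proj : TensorAlgebra R M →ₗ[R] M := ofFamily projFamily

theorem proj_word (l : List M) : proj (word R l) = projFamily (R := R) l.length l.get := by
  have := ofFamily_word_ofFn (projFamily (R := R) (M := M)) l.get
  rwa [List.ofFn_get] at this

@[simp] theorem proj_one : proj (1 : TensorAlgebra R M) = 0 := proj_word []

@[simp] theorem proj_letter (v : M) : proj (TensorAlgebra.ι R v) = v := by
  have := proj_word (R := R) [v]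
  rw [word_singleton] at this
  exact this

theorem proj_word_cons_cons (v w : M) (l : List M) : proj (word R (v :: w :: l)) = 0 :=
  proj_word (v :: w :: l)

theorem proj_letter_mul (v : M) (x : TensorAlgebra R M) :
    proj (TensorAlgebra.ι R v * x) = counit x • v := by
  have : proj ∘ₗ LinearMap.mulLeft R (TensorAlgebra.ι R v) =
      counit.toLinearMap.smulRight v := by
    refine linearMap_ext_word fun l => ?_
    rcases l with _ | ⟨w, l⟩
    · simp
    · have := proj_word_cons_cons (R := R) v w l
      simp only [word_cons] at this
      simp [this, TensorAlgebra.algebraMapInv]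
  exact LinearMap.congr_fun this x

/-- Only the cut after the first letter survives. By uniqueness of the geometric series this makes
the identity the coalgebra map with corestriction `proj`. -/
theorem letter_proj_conv_id :
    (TensorAlgebra.ι R ∘ₗ proj) ⋆ LinearMap.id =
      LinearMap.id - (convOne : TensorAlgebra R M →ₗ[R] TensorAlgebra R M) := by
  refine linearMap_ext_word fun l => ?_
  rcases l with _ | ⟨v, l⟩
  · simp
  · rw [conv_word, List.length_cons, Finset.sum_range_succ', Finset.sum_range_succ']
    rw [Finset.sum_eq_zero]
    · simp
    · intro r hr
      simp only [Finset.mem_range] at hr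
      rcases l with _ | ⟨w, l⟩
      · simp at hr
      · simp only [List.take_succ_cons]
        simp [-word_cons, proj_word_cons_cons]

theorem hat_proj : hat (proj : TensorAlgebra R M →ₗ[R] M) = LinearMap.id := by
  symm
  refine eq_geom_of_sub_conv (by simp) ?_
  rw [sub_conv, letter_proj_conv_id]
  simp

theorem isCoalg_id : IsCoalg (LinearMap.id : TensorAlgebra R M →ₗ[R] TensorAlgebra R M) := by
  rw [← hat_proj]
  exact isCoalg_hat proj_one

theorem map_eq_hat (f : M →ₗ[R] N) :
    (tmap f).toLinearMap = hat (f ∘ₗ proj) := by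
  rw [← map_comp_hat f proj_one, hat_proj, LinearMap.comp_id]

theorem isCoalg_map (f : M →ₗ[R] N) : IsCoalg (tmap f).toLinearMap := by
  rw [map_eq_hat]
  exact isCoalg_hat (by simp)

theorem hat_comp_map (f : L →ₗ[R] M) {C : TensorAlgebra R M →ₗ[R] N} (hC : C 1 = 0) :
    hat C ∘ₗ (tmap f).toLinearMap = hat (C ∘ₗ (tmap f).toLinearMap) :=
  hat_comp (isCoalg_map f) (by simp) hC

theorem counit_word_cons (v : M) (l : List M) : counit (word R (v :: l)) = 0 := by
  simp [TensorAlgebra.algebraMapInv]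

/-- The first factor already supplies one letter, so `proj` retains only the counit of the second,
and that counit forces the second part of the input to be empty. -/
theorem proj_comp_letter_conv (C : TensorAlgebra R M →ₗ[R] N)
    {Y : TensorAlgebra R M →ₗ[R] TensorAlgebra R N}
    (hY : counit.toLinearMap ∘ₗ Y = counit.toLinearMap) :
    proj ∘ₗ ((TensorAlgebra.ι R ∘ₗ C) ⋆ Y) = C := by
  refine linearMap_ext_word fun l => ?_
  have hY' (x) : counit (Y x) = counit x := LinearMap.congr_fun hY x
  rw [LinearMap.comp_apply, conv_word, Finset.sum_range_succ, map_add, map_sum,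
    Finset.sum_eq_zero]
  · simp [proj_letter_mul, hY']
  · intro r hr
    simp only [LinearMap.comp_apply, proj_letter_mul, hY']
    have : l.drop r ≠ [] := by simpa using hr
    obtain ⟨v, l', h⟩ := List.exists_cons_of_ne_nil this
    rw [h, counit_word_cons, zero_smul]

theorem proj_comp_letter_conv_of_counit_eq_zero (C : TensorAlgebra R M →ₗ[R] N)
    {Y : TensorAlgebra R M →ₗ[R] TensorAlgebra R N} (hY : counit.toLinearMap ∘ₗ Y = 0) :
    proj ∘ₗ ((TensorAlgebra.ι R ∘ₗ C) ⋆ Y) = 0 := by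
  refine linearMap_ext_word fun l => ?_
  have hY' (x) : counit (Y x) = 0 := LinearMap.congr_fun hY x
  simp [conv_word, proj_letter_mul, hY']

theorem proj_comp_hat {C : TensorAlgebra R M →ₗ[R] N} (hC : C 1 = 0) : proj ∘ₗ hat C = C := by
  have h := proj_comp_letter_conv C (isCoalg_hat hC).counit_comp
  nth_rewrite 1 [hat]
  rw [geom_eq (by simp [hC]), LinearMap.comp_add]
  have : proj ∘ₗ (convOne : TensorAlgebra R M →ₗ[R] TensorAlgebra R N) = 0 :=
    linearMap_ext_letter (by simp) fun v x _ => by simp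
  rw [this, zero_add]
  exact h

/-- The letter in the middle is primitive. In the expansion of the coproduct, the terms with a cut
inside `X` or inside `Y` combine with the corrections from `deconc_mul` to leave the two terms of a
coderivation. -/
theorem isCoder_conv (hX : IsCoalg X) (hY : IsCoalg Y) (e : TensorAlgebra R M →ₗ[R] N) :
    IsCoder X (X ⋆ (TensorAlgebra.ι R ∘ₗ e) ⋆ Y) Y where
  deconc_comp := by
    have hd : deconc ∘ₗ TensorAlgebra.ι R ∘ₗ e = inL.toLinearMap ∘ₗ TensorAlgebra.ι R ∘ₗ e +
        inR.toLinearMap ∘ₗ TensorAlgebra.ι R ∘ₗ e := by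
      ext x; simp [deconc_letter]
    rw [deconc_comp_conv, deconc_comp_conv, hd, hX.deconc_comp, hY.deconc_comp]
    simp only [algHom_comp_conv, conv_add, add_conv, conv_sub, conv_assoc]
    abel
  counit_comp := by
    rw [algHom_comp_conv, algHom_comp_conv, counit_comp_letter]
    simp

/-- The unit term of `hat C` gives `e`; every other term has a letter from `C` followed by something
of counit zero, which `proj` kills. -/
theorem proj_comp_hat_conv {C e : TensorAlgebra R M →ₗ[R] N} (hC : C 1 = 0) (hY : IsCoalg Y) :
    proj ∘ₗ (hat C ⋆ (TensorAlgebra.ι R ∘ₗ e) ⋆ Y) = e := by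
  have h0 := (isCoder_conv (isCoalg_hat hC) hY e).counit_comp
  have h1 : hat C ⋆ (TensorAlgebra.ι R ∘ₗ e) ⋆ Y = (TensorAlgebra.ι R ∘ₗ e) ⋆ Y +
      (TensorAlgebra.ι R ∘ₗ C) ⋆ hat C ⋆ (TensorAlgebra.ι R ∘ₗ e) ⋆ Y := by
    nth_rewrite 1 [hat]
    rw [geom_eq (by simp [hC]), add_conv, convOne_conv, conv_assoc]
    rfl
  rw [h1, LinearMap.comp_add, proj_comp_letter_conv e hY.counit_comp,
    proj_comp_letter_conv_of_counit_eq_zero _ h0, add_zero]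

/-! ### The filtration by arity -/

/-- `F` vanishes on words with fewer than `n` letters. -/
def VanishesBelow (n : ℕ) (F : TensorAlgebra R M →ₗ[R] N) : Prop :=
  ∀ l : List M, l.length < n → F (word R l) = 0

theorem vanishesBelow_zero (F : TensorAlgebra R M →ₗ[R] N) : VanishesBelow 0 F := by
  intro l hl; simp at hl

theorem vanishesBelow_one {F : TensorAlgebra R M →ₗ[R] N} (h : F 1 = 0) : VanishesBelow 1 F := by
  intro l hl
  obtain rfl : l = [] := by simpa using hl
  simpa using h

theorem eq_zero_of_vanishesBelow {F : TensorAlgebra R M →ₗ[R] N} (h : ∀ n, VanishesBelow n F) :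
    F = 0 :=
  linearMap_ext_word fun l => h (l.length + 1) l (by simp)

theorem VanishesBelow.comp {n : ℕ} {F : TensorAlgebra R M →ₗ[R] N} (h : VanishesBelow n F)
    (G : N →ₗ[R] L) : VanishesBelow n (G ∘ₗ F) := by
  intro l hl
  simp [h l hl]

theorem VanishesBelow.add {n : ℕ} {F G : TensorAlgebra R M →ₗ[R] N} (hF : VanishesBelow n F)
    (hG : VanishesBelow n G) : VanishesBelow n (F + G) := by
  intro l hl
  simp [hF l hl, hG l hl]

theorem VanishesBelow.neg {n : ℕ} {F : TensorAlgebra R M →ₗ[R] N} (hF : VanishesBelow n F) :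
    VanishesBelow n (-F) := by
  intro l hl
  simp [hF l hl]

theorem VanishesBelow.conv {a b : ℕ} {F G : TensorAlgebra R M →ₗ[R] A} (hF : VanishesBelow a F)
    (hG : VanishesBelow b G) : VanishesBelow (a + b) (F ⋆ G) := by
  intro l hl
  rw [conv_word]
  refine Finset.sum_eq_zero fun r hr => ?_
  by_cases h : (l.take r).length < a
  · rw [hF _ h, zero_mul]
  · rw [hG _ ?_, mul_zero]
    simp only [List.length_take, List.length_drop, Finset.mem_range] at *
    omega

/-- Corestrictions without linear part raise the filtration degree of a coderivation. -/
theorem VanishesBelow.comp_hat_conv {n : ℕ} {β : TensorAlgebra R N →ₗ[R] L}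
    (hβ : β ∘ₗ TensorAlgebra.ι R = 0) {e : TensorAlgebra R M →ₗ[R] N} (he : VanishesBelow n e)
    {C D : TensorAlgebra R M →ₗ[R] N} (hC : C 1 = 0) (hD : D 1 = 0) :
    VanishesBelow (n + 1) (β ∘ₗ (hat C ⋆ (TensorAlgebra.ι R ∘ₗ e) ⋆ hat D)) := by
  have hE : VanishesBelow n (TensorAlgebra.ι R ∘ₗ e) := he.comp _
  have hC1 : (TensorAlgebra.ι R ∘ₗ C) 1 = 0 := by simp [hC]
  have hD1 : (TensorAlgebra.ι R ∘ₗ D) 1 = 0 := by simp [hD]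
  -- The term whose output is the single letter from `e` is split off, because `β` kills it. Each
  -- other term has a further factor from `C` or `D`, which vanishes on the empty word and so uses
  -- up at least one input letter.
  have h : hat C ⋆ (TensorAlgebra.ι R ∘ₗ e) ⋆ hat D = TensorAlgebra.ι R ∘ₗ e +
      ((TensorAlgebra.ι R ∘ₗ e) ⋆ (TensorAlgebra.ι R ∘ₗ D) ⋆ hat D +
        (TensorAlgebra.ι R ∘ₗ C) ⋆ hat C ⋆ (TensorAlgebra.ι R ∘ₗ e) ⋆ hat D) := by
    nth_rewrite 1 [hat]
    rw [geom_eq hC1, add_conv, convOne_conv, conv_assoc, ← add_assoc]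
    congr 1
    nth_rewrite 1 [hat]
    rw [geom_eq hD1, conv_add, conv_convOne]
    rfl
  rw [h, LinearMap.comp_add, ← LinearMap.comp_assoc, hβ, LinearMap.zero_comp, zero_add]
  refine VanishesBelow.comp (VanishesBelow.add ?_ ?_) _
  · have := hE.conv ((vanishesBelow_one hD1).conv (vanishesBelow_zero (hat D)))
    simpa using this
  · have := (vanishesBelow_one hC1).conv
      ((vanishesBelow_zero (hat C)).conv (hE.conv (vanishesBelow_zero (hat D))))
    simpa [add_comm] using this

theorem VanishesBelow.comp_hat_conv_le {n : ℕ} (β : TensorAlgebra R N →ₗ[R] L)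
    {e : TensorAlgebra R M →ₗ[R] N} (he : VanishesBelow n e)
    (X Y : TensorAlgebra R M →ₗ[R] TensorAlgebra R N) :
    VanishesBelow n (β ∘ₗ (X ⋆ (TensorAlgebra.ι R ∘ₗ e) ⋆ Y)) := by
  have := (vanishesBelow_zero X).conv ((he.comp (TensorAlgebra.ι R)).conv (vanishesBelow_zero Y))
  simp only [zero_add, add_zero] at this
  exact this.comp β

end CoalgebraMaps

/-! ### Homotopy transfer as identities on the tensor coalgebra -/

section Transfer

variable {R : Type*} [CommRing R] {L M N V W : Type*} [AddCommGroup L] [Module R L]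
  [AddCommGroup M] [Module R M] [AddCommGroup N] [Module R N] [AddCommGroup V] [Module R V]
  [AddCommGroup W] [Module R W]

/-- The coderivation of the tensor coalgebra with corestriction `b`, where `b` is odd with respect
to the parity operator `τ`. -/
noncomputable def coder (τ : M →ₗ[R] M) (b : TensorAlgebra R M →ₗ[R] M) :
    TensorAlgebra R M →ₗ[R] TensorAlgebra R M :=
  (tmap τ).toLinearMap ⋆ (TensorAlgebra.ι R ∘ₗ b) ⋆ LinearMap.id

theorem isCoder_coder (τ : M →ₗ[R] M) (b : TensorAlgebra R M →ₗ[R] M) :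
    IsCoder (tmap τ).toLinearMap (coder τ b) LinearMap.id :=
  isCoder_conv (isCoalg_map τ) isCoalg_id b

theorem proj_comp_coder (τ : M →ₗ[R] M) (b : TensorAlgebra R M →ₗ[R] M) :
    proj ∘ₗ coder τ b = b := by
  rw [coder, map_eq_hat]
  exact proj_comp_hat_conv (by simp) isCoalg_id

theorem coder_one (τ : M →ₗ[R] M) {b : TensorAlgebra R M →ₗ[R] M} (hb : b 1 = 0) :
    coder τ b 1 = 0 := by
  simp [coder, hb]

theorem coder_comp (τ : M →ₗ[R] M) (b : TensorAlgebra R M →ₗ[R] M)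
    {X : TensorAlgebra R L →ₗ[R] TensorAlgebra R M} (hX : IsCoalg X) :
    coder τ b ∘ₗ X = ((tmap τ).toLinearMap ∘ₗ X) ⋆ (TensorAlgebra.ι R ∘ₗ b ∘ₗ X) ⋆ X := by
  rw [coder, hX.conv_comp, hX.conv_comp]
  rfl

/-- With `coder_comp`, this puts both composites of a coalgebra map and a codifferential into the
shape of a coderivation, so that they can be compared through the middle factor alone. The Leibniz
rule applied to the geometric recursion gives a linear equation with invertible coefficient `1 - ι C
τ`. -/
theorem hat_comp_coder (τ : L →ₗ[R] L) (d : TensorAlgebra R L →ₗ[R] L)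
    {C : TensorAlgebra R L →ₗ[R] M} (hC : C 1 = 0) :
    hat C ∘ₗ coder τ d = (hat C ∘ₗ (tmap τ).toLinearMap) ⋆
      (TensorAlgebra.ι R ∘ₗ C ∘ₗ coder τ d) ⋆ hat C := by
  have hC1 : (TensorAlgebra.ι R ∘ₗ C) 1 = 0 := by simp [hC]
  have hD := isCoder_coder τ d
  have h0 : convOne ⋆ (hat C ∘ₗ coder τ d) =
      (TensorAlgebra.ι R ∘ₗ C ∘ₗ coder τ d) ⋆ hat C +
      ((TensorAlgebra.ι R ∘ₗ C) ∘ₗ (tmap τ).toLinearMap) ⋆ (hat C ∘ₗ coder τ d) := by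
    rw [convOne_conv]
    nth_rewrite 1 [hat]
    rw [geom_eq hC1, LinearMap.add_comp, hD.convOne_comp, zero_add, hD.conv_comp]
    exact add_comm _ _
  have h1 : (convOne - (TensorAlgebra.ι R ∘ₗ C) ∘ₗ (tmap τ).toLinearMap) ⋆
      (hat C ∘ₗ coder τ d) = (TensorAlgebra.ι R ∘ₗ C ∘ₗ coder τ d) ⋆ hat C := by
    rw [sub_conv, h0]
    abel
  have h2 : hat (C ∘ₗ (tmap τ).toLinearMap) ⋆
      (convOne - (TensorAlgebra.ι R ∘ₗ C) ∘ₗ (tmap τ).toLinearMap) = convOne :=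
    geom_conv_sub (x := TensorAlgebra.ι R ∘ₗ C ∘ₗ _) (by simp [hC])
  rw [← h1, hat_comp_map τ hC, ← conv_assoc, h2, convOne_conv]

/-- The equations of the `p`-kernels. -/
theorem pKernel_identity {τ D h u : V →ₗ[R] V} {β p P : TensorAlgebra R V →ₗ[R] V}
    (hβ : β ∘ₗ TensorAlgebra.ι R = 0) (hDD : ∀ x, D (D x) = 0)
    (hh : ∀ x, D (h x) + h (D x) = u x - x)
    (hb : (D ∘ₗ proj + β) ∘ₗ coder τ (D ∘ₗ proj + β) = 0)
    (hP : P = proj + h ∘ₗ p) (hp : p = β ∘ₗ hat P) (hP1 : P 1 = 0)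
    (hτP : τ ∘ₗ P = P ∘ₗ (tmap τ).toLinearMap) :
    D ∘ₗ p + p ∘ₗ coder τ (D ∘ₗ proj + u ∘ₗ p) = 0 ∧
      (D ∘ₗ proj + β) ∘ₗ hat P = P ∘ₗ coder τ (D ∘ₗ proj + u ∘ₗ p) := by
  set b := D ∘ₗ proj + β with hbdef
  set d := D ∘ₗ proj + u ∘ₗ p with hddef
  -- The defect of `P` as a map from the codifferential of `d` to that of `b`.
  set E := b ∘ₗ hat P - P ∘ₗ coder τ d with hE
  have hbP : b ∘ₗ hat P = D ∘ₗ P + p := by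
    rw [hbdef, LinearMap.add_comp, LinearMap.comp_assoc, proj_comp_hat hP1, ← hp]
  have hcomm : (tmap τ).toLinearMap ∘ₗ hat P = hat P ∘ₗ (tmap τ).toLinearMap := by
    rw [map_comp_hat τ hP1, hat_comp_map τ hP1, hτP]
  have h1 : coder τ b ∘ₗ hat P =
      (hat P ∘ₗ (tmap τ).toLinearMap) ⋆ (TensorAlgebra.ι R ∘ₗ E) ⋆ hat P +
        hat P ∘ₗ coder τ d := by
    rw [coder_comp τ b (isCoalg_hat hP1), hat_comp_coder τ d hP1, hcomm, ← conv_add, ← add_conv,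
      ← LinearMap.comp_add, hE, sub_add_cancel]
  set Z := (hat P ∘ₗ (tmap τ).toLinearMap) ⋆ (TensorAlgebra.ι R ∘ₗ E) ⋆ hat P with hZ
  have h2 (x) : D (p x) + p (coder τ d x) = - β (Z x) := by
    have e1 : b (coder τ b (hat P x)) = 0 := LinearMap.congr_fun hb (hat P x)
    have e2 : coder τ b (hat P x) = Z x + hat P (coder τ d x) := LinearMap.congr_fun h1 x
    have e3 : proj (coder τ b (hat P x)) = b (hat P x) :=
      LinearMap.congr_fun (proj_comp_coder τ b) _
    have e4 : b (hat P x) = D (P x) + p x := LinearMap.congr_fun hbP x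
    have e5 : p (coder τ d x) = β (hat P (coder τ d x)) := LinearMap.congr_fun hp _
    have e6 : b (coder τ b (hat P x)) = D (proj (coder τ b (hat P x))) +
      β (coder τ b (hat P x)) := rfl
    rw [e6, e3, e4, map_add, hDD, zero_add, e2, map_add, ← e5] at e1
    rw [eq_neg_iff_add_eq_zero, ← e1]
    abel
  -- Inserting `P = proj + h p` and replacing `D h` by `u - 1 - h D` turns `E` into `-h (D p + p
  -- d̂)`, to which `h2` applies.
  have h3 : E = h ∘ₗ β ∘ₗ Z := by
    ext x
    have e4 : b (hat P x) = D (P x) + p x := LinearMap.congr_fun hbP x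
    have e5 : P x = proj x + h (p x) := LinearMap.congr_fun hP x
    have e6 : P (coder τ d x) = proj (coder τ d x) + h (p (coder τ d x)) :=
      LinearMap.congr_fun hP _
    have e7 : proj (coder τ d x) = D (proj x) + u (p x) :=
      LinearMap.congr_fun (proj_comp_coder τ d) _
    have e8 := congrArg h (h2 x)
    rw [map_add, map_neg, eq_neg_iff_add_eq_zero] at e8
    have e9 := hh (p x)
    simp only [hE, LinearMap.sub_apply, LinearMap.comp_apply]
    rw [e4, e6, e7, e5, map_add]
    linear_combination (norm := abel) e9 - e8
  -- If `E` vanishes below arity `n`, then `β Z` vanishes below `n + 1`, because `β` has no linear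
  -- part; the equation `E = h β Z` closes the induction.
  have h4 : E = 0 := by
    refine eq_zero_of_vanishesBelow fun n => ?_
    induction n with
    | zero => exact vanishesBelow_zero _
    | succ n ih =>
      rw [h3, hZ, hat_comp_map τ hP1]
      exact (VanishesBelow.comp_hat_conv hβ ih (by simp [hP1]) hP1).comp h
  refine ⟨?_, sub_eq_zero.1 h4⟩
  ext x
  have := h2 x
  rw [hZ, h4] at this
  simpa using this

/-- The transferred structure and the map `ψ` back to the given structure. -/
theorem transfer_structure {τ D h u : V →ₗ[R] V} {σ D' : W →ₗ[R] W} {f : V →ₗ[R] W}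
    {g : W →ₗ[R] V} {β p P : TensorAlgebra R V →ₗ[R] V}
    (hβ : β ∘ₗ TensorAlgebra.ι R = 0) (hDD : ∀ x, D (D x) = 0)
    (hDD' : ∀ x, D' (D' x) = 0)
    (hf : ∀ x, f (D x) = D' (f x)) (hg : ∀ x, g (D' x) = D (g x)) (hu : u = g ∘ₗ f)
    (hτg : τ ∘ₗ g = g ∘ₗ σ)
    (hh : ∀ x, D (h x) + h (D x) = u x - x)
    (hb : (D ∘ₗ proj + β) ∘ₗ coder τ (D ∘ₗ proj + β) = 0)
    (hP : P = proj + h ∘ₗ p) (hp : p = β ∘ₗ hat P) (hP1 : P 1 = 0)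
    (hτP : τ ∘ₗ P = P ∘ₗ (tmap τ).toLinearMap) :
    (D' ∘ₗ proj + f ∘ₗ p ∘ₗ (tmap g).toLinearMap) ∘ₗ
        coder σ (D' ∘ₗ proj + f ∘ₗ p ∘ₗ (tmap g).toLinearMap) = 0 ∧
      (D ∘ₗ proj + β) ∘ₗ hat (P ∘ₗ (tmap g).toLinearMap) = (P ∘ₗ (tmap g).toLinearMap) ∘ₗ
        coder σ (D' ∘ₗ proj + f ∘ₗ p ∘ₗ (tmap g).toLinearMap) := by
  obtain ⟨h1, h2⟩ := pKernel_identity hβ hDD hh hb hP hp hP1 hτP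
  set d := D ∘ₗ proj + u ∘ₗ p with hd
  set n := D' ∘ₗ proj + f ∘ₗ p ∘ₗ (tmap g).toLinearMap with hn
  have hpg (x) : proj (tmap g x) = g (proj x) := by
    have := proj_comp_hat (C := g ∘ₗ proj) (by simp)
    rw [← map_eq_hat] at this
    exact LinearMap.congr_fun this x
  -- As `u = g f`, the map `g` intertwines the corestrictions `n` and `d`, hence also their
  -- coderivations. Both claims then come from the `p`-kernel identities restricted along `tmap g`,
  -- the first after applying `f`.
  have hdg : d ∘ₗ (tmap g).toLinearMap = g ∘ₗ n := by
    ext x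
    simp [hd, hn, hpg, hu, hg]
  have hcomm : (tmap τ).toLinearMap ∘ₗ (tmap g).toLinearMap =
      (tmap g).toLinearMap ∘ₗ (tmap σ).toLinearMap := by
    rw [map_eq_hat g, map_comp_hat τ (by simp), hat_comp_map σ (by simp), ← LinearMap.comp_assoc,
      hτg]
    congr 1
    ext x
    have := proj_comp_hat (C := σ ∘ₗ proj) (by simp)
    rw [← map_eq_hat] at this
    have := LinearMap.congr_fun this x
    simp at this
    simp [this]
  have h3 : coder τ d ∘ₗ (tmap g).toLinearMap = (tmap g).toLinearMap ∘ₗ coder σ n := by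
    rw [coder_comp τ d (isCoalg_map g), hcomm, hdg]
    have h4 := hat_comp_coder σ n (C := g ∘ₗ proj) (by simp)
    rw [← map_eq_hat] at h4
    rw [h4, LinearMap.comp_assoc (coder σ n) proj g, proj_comp_coder]
  have h3' (x) : coder τ d (tmap g x) = tmap g (coder σ n x) := LinearMap.congr_fun h3 x
  constructor
  · ext x
    have e1 : proj (coder σ n x) = n x := LinearMap.congr_fun (proj_comp_coder σ n) x
    have e2 := congrArg f (LinearMap.congr_fun h1 (tmap g x))
    simp only [LinearMap.add_apply, LinearMap.comp_apply, LinearMap.zero_apply, map_zero,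
      map_add, hf, h3'] at e2
    have e3 : n x = D' (proj x) + f (p (tmap g x)) := rfl
    have e4 : n (coder σ n x) = D' (proj (coder σ n x)) + f (p (tmap g (coder σ n x))) := rfl
    rw [LinearMap.comp_apply, e4, e1, e3, map_add, hDD', zero_add, e2]
    rfl
  · rw [← hat_comp (isCoalg_map g) (by simp) hP1, ← LinearMap.comp_assoc, h2,
      LinearMap.comp_assoc, h3, LinearMap.comp_assoc]

/-- The map `φ` to the transferred structure and the homotopy `H`. -/
theorem transfer_map_homotopy {τ D h u : V →ₗ[R] V} {σ D' : W →ₗ[R] W} {f : V →ₗ[R] W}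
    {g : W →ₗ[R] V} {β p P q χ H : TensorAlgebra R V →ₗ[R] V}
    {ν : TensorAlgebra R W →ₗ[R] W} {ψ : TensorAlgebra R W →ₗ[R] V}
    {φ : TensorAlgebra R V →ₗ[R] W}
    (hβ : β ∘ₗ TensorAlgebra.ι R = 0) (hDD : ∀ x, D (D x) = 0)
    (hf : ∀ x, f (D x) = D' (f x)) (hu : u = g ∘ₗ f)
    (hττ : τ ∘ₗ τ = LinearMap.id)
    (hh : ∀ x, D (h x) + h (D x) = u x - x)
    (hb : (D ∘ₗ proj + β) ∘ₗ coder τ (D ∘ₗ proj + β) = 0)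
    (hP : P = proj + h ∘ₗ p) (hp : p = β ∘ₗ hat P) (hP1 : P 1 = 0)
    (hν : ν = f ∘ₗ p ∘ₗ (tmap g).toLinearMap) (hψ : ψ = P ∘ₗ (tmap g).toLinearMap)
    (hbψ : (D ∘ₗ proj + β) ∘ₗ hat ψ = ψ ∘ₗ coder σ (D' ∘ₗ proj + ν))
    (hφ : φ = f ∘ₗ q) (hχ : χ = ψ ∘ₗ hat φ) (hH : H = h ∘ₗ q) (hq1 : q 1 = 0)
    (hq : q = proj + β ∘ₗ
      (((tmap τ).toLinearMap ∘ₗ hat χ) ⋆ (TensorAlgebra.ι R ∘ₗ H) ⋆ LinearMap.id))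
    (hτφ : σ ∘ₗ φ = φ ∘ₗ (tmap τ).toLinearMap)
    (hτχ : τ ∘ₗ χ = χ ∘ₗ (tmap τ).toLinearMap)
    (hτH : H ∘ₗ (tmap τ).toLinearMap = -(τ ∘ₗ H))
    (hτb : (D ∘ₗ proj + β) ∘ₗ (tmap τ).toLinearMap = -(τ ∘ₗ (D ∘ₗ proj + β))) :
    (D' ∘ₗ proj + ν) ∘ₗ hat φ = φ ∘ₗ coder τ (D ∘ₗ proj + β) ∧
      (D ∘ₗ proj + β) ∘ₗ
          (((tmap τ).toLinearMap ∘ₗ hat χ) ⋆ (TensorAlgebra.ι R ∘ₗ H) ⋆ LinearMap.id) +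
        H ∘ₗ coder τ (D ∘ₗ proj + β) = χ - proj := by
  set b := D ∘ₗ proj + β with hbdef
  set n := D' ∘ₗ proj + ν with hn
  set K := ((tmap τ).toLinearMap ∘ₗ hat χ) ⋆ (TensorAlgebra.ι R ∘ₗ H) ⋆ LinearMap.id with hK
  have hφ1 : φ 1 = 0 := by simp [hφ, hq1]
  have hψ1 : ψ 1 = 0 := by simp [hψ, hP1]
  have hχ1 : χ 1 = 0 := by simp [hχ, hψ1]
  have hH1 : H 1 = 0 := by simp [hH, hq1]
  have hχhat : hat χ = hat ψ ∘ₗ hat φ := by rw [hχ, hat_comp (isCoalg_hat hφ1) (by simp) hψ1]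
  have hψhat : hat ψ = hat P ∘ₗ (tmap g).toLinearMap := by rw [hψ, hat_comp_map g hP1]
  have hβχ (x) : β (hat χ x) = p (tmap g (hat φ x)) := by rw [hχhat, hψhat, hp]; rfl
  have hpg (x) : proj (tmap g x) = g (proj x) := by
    have := proj_comp_hat (C := g ∘ₗ proj) (by simp)
    rw [← map_eq_hat] at this
    exact LinearMap.congr_fun this x
  have hpφ (x) : proj (hat φ x) = φ x := LinearMap.congr_fun (proj_comp_hat hφ1) x
  have hχeq (x) : χ x = u (q x) + h (β (hat χ x)) := by
    rw [hβχ, hχ, hψ, hP]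
    simp only [LinearMap.comp_apply, LinearMap.add_apply, AlgHom.toLinearMap_apply, hpg, hpφ, hu]
    simp [hφ]
  -- The one defect to be killed. `X` and `Y` are the defects of `χ` and of the homotopy equation;
  -- both turn out to be determined linearly by `C`.
  set C := D ∘ₗ q + β ∘ₗ hat χ - q ∘ₗ coder τ b with hC
  set X := b ∘ₗ hat χ - χ ∘ₗ coder τ b with hX
  set Y := b ∘ₗ K + H ∘ₗ coder τ b - χ + proj with hY
  have hCx (x) : C x = D (q x) + β (hat χ x) - q (coder τ b x) := rfl
  have hnφ : n ∘ₗ hat φ = f ∘ₗ C + φ ∘ₗ coder τ b := by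
    ext x
    have : n (hat φ x) = D' (proj (hat φ x)) + ν (hat φ x) := rfl
    rw [LinearMap.comp_apply, this, hpφ, hν, LinearMap.add_apply]
    simp only [LinearMap.comp_apply, hCx, hβχ, hφ, map_add, map_sub, hf]
    simp
  have hXC : X = ψ ∘ₗ ((hat φ ∘ₗ (tmap τ).toLinearMap) ⋆
      (TensorAlgebra.ι R ∘ₗ f ∘ₗ C) ⋆ hat φ) := by
    have hcomm : (tmap σ).toLinearMap ∘ₗ hat φ = hat φ ∘ₗ (tmap τ).toLinearMap := by
      rw [map_comp_hat σ hφ1, hat_comp_map τ hφ1, hτφ]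
    have h1 : b ∘ₗ hat χ = ψ ∘ₗ coder σ n ∘ₗ hat φ := by
      rw [hχhat, ← LinearMap.comp_assoc, hbψ, LinearMap.comp_assoc]
    rw [hX, h1, coder_comp σ n (isCoalg_hat hφ1), hnφ, hcomm, LinearMap.comp_add, add_conv,
      conv_add, LinearMap.comp_add, ← hat_comp_coder τ b hφ1, hχ, LinearMap.comp_assoc,
      add_sub_cancel_right]
  have hcoalg : IsCoalg ((tmap τ).toLinearMap ∘ₗ hat χ) := by
    rw [map_comp_hat τ hχ1]
    exact isCoalg_hat (by simp [hχ1])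
  have hKcoder : IsCoder ((tmap τ).toLinearMap ∘ₗ hat χ) K LinearMap.id :=
    isCoder_conv hcoalg isCoalg_id H
  have hprojK : proj ∘ₗ K = H := by
    rw [hK, map_comp_hat τ hχ1]
    exact proj_comp_hat_conv (by simp [hχ1]) isCoalg_id
  have hqx (x) : q x = proj x + β (K x) := LinearMap.congr_fun hq x
  have hbK (x) : b (K x) = D (H x) + q x - proj x := by
    have e1 : b (K x) = D (proj (K x)) + β (K x) := rfl
    have e2 : proj (K x) = H x := LinearMap.congr_fun hprojK x
    rw [e1, e2, hqx]
    abel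
  -- The homotopy relation for `h` is applied to `q x`; the terms `u q` and `proj` cancel against
  -- `χ` and `b K`.
  have hYC : Y = -(h ∘ₗ C) := by
    ext x
    have e1 : Y x = b (K x) + H (coder τ b x) - χ x + proj x := rfl
    have e2 := hh (q x)
    simp only [e1, hbK, hχeq, hH, LinearMap.comp_apply, LinearMap.neg_apply, hCx, map_add,
      map_sub]
    linear_combination (norm := abel) e2
  have hττ' : (tmap τ).toLinearMap ∘ₗ (tmap τ).toLinearMap = LinearMap.id := by
    have e : proj ∘ₗ (tmap τ).toLinearMap = τ ∘ₗ proj := by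
      have := proj_comp_hat (C := τ ∘ₗ proj) (by simp)
      rwa [← map_eq_hat] at this
    nth_rewrite 2 [map_eq_hat]
    rw [map_comp_hat τ (by simp), ← LinearMap.comp_assoc, hττ, LinearMap.id_comp, hat_proj]
  have hcomm : (tmap τ).toLinearMap ∘ₗ hat χ = hat χ ∘ₗ (tmap τ).toLinearMap := by
    rw [map_comp_hat τ hχ1, hat_comp_map τ hχ1, hτχ]
  have hτχτ : (tmap τ).toLinearMap ∘ₗ (tmap τ).toLinearMap ∘ₗ hat χ = hat χ := by
    rw [← LinearMap.comp_assoc, hττ', LinearMap.id_comp]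
  have hletter (F : TensorAlgebra R V →ₗ[R] V) :
      (tmap τ).toLinearMap ∘ₗ TensorAlgebra.ι R ∘ₗ F = TensorAlgebra.ι R ∘ₗ τ ∘ₗ F := by
    ext x; simp
  -- The error in the statement that the coderivation `K` is a homotopy from `hat χ` to the
  -- identity; it vanishes with `X` and `Y`.
  set Rm := hat χ ⋆ (TensorAlgebra.ι R ∘ₗ Y) ⋆ LinearMap.id -
    hat χ ⋆ (TensorAlgebra.ι R ∘ₗ τ ∘ₗ X) ⋆ K with hRm
  -- Expanding both composites by the Leibniz rule, the terms containing both `H` and `coder τ b` as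
  -- separate factors cancel because `H` is odd.
  have hmain : coder τ b ∘ₗ K + K ∘ₗ coder τ b = Rm + (hat χ - LinearMap.id) := by
    have h1 : coder τ b ∘ₗ K =
        hat χ ⋆ (TensorAlgebra.ι R ∘ₗ b ∘ₗ (tmap τ).toLinearMap ∘ₗ hat χ) ⋆ K +
        hat χ ⋆ (TensorAlgebra.ι R ∘ₗ b ∘ₗ K) ⋆ LinearMap.id +
        hat χ ⋆ (TensorAlgebra.ι R ∘ₗ τ ∘ₗ H) ⋆ coder τ b := by
      have hτK : (tmap τ).toLinearMap ∘ₗ K =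
          hat χ ⋆ (TensorAlgebra.ι R ∘ₗ τ ∘ₗ H) ⋆ (tmap τ).toLinearMap := by
        rw [hK, algHom_comp_conv, algHom_comp_conv, hτχτ, hletter, LinearMap.comp_id]
      conv_lhs => rw [coder]
      rw [hKcoder.conv_comp, hKcoder.conv_comp, hτχτ, hτK]
      simp only [LinearMap.comp_assoc, LinearMap.comp_id, LinearMap.id_comp, conv_add, conv_assoc,
        coder]
    have h2 : K ∘ₗ coder τ b =
        hat χ ⋆ (TensorAlgebra.ι R ∘ₗ H ∘ₗ (tmap τ).toLinearMap) ⋆ coder τ b +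
        hat χ ⋆ (TensorAlgebra.ι R ∘ₗ H ∘ₗ coder τ b) ⋆ LinearMap.id +
        hat χ ⋆ (TensorAlgebra.ι R ∘ₗ τ ∘ₗ χ ∘ₗ coder τ b) ⋆ K := by
      have hD := isCoder_coder τ b
      have h3 : ((tmap τ).toLinearMap ∘ₗ hat χ) ∘ₗ coder τ b = hat χ ⋆
          (TensorAlgebra.ι R ∘ₗ τ ∘ₗ χ ∘ₗ coder τ b) ⋆ ((tmap τ).toLinearMap ∘ₗ hat χ) := by
        rw [LinearMap.comp_assoc, hat_comp_coder τ b hχ1, algHom_comp_conv, algHom_comp_conv,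
          ← hcomm, hτχτ, hletter]
      have h4 : ((tmap τ).toLinearMap ∘ₗ hat χ) ∘ₗ (tmap τ).toLinearMap = hat χ := by
        rw [LinearMap.comp_assoc, ← hcomm, hτχτ]
      conv_lhs => rw [hK]
      rw [hD.conv_comp, hD.conv_comp, h3, h4]
      simp only [LinearMap.comp_assoc, LinearMap.comp_id, LinearMap.id_comp, conv_add, conv_assoc,
        ← hK]
    have h5 : b ∘ₗ (tmap τ).toLinearMap ∘ₗ hat χ = -(τ ∘ₗ X) - τ ∘ₗ χ ∘ₗ coder τ b := by
      rw [← LinearMap.comp_assoc, hτb, hX, LinearMap.neg_comp, LinearMap.comp_sub,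
        LinearMap.comp_assoc]
      abel
    have h6 : H ∘ₗ coder τ b = Y + χ - proj - b ∘ₗ K := by
      rw [hY]; abel
    -- A telescoping sum: appending a factor `χ` to the geometric series of `χ`, or prepending a
    -- factor `proj` to that of `proj`, removes only the unit.
    have h7 : hat χ ⋆ (TensorAlgebra.ι R ∘ₗ χ) ⋆ LinearMap.id -
        hat χ ⋆ (TensorAlgebra.ι R ∘ₗ proj) ⋆ LinearMap.id = hat χ - LinearMap.id := by
      have h8 : hat χ ⋆ (TensorAlgebra.ι R ∘ₗ χ) = hat χ - convOne := by
        have := geom_eq' (x := TensorAlgebra.ι R ∘ₗ χ) (by simp [hχ1])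
        nth_rewrite 2 [hat]
        rw [this]
        simp only [hat]
        abel
      rw [letter_proj_conv_id, ← conv_assoc, h8, sub_conv, conv_sub, convOne_conv, conv_convOne]
      abel
    rw [h1, h2, h5, h6, hτH, hRm, ← h7]
    simp only [LinearMap.comp_add, LinearMap.comp_sub, LinearMap.comp_neg, conv_add, add_conv,
      conv_sub, sub_conv, conv_neg, neg_conv]
    abel
  -- This is `b b̂ K = 0` with `b̂ K` rewritten by `hmain`, combined with the recursion for `q`
  -- evaluated at `coder τ b x`.
  have hCR : C = -(β ∘ₗ Rm) := by
    ext x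
    have e1 : b (coder τ b (K x)) = 0 := LinearMap.congr_fun hb (K x)
    have e2 : b (coder τ b (K x)) = D (proj (coder τ b (K x))) + β (coder τ b (K x)) := rfl
    have e3 : proj (coder τ b (K x)) = b (K x) := LinearMap.congr_fun (proj_comp_coder τ b) _
    have e4 : coder τ b (K x) + K (coder τ b x) = Rm x + (hat χ x - x) :=
      LinearMap.congr_fun hmain x
    have e5 : b x = D (proj x) + β x := rfl
    have e6 : proj (coder τ b x) = b x := LinearMap.congr_fun (proj_comp_coder τ b) _
    have e7 := hqx (coder τ b x)
    rw [e2, e3, hbK, eq_sub_of_add_eq e4] at e1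
    simp only [map_add, map_sub, hDD] at e1
    rw [hCx, LinearMap.neg_apply, LinearMap.comp_apply, e7, e6, e5]
    linear_combination (norm := abel) e1
  -- Both terms of `β Rm` gain one arity: the one with `Y` because `β` has no linear part, the one
  -- with `X` because the factor `K` vanishes on the empty word.
  have hC0 : C = 0 := by
    refine eq_zero_of_vanishesBelow fun k => ?_
    induction k with
    | zero => exact vanishesBelow_zero _
    | succ k ih =>
      have hXv : VanishesBelow k X := by
        rw [hXC]
        exact VanishesBelow.comp_hat_conv_le _ (ih.comp f) _ _
      have hYv : VanishesBelow k Y := by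
        rw [hYC]
        exact (ih.comp h).neg
      have hK1 : K 1 = 0 := by simp [hK, hH1]
      rw [hCR, hRm, LinearMap.comp_sub, sub_eq_add_neg]
      refine (VanishesBelow.add ?_ ?_).neg
      · rw [← hat_proj]
        exact VanishesBelow.comp_hat_conv hβ hYv hχ1 proj_one
      · have := (vanishesBelow_zero (hat χ)).conv
          (((hXv.comp τ).comp (TensorAlgebra.ι R)).conv (vanishesBelow_one hK1))
        rw [zero_add] at this
        exact (this.comp β).neg
  constructor
  · rw [hnφ, hC0]
    simp
  · have : Y = 0 := by rw [hYC, hC0]; simp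
    rw [hY] at this
    rw [eq_sub_iff_add_eq, ← sub_eq_zero, ← this]
    abel

end Transfer

open CategoryTheory

universe u v

/-! ### Suspended operations and their signs -/

noncomputable section

variable {R : Type u} [CommRing R] {V W U : ChainComplex (ModuleCat.{v} R) ℤ}

/-! ### Signs and Koszul operators -/

/-- The sign `(-1) ^ d` as an integer. -/
def sg (d : ℤ) : ℤ := ((Int.negOnePow d : ℤˣ) : ℤ)

theorem sg_add (a b : ℤ) : sg (a + b) = sg a * sg b := by simp [sg, Int.negOnePow_add]

theorem sg_natCast (n : ℕ) : sg n = (-1) ^ n := Int.coe_negOnePow_natCast n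

theorem sg_congr {a b : ℤ} (h : Even (a - b)) : sg a = sg b := by
  rw [sg, sg, (Int.negOnePow_eq_iff a b).2 h]

@[simp] theorem sg_zero : sg 0 = 1 := by simp [sg]

@[simp] theorem sg_one : sg 1 = -1 := by simp [sg]

theorem sg_mul_self (a : ℤ) : sg a * sg a = 1 := by
  rw [← sg_add, ← sg_zero]
  exact sg_congr (by simp)

theorem sg_sum {ι : Type*} (s : Finset ι) (a : ι → ℤ) : sg (∑ i ∈ s, a i) = ∏ i ∈ s, sg (a i) := by
  induction s using Finset.cons_induction with
  | empty => simp
  | cons i s hi ih => rw [Finset.sum_cons, Finset.prod_cons, sg_add, ih]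

theorem koszul_incl (d i : ℤ) (x : V.X i) : koszul V d (incl V i x) = sg (d * i) • incl V i x := by
  simp [koszul, incl, sg]

theorem tot_hom_ext {N : Type*} [AddCommGroup N] [Module R N] {f g : Tot V →ₗ[R] N}
    (h : ∀ i x, f (incl V i x) = g (incl V i x)) : f = g :=
  DirectSum.linearMap_ext R fun i => LinearMap.ext (h i)

theorem koszul_congr {d e : ℤ} (h : Even (d - e)) : koszul V d = koszul V e := by
  refine tot_hom_ext fun i x => ?_
  rw [koszul_incl, koszul_incl, sg_congr]
  rw [← sub_mul]
  exact h.mul_right i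

@[simp] theorem koszul_zero : koszul V 0 = LinearMap.id := by
  refine tot_hom_ext fun i x => ?_
  simp [koszul_incl]

theorem koszul_koszul (d e : ℤ) (x : Tot V) : koszul V d (koszul V e x) = koszul V (d + e) x := by
  suffices koszul V d ∘ₗ koszul V e = koszul V (d + e) from LinearMap.congr_fun this x
  refine tot_hom_ext fun i x => ?_
  rw [LinearMap.comp_apply, koszul_incl, map_zsmul, koszul_incl, koszul_incl, smul_smul, ← sg_add,
    add_mul, add_comm]

/-- The parity operator on the suspension of `V`. -/
def parity (V : ChainComplex (ModuleCat.{v} R) ℤ) : Tot V →ₗ[R] Tot V := -koszul V 1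

theorem parity_parity : parity V ∘ₗ parity V = LinearMap.id := by
  ext1 x
  refine LinearMap.ext fun y => ?_
  simp only [parity, LinearMap.comp_apply, LinearMap.neg_apply, map_neg, neg_neg, koszul_koszul]
  rw [koszul_congr (e := 0) (by decide)]
  simp

/-! ### Degrees -/

/-- The linear map `f` is homogeneous of degree `d`. -/
def LinHasDegree (d : ℤ) (f : Tot V →ₗ[R] Tot W) : Prop :=
  ∀ i x, f (incl V i x) ∈ LinearMap.range (incl W (i + d))

theorem linHasDegree_koszul (d : ℤ) : LinHasDegree 0 (koszul V d) := by
  intro i x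
  rw [koszul_incl, add_zero]
  exact Submodule.smul_of_tower_mem _ _ ⟨x, rfl⟩

theorem linHasDegree_chainTot (f : V ⟶ W) : LinHasDegree 0 (chainTot f) := by
  intro i x
  rw [add_zero]
  exact ⟨(f.f i).hom x, by simp [chainTot, incl]⟩

theorem linHasDegree_htpyTot {a b : V ⟶ W} (h : Homotopy a b) : LinHasDegree 1 (htpyTot h) := by
  intro i x
  exact ⟨(h.hom i (i + 1)).hom x, by simp [htpyTot, incl]⟩

theorem linHasDegree_diff : LinHasDegree (-1) (diff V) := by
  intro i x
  exact ⟨(V.d i (i - 1)).hom x, by simp [diff, incl]; rfl⟩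

theorem linHasDegree_id : LinHasDegree 0 (LinearMap.id : Tot V →ₗ[R] Tot V) := by
  intro i x
  rw [add_zero]
  exact ⟨x, rfl⟩

namespace HasDegree

variable {n : ℕ} {d e : ℤ} {F G : Op V W n}

theorem congr (h : HasDegree d F) (hd : d = e) : HasDegree e F := hd ▸ h

theorem zero : HasDegree d (0 : Op V W n) := fun _ _ => Submodule.zero_mem _

theorem add (hF : HasDegree d F) (hG : HasDegree d G) : HasDegree d (F + G) :=
  fun a x => Submodule.add_mem _ (hF a x) (hG a x)

theorem zsmul (k : ℤ) (hF : HasDegree d F) : HasDegree d (k • F) :=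
  fun a x => Submodule.smul_of_tower_mem _ k (hF a x)

theorem sum {ι : Type*} (s : Finset ι) {F : ι → Op V W n} (h : ∀ i ∈ s, HasDegree d (F i)) :
    HasDegree d (∑ i ∈ s, F i) := by
  induction s using Finset.cons_induction with
  | empty => exact zero
  | cons i s hi ih =>
    rw [Finset.sum_cons]
    exact (h i (by simp)).add (ih fun j hj => h j (by simp [hj]))

theorem comp {f : Tot W →ₗ[R] Tot U} (hf : LinHasDegree e f) (hF : HasDegree d F) :
    HasDegree (d + e) (f.compMultilinearMap F) := by
  intro a x
  obtain ⟨y, hy⟩ := hF a x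
  rw [LinearMap.compMultilinearMap_apply, ← hy, ← add_assoc]
  exact hf _ y

theorem compLinearMap {F : Op W U n} (hF : HasDegree d F) {f : Fin n → Tot V →ₗ[R] Tot W}
    (hf : ∀ i, LinHasDegree 0 (f i)) : HasDegree d (F.compLinearMap f) := by
  intro a x
  have h (i : Fin n) : ∃ y, incl W (a i) y = f i (incl V (a i) (x i)) := by
    have := hf i (a i) (x i)
    rwa [add_zero] at this
  choose y hy using h
  rw [MultilinearMap.compLinearMap_apply]
  simp only [← hy]
  exact hF a y

theorem lin {f : Tot V →ₗ[R] Tot W} (hf : LinHasDegree 0 f) (n : ℕ) :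
    HasDegree ((n : ℤ) - 1) (lin f n) := by
  match n with
  | 0 => exact zero
  | 1 =>
    intro a x
    have := hf (a 0) (x 0)
    have hs : ∑ i, a i = a 0 := by simp
    rw [hs]
    exact this
  | n + 2 => exact zero

theorem idOp (n : ℕ) : HasDegree ((n : ℤ) - 1) (idOp V n) := lin linHasDegree_id n

theorem tcomp (c : Composition n) {F : Op W U c.length} (hF : HasDegree d F)
    {e : Fin c.length → ℤ} {G : ∀ j : Fin c.length, Op V W (c.blocksFun j)}
    (hG : ∀ j, HasDegree (e j) (G j)) : HasDegree (d + ∑ j, e j) (tcomp c F e G) := by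
  intro a x
  have h (i : Fin c.length) := (hG i).compLinearMap
    (f := fun _ => koszul V (∑ j ∈ Finset.univ.filter (fun j => i < j), e j))
    (fun _ => linHasDegree_koszul _) (fun j => a (c.embedding i j)) (fun j => x (c.embedding i j))
  choose y hy using h
  have := hF _ y
  simp only [hy] at this
  have hs : ∑ i, a i = ∑ i : Fin c.length, ∑ j : Fin (c.blocksFun i), a (c.embedding i j) := by
    rw [← c.blocksFinEquiv.sum_comp, Fintype.sum_sigma]
    rfl
  rw [hs, add_comm d, ← add_assoc, ← Finset.sum_add_distrib]
  exact this

end HasDegree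

/-- `F` commutes with the Koszul operators up to the sign of an operation of degree `d`. -/
def HasParity {n : ℕ} (d : ℤ) (F : Op V W n) : Prop :=
  ∀ (e : ℤ) (x : Fin n → Tot V),
    koszul W e (F x) = sg (e * d) • F (fun i => koszul V e (x i))

/-- The sign computations use degrees only through this commutation rule. It is checked on
homogeneous arguments and extends to the direct sum by multilinearity. -/
theorem HasDegree.hasParity {n : ℕ} {d : ℤ} {F : Op V W n} (hF : HasDegree d F) :
    HasParity d F := by
  intro e x
  suffices (koszul W e).compMultilinearMap F =
      sg (e * d) • F.compLinearMap (fun _ => koszul V e) from DFunLike.congr_fun this x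
  refine MultilinearMap.dfinsupp_ext fun a => ?_
  refine MultilinearMap.ext fun y => ?_
  change koszul W e (F fun i => incl V (a i) (y i)) =
    sg (e * d) • F fun i => koszul V e (incl V (a i) (y i))
  obtain ⟨z, hz⟩ := hF a y
  rw [← hz, koszul_incl, hz]
  simp only [koszul_incl, ← Int.cast_smul_eq_zsmul R]
  rw [MultilinearMap.map_smul_univ, smul_smul]
  congr 1
  rw [← Int.cast_prod, ← sg_sum, ← Int.cast_mul, ← sg_add]
  congr 2
  rw [← Finset.mul_sum]
  ring

theorem HasParity.congr {n : ℕ} {d e : ℤ} {F : Op V W n} (h : HasParity d F)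
    (hde : Even (d - e)) : HasParity e F := by
  intro a x
  rw [h a x, sg_congr]
  rw [← mul_sub]
  exact hde.mul_left a

theorem LinHasDegree.koszul_comm {d : ℤ} {f : Tot V →ₗ[R] Tot W} (hf : LinHasDegree d f)
    (e : ℤ) (x : Tot V) : koszul W e (f x) = sg (e * d) • f (koszul V e x) := by
  suffices koszul W e ∘ₗ f = sg (e * d) • f ∘ₗ koszul V e from LinearMap.congr_fun this x
  refine tot_hom_ext fun i x => ?_
  obtain ⟨y, hy⟩ := hf i x
  simp only [LinearMap.comp_apply, LinearMap.smul_apply]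
  rw [← hy, koszul_incl, hy, koszul_incl, map_zsmul, smul_smul, ← sg_add, mul_add, add_comm]

/-! ### Suspension of operations -/

/-- The suspension of an operation. -/
def susp {n : ℕ} (F : Op V W n) : Op V W n :=
  sg (n.choose 2) • F.compLinearMap (fun i => koszul V ((n : ℤ) - 1 - i))

theorem susp_apply {n : ℕ} (F : Op V W n) (v : Fin n → Tot V) :
    susp F v = sg (n.choose 2) • F (fun i => koszul V ((n : ℤ) - 1 - i) (v i)) := rfl

theorem susp_susp {n : ℕ} (F : Op V W n) : susp (susp F) = F := by
  refine MultilinearMap.ext fun v => ?_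
  rw [susp_apply, susp_apply, smul_smul, sg_mul_self, one_smul]
  congr 1
  ext1 i
  rw [koszul_koszul, koszul_congr (e := 0) (by simp)]
  simp

/-- The twist is an involution, so equations between operations may be verified after suspension. -/
theorem susp_injective {n : ℕ} {F G : Op V W n} (h : ∀ v, susp F v = susp G v) : F = G := by
  rw [← susp_susp F, ← susp_susp G, MultilinearMap.ext h]

@[simp] theorem susp_zero {n : ℕ} : susp (0 : Op V W n) = 0 := by
  refine MultilinearMap.ext fun v => ?_
  simp [susp_apply]

theorem susp_add {n : ℕ} (F G : Op V W n) : susp (F + G) = susp F + susp G := by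
  refine MultilinearMap.ext fun v => ?_
  simp [susp_apply]

theorem susp_neg {n : ℕ} (F : Op V W n) : susp (-F) = -susp F := by
  refine MultilinearMap.ext fun v => ?_
  simp [susp_apply]

theorem susp_sub {n : ℕ} (F G : Op V W n) : susp (F - G) = susp F - susp G := by
  refine MultilinearMap.ext fun v => ?_
  simp [susp_apply, smul_sub]

theorem susp_zsmul {n : ℕ} (k : ℤ) (F : Op V W n) : susp (k • F) = k • susp F := by
  refine MultilinearMap.ext fun v => ?_
  simp [susp_apply, smul_comm k]

theorem susp_sum {n : ℕ} {ι : Type*} (s : Finset ι) (F : ι → Op V W n) :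
    susp (∑ i ∈ s, F i) = ∑ i ∈ s, susp (F i) := by
  refine MultilinearMap.ext fun v => ?_
  simp [susp_apply, Finset.smul_sum]

theorem susp_comp {n : ℕ} (f : Tot W →ₗ[R] Tot U) (F : Op V W n) :
    susp (f.compMultilinearMap F) = f.compMultilinearMap (susp F) := by
  refine MultilinearMap.ext fun v => ?_
  simp [susp_apply]

theorem susp_compLinearMap {n : ℕ} {g : Tot V →ₗ[R] Tot W} (hg : LinHasDegree 0 g)
    (F : Op W U n) :
    susp (F.compLinearMap fun _ => g) = (susp F).compLinearMap fun _ => g := by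
  refine MultilinearMap.ext fun v => ?_
  simp only [susp_apply, MultilinearMap.compLinearMap_apply]
  congr 2
  ext1 i
  rw [hg.koszul_comm]
  simp

theorem sum_eq_filter_add_filter {k : ℕ} (i : Fin k) (f : Fin k → ℤ) :
    ∑ j, f j = ∑ j ∈ Finset.univ.filter (fun j => j < i), f j + f i +
      ∑ j ∈ Finset.univ.filter (fun j => i < j), f j := by
  have h : f i = ∑ j, if j = i then f j else 0 := by simp
  rw [Finset.sum_filter, Finset.sum_filter, h, ← Finset.sum_add_distrib, ← Finset.sum_add_distrib]
  refine Finset.sum_congr rfl fun j _ => ?_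
  rcases lt_trichotomy j i with h | h | h
  · simp [h, h.ne, h.not_gt]
  · simp [h]
  · simp [h, h.ne', h.not_gt]

theorem sizeUpTo_eq_sum {n : ℕ} (c : Composition n) (i : Fin c.length) :
    (c.sizeUpTo i : ℤ) = ∑ j ∈ Finset.univ.filter (fun j => j < i), (c.blocksFun j : ℤ) := by
  rw [Composition.sizeUpTo, ← c.ofFn_blocksFun, List.sum_take_ofFn]
  push_cast
  rfl

/-- The composite of suspended operations. -/
theorem susp_tcomp {n : ℕ} (c : Composition n) (F : Op W U c.length) (e : Fin c.length → ℤ)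
    {G : ∀ j : Fin c.length, Op V W (c.blocksFun j)} (hG : ∀ j, HasParity (e j) (G j))
    (t : Fin c.length → ℤ)
    (ht : ∀ i, t i = ∑ j ∈ Finset.univ.filter (fun j => i < j), (e j + c.blocksFun j - 1))
    (v : Fin n → Tot V) :
    susp (tcomp c F e G) v =
      sg ((n.choose 2 : ℕ) + (c.length.choose 2 : ℕ) + ∑ j, ((c.blocksFun j).choose 2 : ℕ) +
        ∑ j, e j * ((c.length : ℤ) - 1 - j + t j)) •
      susp F (fun i => koszul W (t i) (susp (G i) (fun a => v (c.embedding i a)))) := by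
  -- Two ways to count the sign exponent on letter `a` of block `i`: the Koszul exponent of the
  -- later `G j` plus the suspension of the composite, against the suspension of `F`, the suspended
  -- Koszul exponent `t i`, and the suspension of `G i`.
  have key (i : Fin c.length) (a : Fin (c.blocksFun i)) :
      (∑ j ∈ Finset.univ.filter (fun j => i < j), e j) + ((n : ℤ) - 1 - c.embedding i a) =
        ((c.length : ℤ) - 1 - i + t i) + ((c.blocksFun i : ℤ) - 1 - a) := by
    have h1 : (n : ℤ) = c.sizeUpTo i + c.blocksFun i +
        ∑ j ∈ Finset.univ.filter (fun j => i < j), (c.blocksFun j : ℤ) := by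
      have h2 : ∑ j, (c.blocksFun j : ℤ) = n := by exact_mod_cast c.sum_blocksFun
      rw [sizeUpTo_eq_sum, ← h2, sum_eq_filter_add_filter i]
    have h4 : ((Finset.univ.filter (fun j => i < j)).card : ℤ) = (c.length : ℤ) - 1 - i := by
      rw [Finset.filter_lt_eq_Ioi, Fin.card_Ioi]
      omega
    rw [ht, Finset.sum_sub_distrib, Finset.sum_add_distrib, Finset.sum_const, nsmul_one, h4,
      c.coe_embedding]
    push_cast
    linarith
  have hsign : ∀ i : Fin c.length, koszul W ((c.length : ℤ) - 1 - i)
      (koszul W (t i) (susp (G i) (fun a => v (c.embedding i a)))) =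
      sg (((c.blocksFun i).choose 2 : ℕ) + e i * ((c.length : ℤ) - 1 - i + t i)) •
      G i (fun a => koszul V (∑ j ∈ Finset.univ.filter (fun j => i < j), e j)
        (koszul V ((n : ℤ) - 1 - c.embedding i a) (v (c.embedding i a)))) := by
    intro i
    rw [koszul_koszul, susp_apply, map_zsmul, hG i, smul_smul, ← sg_add, mul_comm (e i)]
    congr 2
    ext1 a
    rw [koszul_koszul, koszul_koszul, key]
  rw [susp_apply, susp_apply, smul_smul]
  simp only [hsign, ← Int.cast_smul_eq_zsmul R]
  rw [MultilinearMap.map_smul_univ, smul_smul, ← Int.cast_prod, ← sg_sum, ← Int.cast_mul,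
    ← sg_add, ← sg_add]
  congr 1
  congr 1
  refine sg_congr ⟨-((c.length.choose 2 : ℕ) + ∑ j, ((c.blocksFun j).choose 2 : ℕ) +
    ∑ j, e j * ((c.length : ℤ) - 1 - j + t j)), ?_⟩
  rw [Finset.sum_add_distrib]
  generalize ∑ j, e j * ((c.length : ℤ) - 1 - j + t j) = x
  push_cast
  ring

theorem choose_two_add (a b : ℕ) :
    (a + b).choose 2 = a.choose 2 + b.choose 2 + a * b := by
  induction b with
  | zero => simp
  | succ b ih =>
    rw [← add_assoc, Nat.choose_succ_succ' (a + b) 1, ih, Nat.choose_succ_succ' b 1,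
      Nat.choose_one_right, Nat.choose_one_right]
    ring

/-- The origin of `ϑ`: modulo 2 it is the sign left over in `susp_tcomp` when the `j`-th inner
operation has degree `r j - 1`. -/
theorem theta_ofFn {k : ℕ} (r : Fin k → ℕ) :
    (theta (List.ofFn r) : ℤ) + 2 * ∑ j, ((r j).choose 2 : ℕ) =
      ((∑ j, r j).choose 2 : ℕ) + (k.choose 2 : ℕ) + ∑ j, ((r j).choose 2 : ℕ) +
        ∑ j, ((r j : ℤ) - 1) * ((k : ℤ) - 1 - j) := by
  induction k with
  | zero => simp [theta]
  | succ k ih =>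
    have h1 : ((((List.ofFn fun j : Fin k => r j.succ).map (fun t : ℕ => t + 1)).sum : ℕ) : ℤ) =
        ((∑ j : Fin k, r j.succ : ℕ) : ℤ) + k := by
      rw [List.map_ofFn, List.sum_ofFn]
      simp [Finset.sum_add_distrib]
    have h2 := ih fun j => r j.succ
    have h3 : ∀ j : Fin k, ((k + 1 : ℕ) : ℤ) - 1 - (j.succ : ℕ) = (k : ℤ) - 1 - j := by
      intro j; rw [Fin.val_succ]; push_cast; ring
    rw [List.ofFn_succ, theta]
    simp only [Fin.sum_univ_succ, h3, Fin.val_zero]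
    rw [choose_two_add, Nat.choose_succ_succ' k 1, Nat.choose_one_right]
    push_cast at h1 h2 ⊢
    rw [h1]
    linear_combination h2

theorem even_theta_ones {l : List ℕ} (h : ∀ r ∈ l, r = 1) : Even (theta l) := by
  induction l with
  | nil => simp [theta]
  | cons a l ih =>
    rw [theta, h a (by simp)]
    have : l = List.replicate l.length 1 :=
      List.eq_replicate_length.2 fun r hr => h r (by simp [hr])
    have h1 : ((l.map (fun t => t + 1)).sum) = l.length * 2 := by
      rw [this]; simp
    rw [h1]
    exact ((even_two.mul_left _).mul_left _).add (ih fun r hr => h r (by simp [hr]))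

/-- A trailing block `1` contributes `r * 2` for each earlier `r`, hence nothing modulo 2. This is
why signs written with a truncated `ϑ` agree with those of the full composition. -/
theorem theta_append_ones (l : List ℕ) {l' : List ℕ} (h : ∀ r ∈ l', r = 1) :
    Even ((theta (l ++ l') : ℤ) - theta l) := by
  induction l with
  | nil =>
    simp only [List.nil_append, theta]
    have := even_theta_ones h
    rw [← Int.even_coe_nat] at this
    simpa using this
  | cons a l ih =>
    have : l' = List.replicate l'.length 1 :=
      List.eq_replicate_length.2 fun r hr => h r (by simp [hr])
    have h1 : ((l'.map (fun t => t + 1)).sum) = l'.length * 2 := by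
      rw [this]; simp
    obtain ⟨m, hm⟩ := ih
    rw [List.cons_append, theta, theta, List.map_append, List.sum_append, h1]
    refine ⟨m + a * l'.length, ?_⟩
    push_cast
    linear_combination hm

theorem even_theta_ones_append {l : List ℕ} (h : ∀ r ∈ l, r = 1) (a : ℕ) :
    Even ((theta (l ++ [a]) : ℤ) - l.length * (a + 1)) := by
  induction l with
  | nil => simp [theta]
  | cons b l ih =>
    have : l = List.replicate l.length 1 :=
      List.eq_replicate_length.2 fun r hr => h r (by simp [hr])
    have h1 : ((l.map (fun t => t + 1)).sum) = l.length * 2 := by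
      rw [this]; simp
    obtain ⟨m, hm⟩ := ih fun r hr => h r (by simp [hr])
    rw [List.cons_append, theta, List.map_append, List.sum_append, h1, h b (by simp)]
    refine ⟨m + l.length, ?_⟩
    simp only [List.map_cons, List.map_nil, List.sum_cons, List.sum_nil, List.length_cons]
    push_cast
    linear_combination hm

theorem theta_blocks_sub_take {n : ℕ} (c : Composition n) (m : ℕ)
    (h : ∀ j : Fin c.length, m ≤ j → c.blocksFun j = 1) :
    Even ((theta c.blocks : ℤ) - theta (c.blocks.take m)) := by
  nth_rewrite 1 [← List.take_append_drop m c.blocks]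
  refine theta_append_ones _ fun r hr => ?_
  obtain ⟨a, ha, rfl⟩ := List.getElem_of_mem hr
  rw [List.getElem_drop]
  have hl : m + a < c.length := by
    rw [List.length_drop, c.blocks_length] at ha
    omega
  exact h ⟨m + a, hl⟩ (by simp)

theorem tcomp_congr {n : ℕ} (c : Composition n) (F : Op W U c.length) {e e' : Fin c.length → ℤ}
    {G G' : ∀ j : Fin c.length, Op V W (c.blocksFun j)} (he : ∀ j, Even (e j - e' j))
    (hG : ∀ j, G j = G' j) : tcomp c F e G = tcomp c F e' G' := by
  obtain rfl : G = G' := funext hG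
  unfold tcomp
  congr 2
  funext i
  congr 1
  funext _
  refine koszul_congr ?_
  rw [← Finset.sum_sub_distrib]
  exact Finset.even_sum _ fun j _ => he j

/-- Composites of suspended operations which are all even. -/
theorem susp_tcomp_even {n : ℕ} (c : Composition n) (F : Op W U c.length)
    {G : ∀ j : Fin c.length, Op V W (c.blocksFun j)}
    (hG : ∀ j, HasParity ((c.blocksFun j : ℤ) - 1) (G j)) (v : Fin n → Tot V) :
    susp (sg (theta c.blocks) • tcomp c F (fun j => (c.blocksFun j : ℤ) - 1) G) v =
      susp F (fun i => susp (G i) (fun a => v (c.embedding i a))) := by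
  rw [susp_zsmul, smul_apply, susp_tcomp c F _ hG _ (fun _ => rfl), smul_smul,
    ← sg_add]
  have hth := theta_ofFn c.blocksFun
  rw [c.ofFn_blocksFun, c.sum_blocksFun] at hth
  -- Every inner operation has even suspended degree, so no Koszul operator remains.
  have ht (i : Fin c.length) : ∑ j ∈ Finset.univ.filter (fun j => i < j),
      ((c.blocksFun j : ℤ) - 1 + c.blocksFun j - 1) =
      2 * ∑ j ∈ Finset.univ.filter (fun j => i < j), ((c.blocksFun j : ℤ) - 1) := by
    rw [Finset.mul_sum]
    exact Finset.sum_congr rfl fun j _ => by ring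
  simp only [ht]
  rw [sg_congr (b := 0), sg_zero, one_smul]
  · congr 1
    funext i
    rw [koszul_congr (e := 0) (by simp), koszul_zero, LinearMap.id_apply]
  · simp only [mul_add, Finset.sum_add_distrib, sub_zero]
    rw [show (theta c.blocks : ℤ) = ((n.choose 2 : ℕ) + (c.length.choose 2 : ℕ) +
      ∑ j, ((c.blocksFun j).choose 2 : ℕ) +
        ∑ j, ((c.blocksFun j : ℤ) - 1) * ((c.length : ℤ) - 1 - j)) -
          2 * ∑ j, ((c.blocksFun j).choose 2 : ℕ) by rw [← hth]; ring]
    simp only [mul_left_comm _ (2 : ℤ), ← Finset.mul_sum]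
    rw [← sub_eq_zero] at hth
    simp only [Int.even_add, Int.even_sub, even_two.mul_right]
    tauto

/-- Composites of suspended operations exactly one of which is odd. -/
theorem susp_tcomp_odd {n : ℕ} (c : Composition n) (F : Op W U c.length) (i : Fin c.length)
    {e : Fin c.length → ℤ} {G : ∀ j : Fin c.length, Op V W (c.blocksFun j)}
    (hG : ∀ j, HasParity (e j) (G j))
    (he : ∀ j, e j = (c.blocksFun j : ℤ) - 1 + if j = i then 1 else 0) (v : Fin n → Tot V) :
    susp (sg (theta c.blocks + ((c.length : ℤ) - 1 - i) + c.sizeUpTo i) • tcomp c F e G) v =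
      susp F (fun j => if j < i then parity W (susp (G j) (fun a => v (c.embedding j a)))
        else susp (G j) (fun a => v (c.embedding j a))) := by
  rw [susp_zsmul, smul_apply, susp_tcomp c F _ hG _ (fun _ => rfl), smul_smul,
    ← sg_add]
  have hth := theta_ofFn c.blocksFun
  rw [c.ofFn_blocksFun, c.sum_blocksFun] at hth
  set m : Fin c.length → ℤ := fun j =>
    ∑ j' ∈ Finset.univ.filter (fun j' => j < j'), ((c.blocksFun j' : ℤ) - 1) with hm
  -- Only position `i` has odd suspended degree, so the Koszul exponent seen from `j` is odd exactly
  -- when `j < i`.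
  have ht (j : Fin c.length) : ∑ j' ∈ Finset.univ.filter (fun j' => j < j'),
      (e j' + c.blocksFun j' - 1) = 2 * m j + if j < i then 1 else 0 := by
    have h1 : ∑ j' ∈ Finset.univ.filter (fun j' => j < j'), (if j' = i then (1 : ℤ) else 0) =
        if j < i then 1 else 0 := by
      rw [Finset.sum_ite_eq']
      simp
    rw [hm, ← h1, Finset.mul_sum, ← Finset.sum_add_distrib]
    exact Finset.sum_congr rfl fun j' _ => by rw [he]; ring
  simp only [ht]
  -- Since `koszul W 1` is minus the parity operator, the positions left of `i` release a total sign
  -- `(-1)^i`.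
  have hk (j : Fin c.length) (x : Tot W) : koszul W (2 * m j + if j < i then 1 else 0) x =
      (if j < i then (-1 : R) else 1) • if j < i then parity W x else x := by
    split_ifs with h
    · rw [koszul_congr (e := 1) (by simp)]
      simp [parity]
    · rw [koszul_congr (e := 0) (by simp)]
      simp
  have hcard : (Finset.univ.filter (fun j => j < i)).card = (i : ℕ) := by
    rw [Finset.filter_gt_eq_Iio, Fin.card_Iio]
  have hprod : ∏ j : Fin c.length, (if j < i then (-1 : R) else 1) = ((sg i : ℤ) : R) := by
    rw [Finset.prod_ite, Finset.prod_const, Finset.prod_const_one, mul_one, hcard, sg_natCast]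
    simp
  simp only [hk]
  rw [MultilinearMap.map_smul_univ, hprod, Int.cast_smul_eq_zsmul, smul_smul, ← sg_add,
    sg_congr (b := 0), sg_zero, one_smul]
  have hsz : ∑ j : Fin c.length, ((c.blocksFun j : ℤ) - 1) * (if j < i then (1 : ℤ) else 0) =
      c.sizeUpTo i - i := by
    simp only [mul_ite, mul_one, mul_zero]
    rw [← Finset.sum_filter, Finset.sum_sub_distrib, ← sizeUpTo_eq_sum, Finset.sum_const, hcard]
    simp
  -- Beyond the even case, the extra degree at `i` contributes `k - 1 - i`, with `k` the number of
  -- blocks, and the odd exponents left of `i` contribute `c.sizeUpTo i - i`; both are congruent to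
  -- parts of the stated sign once the `(-1)^i` above is included.
  have hsum : ∑ j : Fin c.length, e j * ((c.length : ℤ) - 1 - j +
      (2 * m j + if j < i then 1 else 0)) =
      ∑ j, ((c.blocksFun j : ℤ) - 1) * ((c.length : ℤ) - 1 - j) +
        2 * ∑ j, ((c.blocksFun j : ℤ) - 1) * m j + (c.sizeUpTo i - i) +
        (((c.length : ℤ) - 1 - i) + 2 * m i) := by
    have h2 : ∑ j : Fin c.length, (if j = i then (1 : ℤ) else 0) * ((c.length : ℤ) - 1 - j +
        (2 * m j + if j < i then 1 else 0)) = ((c.length : ℤ) - 1 - i) + 2 * m i := by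
      simp
    rw [← hsz, ← h2, Finset.mul_sum, ← Finset.sum_add_distrib, ← Finset.sum_add_distrib,
      ← Finset.sum_add_distrib]
    exact Finset.sum_congr rfl fun j _ => by rw [he]; ring
  rw [hsum]
  refine ⟨theta c.blocks + ∑ j, ((c.blocksFun j).choose 2 : ℕ) + ((c.length : ℤ) - 1 - i) +
    c.sizeUpTo i + ∑ j, ((c.blocksFun j : ℤ) - 1) * m j + m i, ?_⟩
  push_cast at hth ⊢
  linear_combination -hth

/-! ### Dictionary between sums of operations and maps on the tensor coalgebra -/

/-- The suspended family `F_m, F_{m + 1}, …` as a linear map on the tensor coalgebra. -/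
def fam (m : ℕ) (F : ∀ n, Op V W n) : TensorAlgebra R (Tot V) →ₗ[R] Tot W :=
  ofFamily fun n => if m ≤ n then susp (F n) else 0

theorem fam_word_ofFn (m : ℕ) (F : ∀ n, Op V W n) {n : ℕ} (v : Fin n → Tot V) :
    fam m F (word R (List.ofFn v)) = if m ≤ n then susp (F n) v else 0 := by
  rw [fam, ofFamily_word_ofFn]
  split_ifs <;> rfl

theorem fam_of_le {m : ℕ} (F : ∀ n, Op V W n) {n : ℕ} (h : m ≤ n) (v : Fin n → Tot V) :
    fam m F (word R (List.ofFn v)) = susp (F n) v := by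
  rw [fam_word_ofFn, if_pos h]

theorem fam_one (m : ℕ) (F : ∀ n, Op V W n) (hm : 1 ≤ m) : fam m F 1 = 0 := by
  have := fam_word_ofFn m F (n := 0) Fin.elim0
  rw [if_neg (by omega)] at this
  simpa using this

theorem fam_two_letter (F : ∀ n, Op V W n) : fam 2 F ∘ₗ TensorAlgebra.ι R = 0 := by
  refine LinearMap.ext fun x => ?_
  have := fam_word_ofFn 2 F (n := 1) (fun _ => x)
  simpa using this

theorem proj_word_ofFn {n : ℕ} (v : Fin n → Tot V) :
    proj (word R (List.ofFn v)) = projFamily (R := R) n v := ofFamily_word_ofFn _ v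

theorem susp_lin (f : Tot V →ₗ[R] Tot W) {n : ℕ} (v : Fin n → Tot V) :
    susp (lin f n) v = f (proj (word R (List.ofFn v))) := by
  rw [proj_word_ofFn, susp_apply]
  match n with
  | 0 => simp [lin, projFamily]
  | 1 => simp [lin, projFamily]
  | n + 2 => simp [lin, projFamily]

theorem fam_lin (f : Tot V →ₗ[R] Tot W) : fam 1 (lin f) = f ∘ₗ proj := by
  refine linearMap_ext_ofFn fun n v => ?_
  rw [fam_word_ofFn, susp_lin]
  split_ifs with h
  · rfl
  · obtain rfl : n = 0 := by omega
    simp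

theorem fam_comp (f : Tot W →ₗ[R] Tot U) (m : ℕ) (F : ∀ n, Op V W n) :
    fam m (fun n => f.compMultilinearMap (F n)) = f ∘ₗ fam m F := by
  refine linearMap_ext_ofFn fun n v => ?_
  rw [fam_word_ofFn, LinearMap.comp_apply, fam_word_ofFn, susp_comp]
  split_ifs <;> simp

theorem fam_compLinearMap {g : Tot V →ₗ[R] Tot W} (hg : LinHasDegree 0 g) (m : ℕ)
    (F : ∀ n, Op W U n) :
    fam m (fun n => (F n).compLinearMap fun _ => g) = fam m F ∘ₗ (tmap g).toLinearMap := by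
  refine linearMap_ext_ofFn fun n v => ?_
  rw [fam_word_ofFn, LinearMap.comp_apply, AlgHom.toLinearMap_apply, tmap_word, List.map_ofFn,
    fam_word_ofFn, susp_compLinearMap hg]
  rfl

/-- Parity of a suspended family. -/
theorem fam_comp_parity {m : ℕ} {F : ∀ n, Op V W n} {d : ℤ}
    (hF : ∀ n, m ≤ n → HasParity ((n : ℤ) - 1 + d) (F n)) :
    fam m F ∘ₗ (tmap (parity V)).toLinearMap = sg d • (parity W ∘ₗ fam m F) := by
  refine linearMap_ext_ofFn fun n v => ?_
  rw [LinearMap.comp_apply, AlgHom.toLinearMap_apply, tmap_word, List.map_ofFn, fam_word_ofFn,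
    LinearMap.smul_apply, LinearMap.comp_apply, fam_word_ofFn]
  split_ifs with hn
  · have hp (y : Tot W) : parity W y = -koszul W 1 y := rfl
    rw [susp_apply, susp_apply, hp, map_zsmul, hF n hn 1]
    have h (i : Fin n) : koszul V ((n : ℤ) - 1 - i) ((parity V ∘ v) i) =
        (-1 : R) • koszul V 1 (koszul V ((n : ℤ) - 1 - i) (v i)) := by
      simp [parity, koszul_koszul, add_comm]
    simp only [h]
    rw [MultilinearMap.map_smul_univ]
    simp only [Finset.prod_const, Finset.card_univ, Fintype.card_fin]
    have hs : ((-1 : R) ^ n) = ((sg n : ℤ) : R) := by rw [sg_natCast]; simp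
    have h1 : -(sg (n.choose 2) • sg (1 * ((n : ℤ) - 1 + d)) •
        (F n) fun i => koszul V 1 (koszul V ((n : ℤ) - 1 - i) (v i))) =
        sg 1 • (sg (n.choose 2) • sg (1 * ((n : ℤ) - 1 + d)) •
        (F n) fun i => koszul V 1 (koszul V ((n : ℤ) - 1 - i) (v i))) := by simp
    rw [hs, Int.cast_smul_eq_zsmul, h1]
    simp only [smul_smul, ← sg_add]
    rw [sg_congr]
    exact ⟨-d, by ring⟩
  · simp

theorem word_ofFn_eq_prod {n : ℕ} (v : Fin n → Tot V) :
    word R (List.ofFn v) = (List.ofFn fun i => TensorAlgebra.ι R (v i)).prod := by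
  rw [word_ofFn, TensorAlgebra.tprod_apply]

/-- The sum over compositions is the expansion of the geometric series, and `(-1)^ϑ` is absorbed by
`susp_tcomp_even`. -/
theorem susp_blockSum (kmin : ℕ) (F : ∀ n, Op W U n) {G : ∀ n, Op V W n}
    (hG : ∀ n : ℕ, 1 ≤ n → HasParity ((n : ℤ) - 1) (G n)) {n : ℕ} (v : Fin n → Tot V) :
    susp (blockSum kmin F G n) v = fam kmin F (hat (fam 1 G) (word R (List.ofFn v))) := by
  rw [hat, geom_word_ofFn, map_sum, blockSum, susp_sum, sum_apply]
  refine Finset.sum_congr rfl fun c _ => ?_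
  simp only [LinearMap.comp_apply]
  rw [← word_ofFn_eq_prod, fam_word_ofFn]
  split_ifs with h
  · rw [← sg_natCast, susp_tcomp_even c _ fun j => hG _ (c.one_le_blocksFun j)]
    congr 1
    funext j
    rw [fam_of_le G (c.one_le_blocksFun j)]
  · simp

/-- The arguments of the outer operation in a term with the odd operation in position `i`. -/
def midArgs {n : ℕ} (x y : TensorAlgebra R (Tot V) →ₗ[R] Tot V) (v : Fin n → Tot V)
    (c : Composition n) (i j : Fin c.length) : Tot V :=
  if j < i then parity V (x (word R (List.ofFn fun a => v (c.embedding j a))))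
  else if j = i then y (word R (List.ofFn fun a => v (c.embedding j a)))
  else proj (word R (List.ofFn fun a => v (c.embedding j a)))

theorem projFamily_of_ne {M : Type*} [AddCommGroup M] [Module R M] {n : ℕ} (hn : n ≠ 1)
    (v : Fin n → M) : projFamily (R := R) n v = 0 := by
  match n, hn with
  | 0, _ => rfl
  | n + 2, _ => rfl

/-- The convolution product runs over all compositions, the definitions only over those with blocks
of length one after position `i`; `proj` removes the difference. -/
theorem susp_midArgs_eq_zero {n : ℕ} (x y : TensorAlgebra R (Tot V) →ₗ[R] Tot V)
    (v : Fin n → Tot V) (c : Composition n) (i : Fin c.length) (F : Op V U c.length)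
    (h : ¬ ∀ j, i < j → c.blocksFun j = 1) : susp F (midArgs x y v c i) = 0 := by
  push Not at h
  obtain ⟨j, hij, hj⟩ := h
  refine MultilinearMap.map_coord_zero _ j ?_
  rw [midArgs, if_neg hij.not_gt, if_neg hij.ne', proj_word_ofFn, projFamily_of_ne hj]

theorem susp_mid_term {n : ℕ} (c : Composition n) (i : Fin c.length) (F : Op V U c.length)
    {X Y : ∀ n, Op V V n} (hX : ∀ n : ℕ, 1 ≤ n → HasParity ((n : ℤ) - 1) (X n))
    (hY : HasParity (c.blocksFun i : ℤ) (Y (c.blocksFun i)))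
    (hc : ∀ j, i < j → c.blocksFun j = 1) (v : Fin n → Tot V) :
    susp (((-1 : ℤ) ^ (n + c.blocksFun i + theta (c.blocks.take ((i : ℕ) + 1)))) •
      tcomp c F (fun j => if j < i then (c.blocksFun j : ℤ) - 1
          else if j = i then (c.blocksFun j : ℤ) else 0)
        (fun j => if j < i then X (c.blocksFun j)
          else if j = i then Y (c.blocksFun j) else idOp V (c.blocksFun j))) v =
      susp F (midArgs (fam 1 X) (fam 1 Y) v c i) := by
  have hG (j : Fin c.length) : HasParity (if j < i then (c.blocksFun j : ℤ) - 1
          else if j = i then (c.blocksFun j : ℤ) else 0) (if j < i then X (c.blocksFun j)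
          else if j = i then Y (c.blocksFun j) else idOp V (c.blocksFun j)) := by
    split_ifs with h1 h2
    · exact hX _ (c.one_le_blocksFun j)
    · rw [h2]; exact hY
    · have := (HasDegree.idOp (V := V) (c.blocksFun j)).hasParity
      rwa [hc j (lt_of_le_of_ne (not_lt.1 h1) (Ne.symm h2))] at this ⊢
  have he (j : Fin c.length) : (if j < i then (c.blocksFun j : ℤ) - 1
          else if j = i then (c.blocksFun j : ℤ) else 0) =
          (c.blocksFun j : ℤ) - 1 + if j = i then 1 else 0 := by
    split_ifs with h1 h2 h2
    · exact absurd h1 (h2 ▸ lt_irrefl _)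
    · simp
    · simp
    · simp [hc j (lt_of_le_of_ne (not_lt.1 h1) (Ne.symm h2))]
  rw [← sg_natCast]
  have hsign : sg ((n + c.blocksFun i + theta (c.blocks.take ((i : ℕ) + 1)) : ℕ) : ℤ) =
      sg (theta c.blocks + ((c.length : ℤ) - 1 - i) + c.sizeUpTo i) := by
    refine sg_congr ?_
    obtain ⟨a, ha⟩ := theta_blocks_sub_take c (i + 1) fun j hj => hc j (Fin.lt_def.2 hj)
    -- As all blocks after `i` are ones, `n + r_i` agrees modulo 2 with `c.sizeUpTo i` plus the
    -- number of those blocks, which is the sign required by `susp_tcomp_odd`.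
    have hn : (n : ℤ) = c.sizeUpTo i + c.blocksFun i + ((c.length : ℤ) - 1 - i) := by
      have h2 : ∑ j, (c.blocksFun j : ℤ) = n := by exact_mod_cast c.sum_blocksFun
      rw [← h2, sum_eq_filter_add_filter i, ← sizeUpTo_eq_sum]
      congr 1
      rw [Finset.sum_congr rfl (g := fun _ => (1 : ℤ))]
      · rw [Finset.filter_lt_eq_Ioi, Finset.sum_const, Fin.card_Ioi, nsmul_one]
        omega
      · intro j hj
        rw [hc j (by simpa using hj)]
        rfl
    refine ⟨c.blocksFun i - a, ?_⟩
    push_cast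
    linear_combination hn - ha
  rw [hsign, susp_tcomp_odd c F i hG he]
  congr 1
  funext j
  rw [midArgs]
  split_ifs with h1 h2
  · rw [fam_of_le X (c.one_le_blocksFun j)]
  · rw [fam_of_le Y (c.one_le_blocksFun j)]
  · exact susp_lin LinearMap.id _

theorem conv_word_ofFn_midArgs {x y : TensorAlgebra R (Tot V) →ₗ[R] Tot V} (hx : x 1 = 0)
    (hy : y 1 = 0) {n : ℕ} (v : Fin n → Tot V) :
    (((tmap (parity V)).toLinearMap ∘ₗ hat x) ⋆ (TensorAlgebra.ι R ∘ₗ y) ⋆ LinearMap.id)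
      (word R (List.ofFn v)) = ∑ c : Composition n, ∑ i : Fin c.length,
        word R (List.ofFn (midArgs x y v c i)) := by
  rw [map_comp_hat _ hx, ← hat_proj, hat, hat, geom_conv_conv_geom (by simp [hx]) (by simp [hy])]
  refine Finset.sum_congr rfl fun c _ => Finset.sum_congr rfl fun i _ => ?_
  rw [word_ofFn_eq_prod]
  congr 2
  funext j
  simp only [midArgs, LinearMap.comp_apply]
  split_ifs <;> rfl

theorem susp_midSum (kmin : ℕ) (F : ∀ n, Op V U n) {X Y : ∀ n, Op V V n}
    (hX : ∀ n : ℕ, 1 ≤ n → HasParity ((n : ℤ) - 1) (X n))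
    (hY : ∀ n : ℕ, 1 ≤ n → HasParity (n : ℤ) (Y n)) {n : ℕ} (v : Fin n → Tot V) :
    susp (∑ c : Composition n, ∑ i : Fin c.length,
      if kmin ≤ c.length ∧ ∀ j, i < j → c.blocksFun j = 1 then
        ((-1 : ℤ) ^ (n + c.blocksFun i + theta (c.blocks.take ((i : ℕ) + 1)))) •
          tcomp c (F c.length)
            (fun j => if j < i then (c.blocksFun j : ℤ) - 1
              else if j = i then (c.blocksFun j : ℤ) else 0)
            (fun j => if j < i then X (c.blocksFun j)
              else if j = i then Y (c.blocksFun j) else idOp V (c.blocksFun j))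
      else 0) v =
    fam kmin F ((((tmap (parity V)).toLinearMap ∘ₗ hat (fam 1 X)) ⋆
      (TensorAlgebra.ι R ∘ₗ fam 1 Y) ⋆ LinearMap.id) (word R (List.ofFn v))) := by
  rw [conv_word_ofFn_midArgs (fam_one 1 X le_rfl) (fam_one 1 Y le_rfl), susp_sum, map_sum,
    sum_apply]
  refine Finset.sum_congr rfl fun c _ => ?_
  rw [susp_sum, map_sum, sum_apply]
  refine Finset.sum_congr rfl fun i _ => ?_
  rw [fam_word_ofFn]
  split_ifs with h1 h2 h2
  · exact susp_mid_term c i _ hX (hY _ (c.one_le_blocksFun i)) h1.2 v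
  · exact absurd h1.1 h2
  · rw [susp_midArgs_eq_zero _ _ _ _ _ _ fun h => h1 ⟨h2, h⟩]
    simp
  · simp

theorem susp_insertSum (kmin : ℕ) (F : ∀ n, Op V U n) {G : ∀ n, Op V V n}
    (hG : ∀ n : ℕ, 2 ≤ n → HasParity (n : ℤ) (G n)) {n : ℕ} (v : Fin n → Tot V) :
    susp (insertSum kmin F G n) v =
      -fam kmin F (coder (parity V) (fam 2 G) (word R (List.ofFn v))) := by
  -- Inserting one operation between identities is the case where the maps before the odd factor are
  -- `proj`; then the blocks on both sides must have length one.
  have h0 : coder (parity V) (fam 2 G) = ((tmap (parity V)).toLinearMap ∘ₗ hat proj) ⋆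
      (TensorAlgebra.ι R ∘ₗ fam 2 G) ⋆ LinearMap.id := by
    rw [hat_proj]; rfl
  have hproj : (proj : TensorAlgebra R (Tot V) →ₗ[R] Tot V) = fam 1 (idOp V) := by
    rw [idOp, fam_lin]; rfl
  rw [h0, conv_word_ofFn_midArgs proj_one (fam_one 2 G (by omega)), insertSum, susp_sum, map_sum,
    sum_apply, ← Finset.sum_neg_distrib]
  refine Finset.sum_congr rfl fun c _ => ?_
  rw [susp_sum, map_sum, sum_apply, ← Finset.sum_neg_distrib]
  refine Finset.sum_congr rfl fun i _ => ?_
  rw [fam_word_ofFn]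
  by_cases hk : kmin ≤ c.length
  swap
  · simp [hk]
  rw [if_pos hk]
  by_cases h2 : 2 ≤ c.blocksFun i
  swap
  · rw [if_neg fun h => h2 h.2.1, MultilinearMap.map_coord_zero _ i, neg_zero, susp_zero,
      zero_apply]
    rw [midArgs, if_neg (lt_irrefl i), if_pos rfl, fam_word_ofFn, if_neg h2]
  by_cases h3 : ∀ j, i < j → c.blocksFun j = 1
  swap
  · rw [susp_midArgs_eq_zero _ _ _ _ _ _ h3, if_neg fun h => h3 fun j hj => h.2.2 j hj.ne']
    simp
  by_cases h4 : ∀ j, j < i → c.blocksFun j = 1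
  swap
  · push Not at h4
    obtain ⟨j, hj, hj1⟩ := h4
    rw [if_neg fun h => hj1 (h.2.2 j hj.ne), MultilinearMap.map_coord_zero _ j, neg_zero, susp_zero,
      zero_apply]
    rw [midArgs, if_pos hj, proj_word_ofFn, projFamily_of_ne hj1, map_zero]
  rw [if_pos ⟨hk, h2, fun j hj => (lt_or_gt_of_ne hj).elim (h4 j) (h3 j)⟩]
  have hmid := susp_mid_term c i (F c.length) (X := idOp V) (Y := G)
    (fun (n : ℕ) _ => (HasDegree.idOp n).hasParity) (hG _ h2) h3 v
  have hargs : midArgs (fam 1 (idOp V)) (fam 1 G) v c i = midArgs proj (fam 2 G) v c i := by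
    funext j
    rw [midArgs, midArgs, ← hproj]
    by_cases hj : j = i
    · subst hj
      rw [fam_of_le _ h2, fam_of_le _ (by omega)]
    · simp [hj]
  rw [← hargs, ← hmid, ← neg_apply, ← susp_neg, ← neg_smul]
  congr 2
  congr 1
  -- With leading ones, `ϑ(1, …, 1, l)` is congruent to `i (l + 1)` for zero-based `i`. The
  -- exponents `(i + 1)(l + 1) + n` and `n + l + i (l + 1)` differ by one: this is the minus sign in
  -- the statement.
  · rw [← sg_natCast, ← sg_natCast, ← neg_one_mul, ← sg_one, ← sg_add]
    refine sg_congr ?_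
    have htake : c.blocks.take ((i : ℕ) + 1) = c.blocks.take i ++ [c.blocksFun i] := by
      rw [List.take_succ_eq_append_getElem (by rw [c.blocks_length]; exact i.2)]
      rfl
    obtain ⟨a, ha⟩ := even_theta_ones_append (l := c.blocks.take i) (a := c.blocksFun i) (by
      intro r hr
      obtain ⟨b, hb, rfl⟩ := List.getElem_of_mem hr
      rw [List.getElem_take]
      rw [List.length_take, c.blocks_length] at hb
      exact h4 ⟨b, by omega⟩ (Fin.lt_def.2 (by simp; omega)))
    rw [← htake, List.length_take, c.blocks_length, min_eq_left i.2.le] at ha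
    refine ⟨-a, ?_⟩
    push_cast
    linear_combination -ha
  · refine tcomp_congr c _ (fun j => ?_) fun j => ?_
    · by_cases hj : j = i
      · simp [hj]
      · rcases lt_or_gt_of_ne hj with h | h
        · simp [hj, h, h4 j h]
        · simp [hj, h.not_gt]
    · by_cases hj : j = i
      · simp [hj]
      · simp [hj]

open TensorProduct

/-! ### The differential of a suspended operation -/

theorem coder_diff_letter_mul {M : Type*} [AddCommGroup M] [Module R M] (τ D : M →ₗ[R] M) (v : M)
    (x : TensorAlgebra R M) :
    coder τ (D ∘ₗ proj) (TensorAlgebra.ι R v * x) =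
      TensorAlgebra.ι R (D v) * x + TensorAlgebra.ι R (τ v) * coder τ (D ∘ₗ proj) x := by
  have h1 : (tmap τ).toLinearMap ∘ₗ LinearMap.mulLeft R (TensorAlgebra.ι R v) =
      LinearMap.mulLeft R (TensorAlgebra.ι R (τ v)) ∘ₗ (tmap τ).toLinearMap := by
    refine LinearMap.ext fun y => ?_
    simp
  have h2 : (TensorAlgebra.ι R ∘ₗ D ∘ₗ proj) ∘ₗ LinearMap.mulLeft R (TensorAlgebra.ι R v) =
      LinearMap.mulLeft R (TensorAlgebra.ι R (D v)) ∘ₗ convOne := by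
    refine LinearMap.ext fun y => ?_
    simp [proj_letter_mul, convOne, Algebra.algebraMap_eq_smul_one]
  rw [coder, conv_letter_mul, h1, mulLeft_comp_conv, conv_letter_mul, h2, mulLeft_comp_conv,
    convOne_conv]
  simp [add_comm]

theorem coder_diff_word_ofFn {M : Type*} [AddCommGroup M] [Module R M] (τ D : M →ₗ[R] M) {n : ℕ}
    (v : Fin n → M) :
    coder τ (D ∘ₗ proj) (word R (List.ofFn v)) = ∑ i : Fin n,
      word R (List.ofFn fun j => if j < i then τ (v j) else if j = i then D (v j) else v j) := by
  induction n with
  | zero => simpa using coder_one τ (by simp)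
  | succ n ih =>
    rw [List.ofFn_succ, word_cons, coder_diff_letter_mul, ih, Fin.sum_univ_succ, Finset.mul_sum]
    congr 1
    · rw [List.ofFn_succ, word_cons]
      simp [Fin.succ_ne_zero]
    · refine Finset.sum_congr rfl fun i _ => ?_
      rw [List.ofFn_succ, word_cons]
      simp

theorem susp_delta_term {n : ℕ} (F : Op V W n) (i : Fin n) (v : Fin n → Tot V) :
    susp (F.compLinearMap fun j =>
      if j < i then koszul V 1 else if j = i then diff V else LinearMap.id) v =
      sg ((n : ℤ) - 1) • susp F (fun j => if j < i then parity V (v j)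
        else if j = i then diff V (v j) else v j) := by
  have hD (a : ℤ) (x : Tot V) : diff V (koszul V a x) = sg a • koszul V a (diff V x) := by
    rw [linHasDegree_diff.koszul_comm, smul_smul, ← sg_add, sg_congr (b := 0) (by simp)]
    simp
  have h (j : Fin n) : (if j < i then koszul V 1 else if j = i then diff V else LinearMap.id)
      (koszul V ((n : ℤ) - 1 - j) (v j)) =
      ((((if j < i then sg 1 else 1) * (if j = i then sg ((n : ℤ) - 1 - i) else 1) : ℤ)) : R) •
      koszul V ((n : ℤ) - 1 - j) (if j < i then parity V (v j)
        else if j = i then diff V (v j) else v j) := by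
    rw [Int.cast_smul_eq_zsmul]
    split_ifs with h1 h2 h2
    · exact absurd h1 (h2 ▸ lt_irrefl _)
    · simp [parity, koszul_koszul, add_comm]
    · rw [one_mul, hD, h2]
    · simp
  rw [susp_apply, susp_apply, MultilinearMap.compLinearMap_apply]
  simp only [h]
  rw [MultilinearMap.map_smul_univ, ← Int.cast_prod, Int.cast_smul_eq_zsmul, smul_comm,
    Finset.prod_mul_distrib]
  congr 1
  -- The `i` factors left of the differential give `(-1)^i` on passing to the parity operator, and
  -- moving the differential past its suspension twist gives `n - 1 - i`.
  have hcard : (Finset.univ.filter (fun j => j < i)).card = (i : ℕ) := by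
    rw [Finset.filter_gt_eq_Iio, Fin.card_Iio]
  rw [Finset.prod_ite, Finset.prod_const, Finset.prod_const_one, mul_one, hcard,
    Finset.prod_ite_eq' Finset.univ i (fun _ => sg ((n : ℤ) - 1 - i)), if_pos (Finset.mem_univ _),
    sg_one, ← sg_natCast, ← sg_add]
  congr 1
  ring

/-- After suspension, `δ` is the graded commutator with the coderivation of the differential; the
sign is that of the suspended degree. -/
theorem susp_delta (d : ℤ) {m n : ℕ} (hmn : m ≤ n) (F : ∀ n, Op V W n) (v : Fin n → Tot V) :
    susp (delta d (F n)) v = diff W (fam m F (word R (List.ofFn v))) -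
      sg (d + n - 1) • fam m F (coder (parity V) (diff V ∘ₗ proj) (word R (List.ofFn v))) := by
  rw [delta, susp_sub, susp_comp, fam_of_le F hmn, sub_apply]
  congr 1
  rw [susp_zsmul, susp_sum, smul_apply, sum_apply, coder_diff_word_ofFn, map_sum]
  simp only [susp_delta_term, fam_of_le F hmn]
  rw [← Finset.smul_sum, smul_smul, add_sub_assoc, sg_add]
  rfl

/-! ### Identities in the total module -/

theorem diff_incl (i : ℤ) (x : V.X i) : diff V (incl V i x) = incl V (i - 1) (V.d i (i - 1) x) := by
  simp [diff, incl]

theorem chainTot_incl (f : V ⟶ W) (i : ℤ) (x : V.X i) :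
    chainTot f (incl V i x) = incl W i (f.f i x) := by
  simp [chainTot, incl]

theorem htpyTot_incl {a b : V ⟶ W} (h : Homotopy a b) (i : ℤ) (x : V.X i) :
    htpyTot h (incl V i x) = incl W (i + 1) (h.hom i (i + 1) x) := by
  simp [htpyTot, incl]

theorem diff_diff (x : Tot V) : diff V (diff V x) = 0 := by
  suffices diff V ∘ₗ diff V = 0 from LinearMap.congr_fun this x
  refine tot_hom_ext fun i x => ?_
  rw [LinearMap.comp_apply, diff_incl, diff_incl, ← ModuleCat.comp_apply, V.d_comp_d]
  simp

theorem chainTot_diff (f : V ⟶ W) (x : Tot V) :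
    chainTot f (diff V x) = diff W (chainTot f x) := by
  suffices chainTot f ∘ₗ diff V = diff W ∘ₗ chainTot f from LinearMap.congr_fun this x
  refine tot_hom_ext fun i x => ?_
  simp only [LinearMap.comp_apply]
  rw [diff_incl, chainTot_incl, chainTot_incl, diff_incl, ← ModuleCat.comp_apply,
    ← ModuleCat.comp_apply, f.comm]

theorem diff_htpyTot {f : V ⟶ W} {g : W ⟶ V} (h : Homotopy (f ≫ g) (𝟙 V)) (x : Tot V) :
    diff V (htpyTot h x) + htpyTot h (diff V x) = (chainTot g ∘ₗ chainTot f) x - x := by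
  suffices diff V ∘ₗ htpyTot h + htpyTot h ∘ₗ diff V =
      chainTot g ∘ₗ chainTot f - LinearMap.id from LinearMap.congr_fun this x
  refine tot_hom_ext fun i x => ?_
  simp only [LinearMap.comp_apply, LinearMap.add_apply, LinearMap.sub_apply, LinearMap.id_apply]
  rw [diff_incl, htpyTot_incl, htpyTot_incl, diff_incl, chainTot_incl, chainTot_incl]
  -- The degrees `i + 1 - 1` and `i - 1 + 1` equal `i` only propositionally, so the inclusions are
  -- transported first.
  have h1 : ∀ j, j = i → incl V j (V.d (i + 1) j (h.hom i (i + 1) x)) =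
      incl V i (V.d (i + 1) i (h.hom i (i + 1) x)) := by
    rintro j rfl; rfl
  have h2 : ∀ j, j = i → incl V j (h.hom (i - 1) j (V.d i (i - 1) x)) =
      incl V i (h.hom (i - 1) i (V.d i (i - 1) x)) := by
    rintro j rfl; rfl
  rw [h1 _ (by ring), h2 _ (by ring), ← map_add, ← map_sub]
  congr 1
  have hc := h.comm i
  rw [dNext_eq h.hom (show (ComplexShape.down ℤ).Rel i (i - 1) by simp),
    prevD_eq h.hom (show (ComplexShape.down ℤ).Rel (i + 1) i by simp)] at hc
  have hx := congrArg (fun φ => φ.hom x) hc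
  simp at hx
  rw [hx]
  abel

/-! ### The kernels -/

theorem blockSum_eq_zero {kmin n : ℕ} (h : n < kmin) (F : ∀ n, Op W U n) (G : ∀ n, Op V W n) :
    blockSum kmin F G n = 0 :=
  Finset.sum_eq_zero fun c _ => if_neg (by have := c.length_le; omega)

theorem insertSum_eq_zero {kmin n : ℕ} (h : n < kmin) (F : ∀ n, Op V W n) (G : ∀ n, Op V V n) :
    insertSum kmin F G n = 0 :=
  Finset.sum_eq_zero fun c _ => Finset.sum_eq_zero fun i _ =>
    if_neg (by have := c.length_le; omega)

theorem sum_blocksFun_sub_one {n : ℕ} (c : Composition n) :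
    ∑ j, ((c.blocksFun j : ℤ) - 1) = n - c.length := by
  have h2 : ∑ j, (c.blocksFun j : ℤ) = n := by exact_mod_cast c.sum_blocksFun
  rw [Finset.sum_sub_distrib, h2]
  simp

theorem hasDegree_blockSum {kmin n : ℕ} {a : ℤ} {F : ∀ n, Op W U n} {G : ∀ n, Op V W n}
    (hF : ∀ k : ℕ, kmin ≤ k → HasDegree ((k : ℤ) + a) (F k))
    (hG : ∀ c : Composition n, kmin ≤ c.length → ∀ j,
      HasDegree ((c.blocksFun j : ℤ) - 1) (G (c.blocksFun j))) :
    HasDegree ((n : ℤ) + a) (blockSum kmin F G n) := by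
  refine HasDegree.sum _ fun c _ => ?_
  split_ifs with h
  · refine ((HasDegree.tcomp c (hF _ h) (hG c h)).congr ?_).zsmul _
    rw [sum_blocksFun_sub_one]
    ring
  · exact HasDegree.zero

section Kernels

variable {μ : ∀ n, Op V V n} {h : Tot V →ₗ[R] Tot V}

theorem pKer_eq_blockSum (μ : ∀ n, Op V V n) (h : Tot V →ₗ[R] Tot V) (n : ℕ) :
    pKer μ h n = blockSum 2 μ (hpKer μ h) n := by
  rw [pKer, blockSum]
  refine Finset.sum_congr rfl fun c _ => ?_
  simp only [dite_eq_ite, hpKer]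

theorem hasDegree_hpKer (hμ : ∀ n : ℕ, 2 ≤ n → HasDegree ((n : ℤ) - 2) (μ n))
    (hh : LinHasDegree 1 h) (n : ℕ) : HasDegree ((n : ℤ) - 1) (hpKer μ h n) := by
  induction n using Nat.strong_induction_on with
  | _ n ih =>
    rw [hpKer]
    split_ifs with hn
    · exact HasDegree.idOp n
    · rw [pKer_eq_blockSum]
      refine (HasDegree.comp hh (hasDegree_blockSum (a := -2)
        (fun k hk => (hμ k hk).congr (by ring))
        fun c hc j => ih _ (blocksFun_lt c hc j))).congr (by ring)

theorem hasDegree_pKer (hμ : ∀ n : ℕ, 2 ≤ n → HasDegree ((n : ℤ) - 2) (μ n))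
    (hh : LinHasDegree 1 h) (n : ℕ) : HasDegree ((n : ℤ) - 2) (pKer μ h n) := by
  rw [pKer_eq_blockSum]
  exact (hasDegree_blockSum (a := -2) (fun k hk => (hμ k hk).congr (by ring))
    fun c _ j => hasDegree_hpKer hμ hh _).congr (by ring)

theorem hasDegree_piKer (hμ : ∀ n : ℕ, 2 ≤ n → HasDegree ((n : ℤ) - 2) (μ n))
    (hh : LinHasDegree 1 h) (n i : ℕ) : HasDegree ((n : ℤ) - 2) (piKer μ h n i) := by
  refine HasDegree.sum _ fun c _ => HasDegree.sum _ fun m _ => ?_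
  split_ifs with hc
  · refine ((HasDegree.tcomp c (hμ _ hc.1) fun j => ?_).congr ?_).zsmul _
    · split_ifs with hj
      · exact hasDegree_hpKer hμ hh _
      · have := HasDegree.idOp (V := V) (c.blocksFun j)
        refine this.congr ?_
        rw [hc.2.2 j (not_lt.1 hj)]
        simp
    · rw [Finset.sum_congr rfl (g := fun j => (c.blocksFun j : ℤ) - 1), sum_blocksFun_sub_one]
      · ring
      · intro j _
        split_ifs with hj
        · rfl
        · rw [hc.2.2 j (not_lt.1 hj)]
          simp
  · exact HasDegree.zero

theorem hasDegree_qKer (hμ : ∀ n : ℕ, 2 ≤ n → HasDegree ((n : ℤ) - 2) (μ n))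
    (hh : LinHasDegree 1 h) {gf : Tot V →ₗ[R] Tot V} (hgf : LinHasDegree 0 gf) (n : ℕ) :
    HasDegree ((n : ℤ) - 1) (qKer μ h gf n) := by
  induction n using Nat.strong_induction_on with
  | _ n ih =>
    rw [qKer]
    split_ifs with hn
    · exact HasDegree.idOp n
    refine HasDegree.sum _ fun c _ => HasDegree.sum _ fun i _ => ?_
    split_ifs with hc
    · refine ((HasDegree.tcomp c (hasDegree_piKer hμ hh _ _) fun j => ?_).congr ?_).zsmul _
      · have hj := ih _ (blocksFun_lt c hc.1 j)
        split_ifs with h1 h2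
        · exact (HasDegree.comp hgf hj).congr (by ring)
        · exact (HasDegree.comp hh hj).congr (by ring)
        · have := HasDegree.idOp (V := V) (c.blocksFun j)
          refine this.congr ?_
          rw [hc.2 j (lt_of_le_of_ne (not_lt.1 h1) (Ne.symm h2))]
          simp
      · rw [Finset.sum_congr rfl (g := fun j => ((c.blocksFun j : ℤ) - 1) + if j = i then 1 else 0),
          Finset.sum_add_distrib, sum_blocksFun_sub_one]
        · simp
          ring
        · intro j _
          split_ifs with h1 h2 h2
          · exact absurd h1 (h2 ▸ lt_irrefl _)
          · simp
          · simp
          · rw [hc.2 j (lt_of_le_of_ne (not_lt.1 h1) (Ne.symm h2))]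
            simp
    · exact HasDegree.zero

theorem fam_pKer (hμ : ∀ n : ℕ, 2 ≤ n → HasDegree ((n : ℤ) - 2) (μ n))
    (hh : LinHasDegree 1 h) : fam 2 (pKer μ h) = fam 2 μ ∘ₗ hat (fam 1 (hpKer μ h)) := by
  refine linearMap_ext_ofFn fun n v => ?_
  rw [LinearMap.comp_apply, ← susp_blockSum 2 μ
    (fun n _ => (hasDegree_hpKer hμ hh n).hasParity), fam_word_ofFn, pKer_eq_blockSum]
  split_ifs with hn
  · rfl
  · rw [blockSum_eq_zero (by omega)]
    simp

/-- The summand `proj` is the convention `h p_1 = id`. -/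
theorem fam_hpKer : fam 1 (hpKer μ h) = proj + h ∘ₗ fam 2 (pKer μ h) := by
  refine linearMap_ext_ofFn fun n v => ?_
  rw [LinearMap.add_apply, LinearMap.comp_apply, fam_word_ofFn, fam_word_ofFn, hpKer]
  by_cases h1 : n = 1
  · subst h1
    simp only [le_refl, if_true]
    rw [idOp, susp_lin]
    simp
  · rw [if_neg h1, proj_word_ofFn, projFamily_of_ne h1, susp_comp]
    by_cases h2 : 2 ≤ n
    · rw [if_pos (by omega), if_pos h2]
      simp
    · rw [if_neg (by omega), if_neg h2]
      simp

/-- By `prefix_eq_splitSum`, with `hat proj = id` on the remaining letters, the product expands over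
compositions with a block boundary after letter `i`. Longer blocks beyond it are killed by `proj`,
which leaves the defining sum with its one-based index `i + 1`. -/
theorem susp_piKer (hμ : ∀ n : ℕ, 2 ≤ n → HasDegree ((n : ℤ) - 2) (μ n))
    (hh : LinHasDegree 1 h) {k i : ℕ} (hi : i < k) (w : Fin k → Tot V) :
    susp (piKer μ h k (i + 1)) w = fam 2 μ (hat (fam 1 (hpKer μ h))
      (word R ((List.ofFn w).take i)) * word R ((List.ofFn w).drop i)) := by
  set P := fam 1 (hpKer μ h) with hP
  have hword (l : List (Tot V)) : hat proj (word R l) = word R l := by rw [hat_proj]; rfl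
  have hs := prefix_eq_splitSum (A := TensorAlgebra R (Tot V))
    (x := fun l => TensorAlgebra.ι R (P (word R l)))
    (z := fun l => TensorAlgebra.ι R (proj (word R l))) (X := fun l => hat P (word R l))
    (Z := fun l => hat proj (word R l)) (by simp) (fun l hl => geom_rec _ hl) (by simp)
    (fun l hl => geom_rec _ hl) (List.ofFn w) (i := i) (by simpa using hi)
  simp only [hword] at hs
  rw [hs, List.length_ofFn, splitSum_ofFn, map_sum, piKer, susp_sum, sum_apply]
  refine Finset.sum_congr rfl fun c _ => ?_
  rw [prefixProd_ofFn, map_sum, susp_sum, sum_apply]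
  refine Finset.sum_congr rfl fun m _ => ?_
  have hlen : (List.ofFn fun i => List.ofFn fun j => w (c.embedding i j)).map List.length =
      c.blocks := by
    rw [List.map_ofFn, ← c.ofFn_blocksFun]
    congr 1
    funext j
    simp
  rw [hlen]
  change _ = fam 2 μ (if c.sizeUpTo m = i then _ else 0)
  have hargs : (List.ofFn fun j => if j < m then
      TensorAlgebra.ι R (P (word R (List.ofFn fun a => w (c.embedding j a)))) else
      TensorAlgebra.ι R (proj (word R (List.ofFn fun a => w (c.embedding j a))))).prod =
      word R (List.ofFn fun j => if j < m then P (word R (List.ofFn fun a => w (c.embedding j a)))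
        else proj (word R (List.ofFn fun a => w (c.embedding j a)))) := by
    rw [word_ofFn_eq_prod]
    congr 2
    funext j
    split_ifs <;> rfl
  rw [hargs]
  by_cases h1 : c.sizeUpTo m = i
  swap
  · rw [if_neg h1, if_neg fun h => h1 (by omega)]
    simp
  rw [if_pos h1, fam_word_ofFn]
  by_cases h2 : 2 ≤ c.length
  swap
  · rw [if_neg h2, if_neg fun h => h2 h.1]
    simp
  rw [if_pos h2]
  by_cases h3 : ∀ j, m ≤ j → c.blocksFun j = 1
  swap
  · rw [if_neg fun h => h3 h.2.2]
    push Not at h3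
    obtain ⟨j, hj, hj1⟩ := h3
    rw [MultilinearMap.map_coord_zero _ j, susp_zero, zero_apply]
    rw [if_neg hj.not_gt, proj_word_ofFn, projFamily_of_ne hj1]
  rw [if_pos ⟨h2, by omega, h3⟩, ← sg_natCast, ← sg_congr (theta_blocks_sub_take c m h3),
    tcomp_congr c (μ c.length) (e' := fun j => (c.blocksFun j : ℤ) - 1) (G' := fun j =>
      if j < m then hpKer μ h (c.blocksFun j) else idOp V (c.blocksFun j)) _ (fun _ => rfl),
    susp_tcomp_even]
  · congr 1
    funext j
    split_ifs with hj
    · rw [hP, fam_of_le _ (c.one_le_blocksFun j)]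
    · exact susp_lin LinearMap.id _
  · intro j
    split_ifs with hj
    · exact (hasDegree_hpKer hμ hh _).hasParity
    · exact (HasDegree.idOp _).hasParity
  · intro j
    split_ifs with hj
    · simp
    · simp [h3 j (not_lt.1 hj)]

theorem prod_inL_inR {M : Type*} [AddCommGroup M] [Module R M] {k : ℕ} (i : ℕ) (w : Fin k → M) :
    (List.ofFn fun j : Fin k => if (j : ℕ) < i then inL (TensorAlgebra.ι R (w j))
      else inR (TensorAlgebra.ι R (w j))).prod =
    inL (word R ((List.ofFn w).take i)) * inR (word R ((List.ofFn w).drop i)) := by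
  induction k generalizing i with
  | zero => simp [Algebra.TensorProduct.one_def]
  | succ k ih =>
    rw [List.ofFn_succ, List.ofFn_succ, List.prod_cons]
    rcases i with _ | i
    · have := ih 0 fun j => w j.succ
      simp only [Nat.not_lt_zero, if_false] at this ⊢
      rw [this]
      simp
    · have := ih i fun j => w j.succ
      simp only [Fin.val_succ, Nat.add_lt_add_iff_right]
      rw [this, List.take_succ_cons, List.drop_succ_cons, word_cons, map_mul, mul_assoc]
      simp

/-- The `q`-recursion feeds `gf q` into the first inputs of `p_k^i`, and there `p_k^i` applies `hat
P`. Together these assemble to `hat χ` with `χ = P ∘ hat (gf q)`, so the auxiliary kernels drop out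
of the equation. -/
theorem fam_qKer (hμ : ∀ n : ℕ, 2 ≤ n → HasDegree ((n : ℤ) - 2) (μ n))
    (hh : LinHasDegree 1 h) {gf : Tot V →ₗ[R] Tot V} (hgf : LinHasDegree 0 gf) :
    fam 1 (qKer μ h gf) = proj + fam 2 μ ∘ₗ (((tmap (parity V)).toLinearMap ∘ₗ
      hat (fam 1 (hpKer μ h) ∘ₗ hat (gf ∘ₗ fam 1 (qKer μ h gf)))) ⋆
        (TensorAlgebra.ι R ∘ₗ h ∘ₗ fam 1 (qKer μ h gf)) ⋆ LinearMap.id) := by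
  set P := fam 1 (hpKer μ h) with hP
  set q := fam 1 (qKer μ h gf) with hq
  have hP1 : P 1 = 0 := fam_one _ _ le_rfl
  have hq1 : q 1 = 0 := fam_one _ _ le_rfl
  have hx1 : (gf ∘ₗ q) 1 = 0 := by simp [hq1]
  have hy1 : (h ∘ₗ q) 1 = 0 := by simp [hq1]
  have hparP : parity V ∘ₗ P = P ∘ₗ (tmap (parity V)).toLinearMap := by
    rw [hP, fam_comp_parity (d := 0) fun n _ => by
      simpa using (hasDegree_hpKer hμ hh n).hasParity]
    simp
  -- Since `P` is even, the parity operator moves inside and acts on the outputs of `gf q`, where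
  -- `midArgs` places it.
  have hX : (tmap (parity V)).toLinearMap ∘ₗ hat (P ∘ₗ hat (gf ∘ₗ q)) =
      hat P ∘ₗ hat (parity V ∘ₗ gf ∘ₗ q) := by
    rw [← map_comp_hat _ hx1, ← LinearMap.comp_assoc, hat_comp_map _ hP1, ← hparP,
      ← map_comp_hat _ hP1, LinearMap.comp_assoc, hat_comp (isCoalg_hat hx1) (by simp) hP1]
  have hsum {n : ℕ} (v : Fin n → Tot V) :
      fam 2 μ (((hat P ∘ₗ hat (parity V ∘ₗ gf ∘ₗ q)) ⋆ (TensorAlgebra.ι R ∘ₗ h ∘ₗ q) ⋆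
        LinearMap.id) (word R (List.ofFn v))) =
      ∑ c : Composition n, ∑ i : Fin c.length,
        susp (piKer μ h c.length (i + 1)) (midArgs (gf ∘ₗ q) (h ∘ₗ q) v c i) := by
    have e1 : inR.toLinearMap ∘ₗ ((TensorAlgebra.ι R ∘ₗ h ∘ₗ q) ⋆ LinearMap.id) =
        (inR.toLinearMap ∘ₗ TensorAlgebra.ι R ∘ₗ h ∘ₗ q) ⋆
          geom (inR.toLinearMap ∘ₗ TensorAlgebra.ι R ∘ₗ proj) := by
      rw [algHom_comp_conv, ← hat_proj, hat, algHom_comp_geom _ (by simp)]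
    have e2 : inL.toLinearMap ∘ₗ hat (parity V ∘ₗ gf ∘ₗ q) =
        geom (inL.toLinearMap ∘ₗ TensorAlgebra.ι R ∘ₗ parity V ∘ₗ gf ∘ₗ q) := by
      rw [hat, algHom_comp_geom _ (by simp [hq1])]
    -- The expansion is done in the tensor square: blocks before the odd one go to the left factor,
    -- the others to the right. Applying `hat P ⊗ id` and multiplying then treats exactly the first
    -- `i` letters by `hat P`.
    have e3 := mul_map_comp_conv (hat P) LinearMap.id (hat (parity V ∘ₗ gf ∘ₗ q))
      ((TensorAlgebra.ι R ∘ₗ h ∘ₗ q) ⋆ LinearMap.id)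
    rw [e1, e2, LinearMap.id_comp] at e3
    rw [← e3, LinearMap.comp_apply, LinearMap.comp_apply,
      geom_conv_conv_geom (by simp [hq1]) (by simp [hq1]), map_sum, map_sum, map_sum]
    refine Finset.sum_congr rfl fun c _ => ?_
    rw [map_sum, map_sum, map_sum]
    refine Finset.sum_congr rfl fun i _ => ?_
    rw [susp_piKer hμ hh i.2]
    congr 1
    have e4 := prod_inL_inR (R := R) (i : ℕ) (midArgs (gf ∘ₗ q) (h ∘ₗ q) v c i)
    have e5 : (List.ofFn fun j : Fin c.length => if (j : ℕ) < (i : ℕ) then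
        inL (TensorAlgebra.ι R (midArgs (gf ∘ₗ q) (h ∘ₗ q) v c i j))
        else inR (TensorAlgebra.ι R (midArgs (gf ∘ₗ q) (h ∘ₗ q) v c i j))) =
        List.ofFn fun j : Fin c.length => if j < i then
          (inL.toLinearMap ∘ₗ TensorAlgebra.ι R ∘ₗ parity V ∘ₗ gf ∘ₗ q)
            (word R (List.ofFn fun a => v (c.embedding j a)))
        else if j = i then (inR.toLinearMap ∘ₗ TensorAlgebra.ι R ∘ₗ h ∘ₗ q)
            (word R (List.ofFn fun a => v (c.embedding j a)))
        else (inR.toLinearMap ∘ₗ TensorAlgebra.ι R ∘ₗ proj)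
            (word R (List.ofFn fun a => v (c.embedding j a))) := by
      congr 1
      funext j
      simp only [midArgs, ← Fin.lt_def]
      split_ifs <;> rfl
    rw [← e5, e4]
    simp [hP]
  refine linearMap_ext_ofFn fun n v => ?_
  rw [LinearMap.add_apply, LinearMap.comp_apply, hX, hsum, hq, fam_word_ofFn]
  have hzero {k : ℕ} (hk : k < 2) (i : ℕ) : piKer μ h k i = 0 :=
    Finset.sum_eq_zero fun c _ => Finset.sum_eq_zero fun m _ =>
      if_neg (by have := c.length_le; omega)
  by_cases h1 : n = 1
  · subst h1
    rw [if_pos le_rfl, Finset.sum_eq_zero, add_zero, qKer, if_pos rfl]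
    · exact susp_lin LinearMap.id _
    · refine fun c _ => Finset.sum_eq_zero fun i _ => ?_
      rw [hzero (by have := c.length_le; omega)]
      simp
  · have h2 : susp (qKer μ h gf n) v = ∑ c : Composition n, ∑ i : Fin c.length,
        susp (piKer μ h c.length (i + 1)) (midArgs (gf ∘ₗ q) (h ∘ₗ q) v c i) := by
      rw [qKer, if_neg h1, susp_sum, sum_apply]
      refine Finset.sum_congr rfl fun c _ => ?_
      rw [susp_sum, sum_apply]
      refine Finset.sum_congr rfl fun i _ => ?_
      by_cases h3 : 2 ≤ c.length
      swap
      · rw [dif_neg fun h => h3 h.1, hzero (by omega)]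
        simp
      by_cases h4 : ∀ j, i < j → c.blocksFun j = 1
      swap
      · rw [dif_neg fun h => h4 h.2, susp_midArgs_eq_zero _ _ _ _ _ _ h4]
        simp
      rw [dif_pos ⟨h3, h4⟩]
      have h5 := susp_mid_term c i (piKer μ h c.length (i + 1))
        (X := fun n => gf.compMultilinearMap (qKer μ h gf n))
        (Y := fun n => h.compMultilinearMap (qKer μ h gf n))
        (fun n _ => ((HasDegree.comp hgf (hasDegree_qKer hμ hh hgf n)).congr
          (by ring)).hasParity)
        ((HasDegree.comp hh (hasDegree_qKer hμ hh hgf _)).congr (by ring)).hasParity h4 v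
      rw [fam_comp, fam_comp] at h5
      exact h5
    rw [proj_word_ofFn, projFamily_of_ne h1, zero_add, ← h2]
    split_ifs with hn
    · rfl
    · obtain rfl : n = 0 := by omega
      rw [h2]
      symm
      refine Finset.sum_eq_zero fun c _ => Finset.sum_eq_zero fun i _ => ?_
      rw [hzero (by have := c.length_le; omega)]
      simp

end Kernels

/-! ### The A∞-equations as equations for codifferentials -/

/-- The corestriction of the codifferential of an `A_∞`-structure. -/
def codiff (μ : ∀ n, Op V V n) : TensorAlgebra R (Tot V) →ₗ[R] Tot V :=
  diff V ∘ₗ proj + fam 2 μ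

theorem coder_add {M : Type*} [AddCommGroup M] [Module R M] (τ : M →ₗ[R] M)
    (a b : TensorAlgebra R M →ₗ[R] M) : coder τ (a + b) = coder τ a + coder τ b := by
  rw [coder, LinearMap.comp_add, add_conv, conv_add]
  rfl

theorem codiff_comp_coder_word {μ : ∀ n, Op V V n}
    (hμ : ∀ n : ℕ, 2 ≤ n → HasDegree ((n : ℤ) - 2) (μ n)) {n : ℕ} (hn : 2 ≤ n)
    (v : Fin n → Tot V) :
    codiff μ (coder (parity V) (codiff μ) (word R (List.ofFn v))) =
      susp (delta ((n : ℤ) - 2) (μ n)) v - susp (insertSum 2 μ μ n) v := by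
  have e1 (x) : proj (coder (parity V) (codiff μ) x) = codiff μ x :=
    LinearMap.congr_fun (proj_comp_coder _ _) x
  have e2 (x) : codiff μ x = diff V (proj x) + fam 2 μ x := rfl
  rw [susp_insertSum 2 μ fun n hn => (hμ n hn).hasParity.congr (by simp), susp_delta _ hn μ,
    e2, e1, e2, map_add, diff_diff, zero_add, codiff, coder_add, LinearMap.add_apply, map_add,
    sg_congr (b := 1) ⟨(n : ℤ) - 2, by ring⟩, sg_one, neg_one_smul]
  abel

theorem isStructure_iff {μ : ∀ n, Op V V n}
    (hμ : ∀ n : ℕ, 2 ≤ n → HasDegree ((n : ℤ) - 2) (μ n)) :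
    IsStructure V μ ↔ codiff μ ∘ₗ coder (parity V) (codiff μ) = 0 := by
  constructor
  · intro h
    refine linearMap_ext_ofFn fun n v => ?_
    by_cases hn : 2 ≤ n
    · rw [LinearMap.comp_apply, codiff_comp_coder_word hμ hn, (h n hn).2, sub_self]
      rfl
    -- On words of fewer than two letters `β` does not contribute, and the equation reduces to `D ∘
    -- D = 0`.
    · have e1 (x) : proj (coder (parity V) (codiff μ) x) = codiff μ x :=
        LinearMap.congr_fun (proj_comp_coder _ _) x
      have e2 (x) : codiff μ x = diff V (proj x) + fam 2 μ x := rfl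
      have e3 := susp_insertSum 2 μ (fun n hn => (hμ n hn).hasParity.congr (by simp)) v
      rw [insertSum_eq_zero (by omega), susp_zero, zero_apply, eq_comm, neg_eq_zero] at e3
      have e4 : fam 2 μ (coder (parity V) (diff V ∘ₗ proj) (word R (List.ofFn v))) = 0 := by
        rw [coder_diff_word_ofFn, map_sum]
        exact Finset.sum_eq_zero fun i _ => by rw [fam_word_ofFn, if_neg hn]
      rw [LinearMap.comp_apply, e2, e1, e2, map_add, diff_diff, fam_word_ofFn, if_neg hn]
      rw [codiff, coder_add, LinearMap.add_apply, map_add, e3, e4]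
      simp
  · intro h n hn
    refine ⟨hμ n hn, susp_injective fun v => ?_⟩
    rw [← sub_eq_zero, ← codiff_comp_coder_word hμ hn, ← LinearMap.comp_apply, h]
    rfl

/-- On words with `n` letters the two terms with the differential make up `δ`, and the others are
the two sums in the definition; the suspended degree is even, so the commutator carries a minus
sign. -/
theorem isMap_of_codiff_comp {μ : ∀ n, Op V V n} {ν : ∀ n, Op W W n} {φ : ∀ n, Op V W n}
    (hμ : ∀ n : ℕ, 2 ≤ n → HasDegree ((n : ℤ) - 2) (μ n))
    (hφ : ∀ n : ℕ, 1 ≤ n → HasDegree ((n : ℤ) - 1) (φ n))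
    (h : codiff ν ∘ₗ hat (fam 1 φ) = fam 1 φ ∘ₗ coder (parity V) (codiff μ)) :
    IsMap μ ν φ := by
  intro n hn
  refine ⟨hφ n hn, susp_injective fun v => ?_⟩
  have e0 := LinearMap.congr_fun h (word R (List.ofFn v))
  have e1 (x) : proj (hat (fam 1 φ) x) = fam 1 φ x :=
    LinearMap.congr_fun (proj_comp_hat (fam_one 1 φ le_rfl)) x
  have e2 (x) : codiff ν x = diff W (proj x) + fam 2 ν x := rfl
  rw [LinearMap.comp_apply, LinearMap.comp_apply, e2, e1, codiff, coder_add, LinearMap.add_apply,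
    map_add] at e0
  rw [susp_sub, susp_neg, sub_apply, neg_apply,
    susp_insertSum 1 φ fun n hn => (hμ n hn).hasParity.congr (by simp),
    susp_blockSum 2 ν fun n hn => (hφ n hn).hasParity, susp_delta _ hn φ,
    sg_congr (b := 0) ⟨(n : ℤ) - 1, by ring⟩, sg_zero, one_smul, eq_sub_of_add_eq e0]
  abel

theorem isHomotopyToId_of_codiff_comp {μ χ H : ∀ n, Op V V n}
    (hμ : ∀ n : ℕ, 2 ≤ n → HasDegree ((n : ℤ) - 2) (μ n))
    (hχ : ∀ n : ℕ, 1 ≤ n → HasDegree ((n : ℤ) - 1) (χ n))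
    (hH : ∀ n : ℕ, 1 ≤ n → HasDegree (n : ℤ) (H n))
    (h : codiff μ ∘ₗ (((tmap (parity V)).toLinearMap ∘ₗ hat (fam 1 χ)) ⋆
        (TensorAlgebra.ι R ∘ₗ fam 1 H) ⋆ LinearMap.id) +
      fam 1 H ∘ₗ coder (parity V) (codiff μ) = fam 1 χ - proj) :
    IsHomotopyToId μ χ H := by
  intro n hn
  refine ⟨hH n hn, susp_injective fun v => ?_⟩
  have e0 := LinearMap.congr_fun h (word R (List.ofFn v))
  have hχ1 := fam_one 1 χ le_rfl
  have e1 : proj ∘ₗ (((tmap (parity V)).toLinearMap ∘ₗ hat (fam 1 χ)) ⋆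
        (TensorAlgebra.ι R ∘ₗ fam 1 H) ⋆ LinearMap.id) = fam 1 H := by
    rw [map_comp_hat _ hχ1]
    exact proj_comp_hat_conv (by simp [hχ1]) isCoalg_id
  have e1' (x) := LinearMap.congr_fun e1 x
  simp only [LinearMap.comp_apply] at e1'
  have e2 (x) : codiff μ x = diff V (proj x) + fam 2 μ x := rfl
  rw [LinearMap.add_apply, LinearMap.comp_apply, LinearMap.comp_apply, e2, e1', codiff, coder_add,
    LinearMap.add_apply, map_add, LinearMap.sub_apply, fam_of_le χ hn] at e0
  rw [susp_sub, susp_add, susp_add, susp_neg, sub_apply, add_apply, add_apply, neg_apply,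
    susp_midSum 2 μ (fun n hn => (hχ n hn).hasParity) fun n hn => (hH n hn).hasParity,
    susp_insertSum 1 H fun n hn => (hμ n hn).hasParity.congr (by simp), susp_delta _ hn H,
    sg_congr (b := 1) ⟨(n : ℤ) - 1, by ring⟩, sg_one, neg_one_smul, sub_neg_eq_add]
  have e3 : susp (idOp V n) v = proj (word R (List.ofFn v)) := susp_lin LinearMap.id v
  rw [e3, add_sub_assoc, ← e0]
  abel

theorem fam_compMap (ψ : ∀ n, Op W U n) {φ : ∀ n, Op V W n}
    (hφ : ∀ n : ℕ, 1 ≤ n → HasDegree ((n : ℤ) - 1) (φ n)) :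
    fam 1 (compMap ψ φ) = fam 1 ψ ∘ₗ hat (fam 1 φ) := by
  refine linearMap_ext_ofFn fun n v => ?_
  rw [LinearMap.comp_apply, ← susp_blockSum 1 ψ fun n hn => (hφ n hn).hasParity, fam_word_ofFn]
  split_ifs with hn
  · rfl
  · rw [blockSum_eq_zero (by omega)]
    simp

theorem linHasDegree_comp_zero {f : Tot W →ₗ[R] Tot U} {g : Tot V →ₗ[R] Tot W}
    (hf : LinHasDegree 0 f) (hg : LinHasDegree 0 g) : LinHasDegree 0 (f ∘ₗ g) := by
  intro i x
  obtain ⟨y, hy⟩ := hg i x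
  have := hf (i + 0) y
  rw [LinearMap.comp_apply, ← hy]
  rwa [add_zero (i + 0)] at this

theorem parity_comp_chainTot (f : V ⟶ W) :
    parity W ∘ₗ chainTot f = chainTot f ∘ₗ parity V := by
  refine LinearMap.ext fun x => ?_
  simp [parity, (linHasDegree_chainTot f).koszul_comm]

theorem codiff_comp_parity {μ : ∀ n, Op V V n}
    (hμ : ∀ n : ℕ, 2 ≤ n → HasDegree ((n : ℤ) - 2) (μ n)) :
    codiff μ ∘ₗ (tmap (parity V)).toLinearMap = -(parity V ∘ₗ codiff μ) := by
  have h1 : proj ∘ₗ (tmap (parity V)).toLinearMap = parity V ∘ₗ proj := by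
    have := proj_comp_hat (C := parity V ∘ₗ proj) (by simp)
    rwa [← map_eq_hat] at this
  have h2 : diff V ∘ₗ parity V = -(parity V ∘ₗ diff V) := by
    refine LinearMap.ext fun x => ?_
    simp only [parity, LinearMap.comp_apply, LinearMap.neg_apply, map_neg,
      linHasDegree_diff.koszul_comm]
    rw [sg_congr (b := 1) (by decide)]
    simp
  rw [codiff, LinearMap.add_comp, LinearMap.comp_assoc, h1, ← LinearMap.comp_assoc, h2,
    fam_comp_parity (d := -1) fun n hn => (hμ n hn).hasParity.congr (by ring_nf; simp),
    sg_congr (b := 1) (by decide)]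
  simp only [sg_one, LinearMap.neg_comp, LinearMap.comp_add, LinearMap.comp_assoc, neg_one_smul]
  abel

theorem parity_comp_fam {F : ∀ n, Op V W n}
    (hF : ∀ n : ℕ, 1 ≤ n → HasDegree ((n : ℤ) - 1) (F n)) :
    parity W ∘ₗ fam 1 F = fam 1 F ∘ₗ (tmap (parity V)).toLinearMap := by
  rw [fam_comp_parity (d := 0) fun n hn => by simpa using (hF n hn).hasParity]
  simp

end

end AInfinity
-- The transfer theorem
theorem theorem1 {R : Type*} [CommRing R] (V W : ChainComplex (ModuleCat R) ℤ)
    (f : V ⟶ W) (g : W ⟶ V)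
    (h : Homotopy (CategoryTheory.CategoryStruct.comp f g) (CategoryTheory.CategoryStruct.id V))
    (μ : ∀ n, AInfinity.Op V V n) (hμ : AInfinity.IsStructure V μ) :
    AInfinity.IsStructure W (AInfinity.nu f g h μ) ∧
    (AInfinity.IsMap μ (AInfinity.nu f g h μ) (AInfinity.phi f g h μ) ∧
      AInfinity.phi f g h μ 1 = AInfinity.lin (AInfinity.chainTot f) 1) ∧
    (AInfinity.IsMap (AInfinity.nu f g h μ) μ (AInfinity.psi f g h μ) ∧
      AInfinity.psi f g h μ 1 = AInfinity.lin (AInfinity.chainTot g) 1) ∧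
    (AInfinity.IsHomotopyToId μ
        (AInfinity.compMap (AInfinity.psi f g h μ) (AInfinity.phi f g h μ))
        (AInfinity.bigH f g h μ) ∧
      AInfinity.bigH f g h μ 1 = AInfinity.lin (AInfinity.htpyTot h) 1) := by
  open AInfinity in
  have hμd : ∀ n : ℕ, 2 ≤ n → HasDegree ((n : ℤ) - 2) (μ n) := fun n hn => (hμ n hn).1
  have hf0 := linHasDegree_chainTot f
  have hg0 := linHasDegree_chainTot g
  have hh1 := linHasDegree_htpyTot h
  have hgf := linHasDegree_comp_zero hg0 hf0
  have hqd := hasDegree_qKer hμd hh1 hgf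
  have hνd : ∀ n : ℕ, 2 ≤ n → HasDegree ((n : ℤ) - 2) (nu f g h μ n) := fun n _ =>
    (HasDegree.comp hf0 ((hasDegree_pKer hμd hh1 n).compLinearMap fun _ => hg0)).congr (by ring)
  have hφd : ∀ n : ℕ, 1 ≤ n → HasDegree ((n : ℤ) - 1) (phi f g h μ n) := fun n _ =>
    (HasDegree.comp hf0 (hqd n)).congr (by ring)
  have hψd : ∀ n : ℕ, 1 ≤ n → HasDegree ((n : ℤ) - 1) (psi f g h μ n) := fun n _ =>
    (hasDegree_hpKer hμd hh1 n).compLinearMap fun _ => hg0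
  have hHd : ∀ n : ℕ, 1 ≤ n → HasDegree (n : ℤ) (bigH f g h μ n) := fun n _ =>
    (HasDegree.comp hh1 (hqd n)).congr (by ring)
  have hχd : ∀ n : ℕ, 1 ≤ n →
      HasDegree ((n : ℤ) - 1) (compMap (psi f g h μ) (phi f g h μ) n) := fun n _ =>
    (hasDegree_blockSum (a := -1) (fun k hk => (hψd k hk).congr (by ring))
      fun c _ j => hφd _ (c.one_le_blocksFun j)).congr (by ring)
  have hν : fam 2 (nu f g h μ) = chainTot f ∘ₗ fam 2 (pKer μ (htpyTot h)) ∘ₗ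
      (tmap (chainTot g)).toLinearMap := by
    rw [← fam_compLinearMap hg0, ← fam_comp]
    rfl
  have hψ : fam 1 (psi f g h μ) = fam 1 (hpKer μ (htpyTot h)) ∘ₗ
      (tmap (chainTot g)).toLinearMap := by
    rw [← fam_compLinearMap hg0]
    rfl
  have hφ : fam 1 (phi f g h μ) = chainTot f ∘ₗ
      fam 1 (qKer μ (htpyTot h) (chainTot g ∘ₗ chainTot f)) := by
    rw [← fam_comp]
    rfl
  have hH : fam 1 (bigH f g h μ) = htpyTot h ∘ₗ
      fam 1 (qKer μ (htpyTot h) (chainTot g ∘ₗ chainTot f)) := by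
    rw [← fam_comp]
    rfl
  have hχ := fam_compMap (psi f g h μ) hφd
  have hb : codiff μ ∘ₗ coder (parity V) (codiff μ) = 0 := (isStructure_iff hμd).1 hμ
  have hP := fam_hpKer (μ := μ) (h := htpyTot h)
  have hp := fam_pKer hμd hh1
  have hP1 : fam 1 (hpKer μ (htpyTot h)) 1 = 0 := fam_one _ _ le_rfl
  have hq1 : fam 1 (qKer μ (htpyTot h) (chainTot g ∘ₗ chainTot f)) 1 = 0 := fam_one _ _ le_rfl
  obtain ⟨h1, h2⟩ := transfer_structure (fam_two_letter μ) diff_diff diff_diff (chainTot_diff f)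
    (chainTot_diff g) rfl (parity_comp_chainTot g) (diff_htpyTot h) hb hP hp hP1
    (parity_comp_fam fun n _ => hasDegree_hpKer hμd hh1 n)
  rw [← hν] at h1 h2
  rw [← hψ] at h2
  have hφ1 : fam 1 (phi f g h μ) 1 = 0 := fam_one _ _ le_rfl
  have hq := fam_qKer hμd hh1 hgf
  -- Since `φ = f q` and `ψ = P ∘ tmap g`, the map occurring in the `q`-recursion is the composite
  -- `ψφ`.
  have hχ' : fam 1 (hpKer μ (htpyTot h)) ∘ₗ hat ((chainTot g ∘ₗ chainTot f) ∘ₗ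
      fam 1 (qKer μ (htpyTot h) (chainTot g ∘ₗ chainTot f))) =
      fam 1 (compMap (psi f g h μ) (phi f g h μ)) := by
    have e : (chainTot g ∘ₗ chainTot f) ∘ₗ
        fam 1 (qKer μ (htpyTot h) (chainTot g ∘ₗ chainTot f)) =
        chainTot g ∘ₗ fam 1 (phi f g h μ) := by
      rw [hφ]; rfl
    rw [e, ← map_comp_hat _ hφ1, hχ, hψ, LinearMap.comp_assoc]
  rw [hχ', ← hH] at hq
  obtain ⟨h3, h4⟩ := transfer_map_homotopy (fam_two_letter μ) diff_diff (chainTot_diff f) rfl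
    parity_parity (diff_htpyTot h) hb hP hp hP1 hν hψ h2 hφ hχ hH hq1 hq
    (parity_comp_fam hφd) (parity_comp_fam hχd)
    (by
      rw [fam_comp_parity (d := 1) fun n hn => by simpa using (hHd n hn).hasParity]
      simp)
    (codiff_comp_parity hμd)
  refine ⟨(isStructure_iff hνd).2 h1, ⟨isMap_of_codiff_comp hμd hφd h3, ?_⟩,
    ⟨isMap_of_codiff_comp hνd hψd h2, ?_⟩, isHomotopyToId_of_codiff_comp hμd hχd hHd h4, ?_⟩
  · refine MultilinearMap.ext fun v => ?_
    simp [phi, qKer, idOp, lin]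
  · refine MultilinearMap.ext fun v => ?_
    simp [psi, hpKer, idOp, lin]
  · refine MultilinearMap.ext fun v => ?_
    simp [bigH, qKer, idOp, lin]
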